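/- **Notation.** Let $C>4/3^{3/2}$, let $T_C(\xi)=-\xi^{8/3}+3C\xi^2-3$, let $0<\xi_{01}<\xi_{02}$ be its two positive zeros, $\xi_{00}=(\tfrac94C)^{3/2}\in(\xi_{01},\xi_{02})$, and $$\zeta_0(\xi)=\int_{\xi_{00}}^{\xi}\frac{\sqrt C\,\tau^{4/3}}{(-1+C\tau^2)\sqrt{T_C(\tau)}}\,d\tau ,\qquad \xi\in[\xi_{01},\xi_{02}],$$ with $\zeta_{0,-1}=\zeta_0(\xi_{01})$ and $\zeta_{0,1}=\zeta_0(\xi_{02})$ (convergent improper integrals). For $k\in\mathbb Z$, $c\in\mathbb R$ put $$\Phi_{C,k,c}(\xi,\theta)=\Big(\sqrt{1-\tfrac1{C\xi^2}}\cos(\zeta_0(\xi)+c),\,(-1)^k\sqrt{1-\tfrac1{C\xi^2}}\sin(\zeta_0(\xi)+c),\,\tfrac{\cos(\sqrt C\theta)}{\sqrt C\,\xi},\,\tfrac{\sin(\sqrt C\theta)}{\sqrt C\,\xi}\Big).$$ The piece $S_{C,k,c}\subset\mathbb S^3$ is the image of $D_C=(\xi_{01},\xi_{02})\times\mathbb R$;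 its boundary circles $\Gamma_{C,k,c}(e)$ are the images of $\{e\}\times\mathbb R$ for $e\in\{\xi_{01},\xi_{02}\}$. Two surfaces $S,S'$ are *glued along* a curve $\gamma:(a,b)\to\mathbb R^4$, $a<b$, if there is a $C^3$ immersion $X$ of an open neighbourhood of $\{0\}\times(a,b)$ in $\mathbb R^2$ into $\mathbb R^4$ with $X(0,s)=\gamma(s)$, $X(t,s)\in\overline S$ for $t\le0$ and $X(t,s)\in\overline{S'}$ for $t\ge0$. A sequence $(c_k)_{k\in\mathbb Z}$ satisfies the *recursion* for $C$ if, mod $2\pi$, $c_k\equiv-2\zeta_{0,1}-c_{k-1}$ for odd $k$ and $c_k\equiv-2\zeta_{0,-1}-c_{k-1}$ for even $k$. For $0<C^*<(C-4/3^{3/2})^{-1/2}$ let $h_0(\xi)=\int_{\xi_{00}}^{\xi}\sqrt{\frac{3\tau^2-(C^*)^2T_C(\tau)}{\tau^4T_C(\tau)}}\,d\tau$, $h_{0,-1}=h_0(\xi_{01})$, $h_{0,1}=h_0(\xi_{02})$, $L=h_{0,1}-h_{0,-1}$, $I_k=[h_{0,-1}+kL,\,h_{0,-1}+(k+1)L]$,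 and $h_k=kL+h_0$ for even $k$, $h_k=(k+1)h_{0,1}-(k-1)h_{0,-1}-h_0$ for odd $k$. Let $F:\mathbb R\to[\xi_{01},\xi_{02}]$ be the function equal to $h_k^{-1}$ on $I_k$, and for $(c_k)$ satisfying the recursion let $\Phi_{C,C^*,(c_k)}(h,\theta)=\Phi_{C,k,c_k}(F(h),\theta)$ for $h\in I_k$, $\theta\in\mathbb R$. A *complete immersion* is a $C^3$ immersion $\Psi:\mathbb R^2\to\mathbb S^3$ whose induced metric is complete. It is *biconservative* if $A(\operatorname{grad}f)=-\frac f2\operatorname{grad}f$, where $A$ is its shape operator in $\mathbb S^3$ and $f=\operatorname{trace}A$. It is *obtained by gluing the pieces* $A_k(S_{C_k,k,c_k})$, $k\in\mathbb Z$, with $C_k>4/3^{3/2}$, $c_k\in\mathbb R$ and $A_k\in O(4)$, if there are $\dots<t_{-1}<t_0<t_1<\dots$ with $t_k\to\pm\infty$ as $k\to\pm\infty$ and, for every $k$, a continuous bijection $\omega_k:(t_k,t_{k+1})\times\mathbb R\to D_{C_k}$ with $\Psi=A_k\circ\Phi_{C_k,k,c_k}\circ\omega_k$ on $(t_k,t_{k+1})\times\mathbb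 R$. **Proposition.** Let $C,C'>4/3^{3/2}$. 1. $\overline{S_{C,k,c}}\setminus S_{C,k,c}=\Gamma_{C,k,c}(\xi_{01})\cup\Gamma_{C,k,c}(\xi_{02})$. 2. If $S_{C,k,c}$ and $S_{C',l,c'}$ are glued along $\gamma$, then $C=C'$ and either the two pieces coincide and $\gamma$ lies in them, or there is $e\in\{\xi_{01},\xi_{02}\}$ such that $\gamma$ lies in $\Gamma_{C,k,c}(e)\cap\Gamma_{C',l,c'}(e)$, $k+l$ is odd, and $c'\equiv-2\zeta_0(e)-c\pmod{2\pi}$. 3. Conversely, if $e\in\{\xi_{01},\xi_{02}\}$, $k+l$ is odd and $c'\equiv-2\zeta_0(e)-c\pmod{2\pi}$, then $S_{C,k,c}$ and $S_{C,l,c'}$ are glued along $\theta\mapsto\Phi_{C,k,c}(e,\theta)$, $\theta\in(a,b)$, for all $a<b$. 4. If $S_{C,k,c}$ and $A(S_{C',l,c'})$, with $A\in O(4)$, are glued along $\gamma$, then $C=C'$ and either $A(S_{C',l,c'})=S_{C,k,c}$ and $\gamma$ lies in this surface, or there is $e\in\{\xi_{01},\xi_{02}\}$ such that $\gamma$ lies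 in $\Gamma_{C,k,c}(e)\cap A(\Gamma_{C',l,c'}(e))$ and $A(S_{C',l,c'})=S_{C,k+1,-2\zeta_0(e)-c}$. 5. For every admissible $C^*$ and every $(c_k)$ satisfying the recursion for $C$, $\Phi_{C,C^*,(c_k)}$ is a complete biconservative immersion obtained by gluing the pieces $S_{C,k,c_k}$, $k\in\mathbb Z$, with $t_k=h_{0,-1}+kL$. 6. (Uniqueness.) Let $\Psi$ be a complete immersion obtained by gluing pieces $A_k(S_{C_k,k,c_k})$, $k\in\mathbb Z$. Then $C_k=C_0$ for all $k$. If every $A_k$ is the identity, then $(c_k)$ or $(c_{-k})$ satisfies the recursion for $C_0$. Moreover, for every $C^*$ admissible for $C_0$ there are a sequence $(c'_k)$ satisfying the recursion for $C_0$, with $c'_0=c_0$, and a $C^3$ diffeomorphism $\omega$ of $\mathbb R^2$ such that $\Psi=A_0\circ\Phi_{C_0,C^*,(c'_k)}\circ\omega$. In particular, if $A_0$ is the identity, then $\Psi$ is a reparametrization of $\Phi_{C_0,C^*,(c'_k)}$. -/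

import Mathlib

open Set Filter Topology

noncomputable section

namespace BiconsSphere

/-- The ambient space `ℝ⁴` of the unit sphere `𝕊³`. -/
abbrev E4 := EuclideanSpace ℝ (Fin 4)

/-! ### The constants and functions attached to `C` -/

/-- The threshold `4 / 3^{3/2}` for the parameter `C`. -/
def critC : ℝ := 4 / (3 : ℝ) ^ (3 / 2 : ℝ)

/-- `T(ξ) = -ξ^{8/3} + 3 C ξ² - 3`. -/
def T (C ξ : ℝ) : ℝ := -ξ ^ (8 / 3 : ℝ) + 3 * C * ξ ^ 2 - 3

/-- The smallest positive zero of `T`. -/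
def xi01 (C : ℝ) : ℝ := sInf {ξ : ℝ | 0 < ξ ∧ T C ξ = 0}

/-- The largest positive zero of `T` (for `C > critC` there are exactly two positive zeros). -/
def xi02 (C : ℝ) : ℝ := sSup {ξ : ℝ | 0 < ξ ∧ T C ξ = 0}

/-- The base point of the integrals. -/
def xi00 (C : ℝ) : ℝ := (9 / 4 * C) ^ (3 / 2 : ℝ)

/-- The angular function `ζ₀`. The integrand has only inverse square root singularities at
`ξ₀₁` and `ξ₀₂`, hence it is integrable on `[ξ₀₁, ξ₀₂]`, and the values at the two end points are
the one-sided limits `ζ_{0,-1}` and `ζ_{0,1}`. -/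
def zeta0 (C ξ : ℝ) : ℝ :=
  ∫ τ in (xi00 C)..ξ,
    Real.sqrt C * τ ^ (4 / 3 : ℝ) / ((-1 + C * τ ^ 2) * Real.sqrt (T C τ))

/-- `ζ_{0,-1}`, the limit of `ζ₀` at `ξ₀₁`. -/
def zetaM (C : ℝ) : ℝ := zeta0 C (xi01 C)

/-- `ζ_{0,1}`, the limit of `ζ₀` at `ξ₀₂`. -/
def zetaP (C : ℝ) : ℝ := zeta0 C (xi02 C)

/-! ### The pieces `S_{C, c_k}` -/

/-- The domain `D_C = (ξ₀₁, ξ₀₂) × ℝ`. -/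
def D (C : ℝ) : Set (ℝ × ℝ) := Ioo (xi01 C) (xi02 C) ×ˢ univ

/-- The parametrization of the `k`-th piece with phase constant `c` (only the parity of `k`
matters), given by the same formula on the closed strip `[ξ₀₁, ξ₀₂] × ℝ`. -/
def pieceMap (C : ℝ) (k : ℤ) (c : ℝ) (p : ℝ × ℝ) : E4 :=
  !₂[Real.sqrt (1 - 1 / (C * p.1 ^ 2)) * Real.cos (zeta0 C p.1 + c),
     (-1 : ℝ) ^ k * (Real.sqrt (1 - 1 / (C * p.1 ^ 2)) * Real.sin (zeta0 C p.1 + c)),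
     Real.cos (Real.sqrt C * p.2) / (Real.sqrt C * p.1),
     Real.sin (Real.sqrt C * p.2) / (Real.sqrt C * p.1)]

/-- The surface `S_{C, c_k}` in `𝕊³`, with `c = c_k`. -/
def piece (C : ℝ) (k : ℤ) (c : ℝ) : Set E4 := pieceMap C k c '' D C

/-- The boundary circle of the piece that corresponds to `ξ = e`, where `e` is one of
`ξ₀₁`, `ξ₀₂`. -/
def bdryCircle (C : ℝ) (k : ℤ) (c e : ℝ) : Set E4 := range fun θ : ℝ => pieceMap C k c (e, θ)

/-- `S` and `S'` are glued, at the level of `C³` smoothness, along the curve `γ` on `(a, b)`: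
there is an immersed surface patch `X` of class `C³` with `X (0, s) = γ s`, whose side `t ≤ 0` lies
in the closure of `S` and whose side `t ≥ 0` lies in the closure of `S'`. -/
def GluedAlong (S S' : Set E4) (γ : ℝ → E4) (a b : ℝ) : Prop :=
  ∃ (U : Set (ℝ × ℝ)) (X : ℝ × ℝ → E4),
    IsOpen U ∧ ({0} : Set ℝ) ×ˢ Ioo a b ⊆ U ∧
    ContDiffOn ℝ 3 X U ∧ (∀ p ∈ U, Function.Injective (fderiv ℝ X p)) ∧
    (∀ s ∈ Ioo a b, X (0, s) = γ s) ∧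
    (∀ p ∈ U, p.1 ≤ 0 → X p ∈ closure S) ∧
    (∀ p ∈ U, 0 ≤ p.1 → X p ∈ closure S')

/-- The recursion (mod `2π`) between consecutive phase constants. -/
def PhaseRec (C : ℝ) (c : ℤ → ℝ) : Prop :=
  ∀ k : ℤ,
    (Odd k → c k ≡ -2 * zetaP C - c (k - 1) [PMOD (2 * Real.pi)]) ∧
    (Even k → c k ≡ -2 * zetaM C - c (k - 1) [PMOD (2 * Real.pi)])

/-! ### The complete surfaces `Φ_{C, C*}` -/

/-- The admissible values of `C*`. -/
def AdmissibleStar (C Cs : ℝ) : Prop := 0 < Cs ∧ Cs < (C - critC) ^ (-(1 / 2) : ℝ)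

/-- The height function `h₀` of the profile curve (again integrable up to the end points). -/
def h0 (C Cs ξ : ℝ) : ℝ :=
  ∫ τ in (xi00 C)..ξ,
    Real.sqrt ((3 * τ ^ 2 - Cs ^ 2 * T C τ) / (τ ^ 4 * T C τ))

/-- `h_{0,-1}`. -/
def h0M (C Cs : ℝ) : ℝ := h0 C Cs (xi01 C)

/-- `h_{0,1}`. -/
def h0P (C Cs : ℝ) : ℝ := h0 C Cs (xi02 C)

/-- The left end point of the interval of the `k`-th piece. The `k`-th piece lives on
`[node k, node (k + 1)]`, that is, on `[h_{0,k}, h_{0,k+1}]` for `k ≥ 1`, on `[h_{0,-1}, h_{0,1}]`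
for `k = 0`, and on `[h_{0,k-1}, h_{0,k}]` for `k ≤ -1`, where
`h_{0,k} = k h_{0,1} - (k - 1) h_{0,-1}` for `k ≥ 1` and
`h_{0,k} = -k h_{0,-1} + (k + 1) h_{0,1}` for `k ≤ -1`. -/
def node (C Cs : ℝ) (k : ℤ) : ℝ := h0M C Cs + k * (h0P C Cs - h0M C Cs)

/-- The index of the piece that contains the height `h`. -/
def pieceIndex (C Cs h : ℝ) : ℤ := ⌊(h - h0M C Cs) / (h0P C Cs - h0M C Cs)⌋

/-- The functions `h_k`, obtained from `h₀` by successive reflections. -/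
def hk (C Cs : ℝ) (k : ℤ) (ξ : ℝ) : ℝ :=
  if Even k then k * (h0P C Cs - h0M C Cs) + h0 C Cs ξ
  else (k + 1) * h0P C Cs - (k - 1) * h0M C Cs - h0 C Cs ξ

/-- The periodic function `F`, equal to the inverse of `h_k` on the interval of the `k`-th
piece. -/
def F (C Cs h : ℝ) : ℝ :=
  Function.invFunOn (hk C Cs (pieceIndex C Cs h)) (Icc (xi01 C) (xi02 C)) h

/-- The map `Φ_{C, C*}` with phase constants `c_k`. -/
def Phi (C Cs : ℝ) (c : ℤ → ℝ) (p : ℝ × ℝ) : E4 :=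
  pieceMap C (pieceIndex C Cs p.1) (c (pieceIndex C Cs p.1)) (F C Cs p.1, p.2)

/-! ### Complete immersed surfaces -/

/-- The length of the curve `σ`, parametrized by `[0, 1]`, in the metric induced by `Ψ`. -/
def curveLength (Ψ : ℝ × ℝ → E4) (σ : ℝ → ℝ × ℝ) : ℝ :=
  ∫ u in (0 : ℝ)..1, ‖fderiv ℝ Ψ (σ u) (deriv σ u)‖

/-- The distance of the metric induced by `Ψ`: the infimum of the lengths of `C¹` curves. -/
def surfDist (Ψ : ℝ × ℝ → E4) (p q : ℝ × ℝ) : ℝ :=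
  sInf {l : ℝ | ∃ σ : ℝ → ℝ × ℝ, ContDiff ℝ 1 σ ∧ σ 0 = p ∧ σ 1 = q ∧ l = curveLength Ψ σ}

/-- `Ψ : ℝ² → 𝕊³` is an immersion of class `C³` and the induced metric is complete. -/
structure IsCompleteImmersion (Ψ : ℝ × ℝ → E4) : Prop where
  contDiff : ContDiff ℝ 3 Ψ
  sphere : ∀ p, ‖Ψ p‖ = 1
  immersion : ∀ p, Function.Injective (fderiv ℝ Ψ p)
  complete : ∀ u : ℕ → ℝ × ℝ,
    (∀ ε > 0, ∃ N, ∀ m ≥ N, ∀ n ≥ N, surfDist Ψ (u m) (u n) < ε) →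
      ∃ p, Tendsto u atTop (𝓝 p)

/-! ### Biconservative immersions -/

/-- The `i`-th partial derivative of a map defined on `ℝ²`. -/
def pd {V : Type*} [NormedAddCommGroup V] [NormedSpace ℝ V] (i : Fin 2) (X : ℝ × ℝ → V)
    (p : ℝ × ℝ) : V :=
  fderiv ℝ X p ((![(1, 0), (0, 1)] : Fin 2 → ℝ × ℝ) i)

/-- The matrix of the first fundamental form. -/
def firstForm (X : ℝ × ℝ → E4) (p : ℝ × ℝ) : Matrix (Fin 2) (Fin 2) ℝ :=
  Matrix.of fun i j => inner ℝ (pd i X p) (pd j X p)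

/-- The matrix of the second fundamental form in `𝕊³` with respect to the unit normal `η`. -/
def secondForm (X η : ℝ × ℝ → E4) (p : ℝ × ℝ) : Matrix (Fin 2) (Fin 2) ℝ :=
  Matrix.of fun i j => inner ℝ (η p) (pd i (pd j X) p)

/-- The matrix of the shape operator `A`. -/
def shapeOp (X η : ℝ × ℝ → E4) (p : ℝ × ℝ) : Matrix (Fin 2) (Fin 2) ℝ :=
  (firstForm X p)⁻¹ * secondForm X η p

/-- The mean curvature function `f = trace A`. -/
def meanCurv (X η : ℝ × ℝ → E4) (p : ℝ × ℝ) : ℝ := (shapeOp X η p).trace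

/-- The components of the gradient of `f` with respect to the induced metric. -/
def gradient (X : ℝ × ℝ → E4) (f : ℝ × ℝ → ℝ) (p : ℝ × ℝ) : Fin 2 → ℝ :=
  (firstForm X p)⁻¹.mulVec fun i => pd i f p

/-- The immersed surface `X : ℝ² → 𝕊³` is biconservative: `A (grad f) = -(f / 2) grad f`. -/
def IsBiconservative (X : ℝ × ℝ → E4) : Prop :=
  ∃ η : ℝ × ℝ → E4, Continuous η ∧
    (∀ p, ‖η p‖ = 1 ∧ inner ℝ (η p) (X p) = 0 ∧ ∀ i, inner ℝ (η p) (pd i X p) = 0) ∧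
    ∀ p, (shapeOp X η p).mulVec (gradient X (meanCurv X η) p) =
      (-(meanCurv X η p / 2)) • gradient X (meanCurv X η) p

/-! ### Surfaces obtained by gluing pieces -/

/-- `Ψ` is obtained by gluing consecutively the pieces `A_k (S_{C_k, c_k})`, `k ∈ ℤ`, where the
`A_k` are isometries of `𝕊³`: the lines `{t_k} × ℝ` cut the plane into the strips
`(t_k, t_{k+1}) × ℝ`, and on the `k`-th strip `Ψ` is a reparametrization of `A_k (S_{C_k, c_k})`. -/
def IsPieceChain (Ψ : ℝ × ℝ → E4) (t : ℤ → ℝ) (Cc c : ℤ → ℝ) (A : ℤ → E4 ≃ₗᵢ[ℝ] E4) : Prop :=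
  StrictMono t ∧ (∀ x : ℝ, ∃ k, t k ≤ x ∧ x < t (k + 1)) ∧
  ∀ k, critC < Cc k ∧
    ∃ ω : ℝ × ℝ → ℝ × ℝ,
      ContinuousOn ω (Ioo (t k) (t (k + 1)) ×ˢ univ) ∧
      BijOn ω (Ioo (t k) (t (k + 1)) ×ˢ univ) (D (Cc k)) ∧
      ∀ p ∈ Ioo (t k) (t (k + 1)) ×ˢ (univ : Set ℝ),
        Ψ p = A k (pieceMap (Cc k) k (c k) (ω p))

end BiconsSphere

end

open BiconsSphere Set

/-!
# Biconservative surfaces in the sphere glued from rotational pieces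

A piece is a rotational surface whose profile curve, in the orthonormal frame given by its position
`Y`, its unit tangent `e` and its normal `η`, satisfies a system of ordinary differential equations
with smooth coefficients (`ProfileFlow`). The singularities of `ζ₀` and `h₀` at the ends of
`[ξ₀₁, ξ₀₂]` come only from the choice of `ξ` as a parameter: in the variable `h` the functions
`ρ = 1 / (√C ξ)`, its derivative `α` by arc length and the position in the first plane extend across
the nodes exactly when the phases satisfy the recursion, and they solve the system there
as well (`profile`). Hence `Φ_{C, C*}` is as smooth as a solution of the system. The principal
curvatures are `κ` and `-3 κ`, with `κ` constant on the parallels, which is the biconservative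
equation; the differential is bounded below, which yields completeness. The same computation applies
to `C* = 0`, where `h` is the arc length of the meridians, and this case is used for all auxiliary
purposes.

For the rigidity of gluing, a patch `X` that lies in the closure of a piece for `t ≤ 0` lifts there
to the parameter plane (`exists_sideLift`). Since `X` is of class `C³`, its position, differential
and second derivatives along `t = 0` can be computed from either side. The second
fundamental forms have eigenvalues `κ, -3 κ` on the one side and `κ', -3 κ'` on the other, so
`κ = κ'` and the frames agree up to signs (`frame_match`). One more derivative along the curve
gives the equality of `α / ρ`, hence of all data of the two pieces (`exists_frameContact`).
The isometry is therefore determined by the frames, and it carries the second piece either to the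
first one or, if `α = 0`, to its continuation across a boundary circle
(`FrameContact.carriesPiece`). In the first case the contact cannot take place at the boundary,
because the height of the lift would have a critical point there (`mem_Ioo_of_patch`).

For uniqueness, every closed strip of a glued surface is parametrized by a closed piece
(`exists_stripParam`); the boundary of the strip goes to the boundary of the piece, and by
completeness the meridians reach both boundary circles (`StripParam.exists_boundary`), so the
boundary values of `ξ` alternate along the chain. By rigidity all constants agree and the moved
pieces are the consecutive pieces of one surface `Φ_{C, C*}`, moved by `A 0`. The height and a
continuous angle of rotation then define a bijective local diffeomorphism of the plane
(`exists_reparam`).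
-/

namespace BiconsSphere

/-! ### The function `T` and its zeros and its zeros -/

lemma rpow_two_thirds_pow (y : ℝ) (hy : 0 ≤ y) (n m : ℕ) (q : ℝ) (hq : (n : ℝ) * q = m) :
    (y ^ n) ^ q = y ^ m := by
  rw [← Real.rpow_natCast y n, ← Real.rpow_mul hy, hq, Real.rpow_natCast]

lemma T_cube (C : ℝ) {x : ℝ} (hx : 0 ≤ x) : T C (x ^ 3) = -x ^ 8 + 3 * C * x ^ 6 - 3 := by
  unfold T
  rw [rpow_two_thirds_pow x hx 3 8 (8 / 3) (by norm_num)]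
  ring

/-- A positive real is the cube of its cube root; this removes all fractional exponents. -/
lemma exists_cube {ξ : ℝ} (h : 0 < ξ) : ∃ x : ℝ, 0 < x ∧ ξ = x ^ 3 :=
  ⟨ξ ^ (1 / 3 : ℝ), by positivity, by
    rw [← Real.rpow_natCast, ← Real.rpow_mul h.le]; norm_num⟩

lemma critC_pos : 0 < critC := by unfold critC; positivity

lemma critC_eq : critC * (Real.sqrt 3 * 3) = 4 := by
  unfold critC
  have : (3 : ℝ) ^ (3 / 2 : ℝ) = Real.sqrt 3 * 3 := by
    rw [Real.sqrt_eq_rpow, show (3 / 2 : ℝ) = 1 / 2 + 1 by norm_num,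
      Real.rpow_add (by norm_num), Real.rpow_one]
  rw [this]; field_simp

lemma critC_pow_four : critC ^ 4 = 256 / 729 := by
  have h := critC_eq
  have h3 : Real.sqrt 3 ^ 2 = 3 := Real.sq_sqrt (by norm_num)
  have : critC ^ 4 * ((Real.sqrt 3 ^ 2) ^ 2 * 81) = 256 := by
    calc _ = (critC * (Real.sqrt 3 * 3)) ^ 4 := by ring
      _ = 256 := by rw [h]; norm_num
  rw [h3] at this; linarith

lemma hasDerivAt_T (C : ℝ) {ξ : ℝ} (h : 0 < ξ) :
    HasDerivAt (T C) (ξ * (6 * C - 8 / 3 * ξ ^ (2 / 3 : ℝ))) ξ := by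
  have h1 := ((Real.hasDerivAt_rpow_const (x := ξ) (p := 8 / 3) (Or.inl h.ne')).neg.add
    ((hasDerivAt_pow 2 ξ).const_mul (3 * C))).sub_const 3
  refine (h1.congr_deriv ?_)
  have : ξ ^ ((8 : ℝ) / 3 - 1) = ξ * ξ ^ (2 / 3 : ℝ) := by
    nth_rewrite 2 [← Real.rpow_one ξ]
    rw [← Real.rpow_add h]; norm_num
  rw [this]; push_cast; ring

lemma continuous_T (C : ℝ) : Continuous (T C) := by
  unfold T
  have : Continuous fun ξ : ℝ => ξ ^ (8 / 3 : ℝ) := Real.continuous_rpow_const (by norm_num)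
  fun_prop

section
variable {C : ℝ} (hC : critC < C)
include hC

lemma C_pos : 0 < C := critC_pos.trans hC

lemma xi00_pos : 0 < xi00 C := by
  unfold xi00; have := C_pos hC; positivity

lemma xi00_rpow : xi00 C ^ (2 / 3 : ℝ) = 9 / 4 * C := by
  unfold xi00; have := C_pos hC
  rw [← Real.rpow_mul (by positivity)]; norm_num

lemma T_xi00_pos : 0 < T C (xi00 C) := by
  have hc := C_pos hC
  have h : xi00 C = Real.sqrt (9 / 4 * C) ^ 3 := by
    unfold xi00
    rw [Real.sqrt_eq_rpow, ← Real.rpow_natCast, ← Real.rpow_mul (by positivity)]; norm_num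
  have hs : Real.sqrt (9 / 4 * C) ^ 2 = 9 / 4 * C := Real.sq_sqrt (by positivity)
  rw [h, T_cube C (Real.sqrt_nonneg _)]
  have h4 : critC ^ 4 < C ^ 4 := pow_lt_pow_left₀ hC critC_pos.le (by norm_num)
  rw [critC_pow_four] at h4
  have : -Real.sqrt (9 / 4 * C) ^ 8 + 3 * C * Real.sqrt (9 / 4 * C) ^ 6 - 3
    = -(Real.sqrt (9 / 4 * C) ^ 2) ^ 4 + 3 * C * (Real.sqrt (9 / 4 * C) ^ 2) ^ 3 - 3 := by ring
  rw [this, hs]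
  nlinarith

lemma deriv_T_pos {ξ : ℝ} (h0 : 0 < ξ) (h : ξ < xi00 C) :
    0 < ξ * (6 * C - 8 / 3 * ξ ^ (2 / 3 : ℝ)) := by
  have := Real.rpow_lt_rpow h0.le h (show (0 : ℝ) < 2 / 3 by norm_num)
  rw [xi00_rpow hC] at this
  exact mul_pos h0 (by linarith)

lemma deriv_T_neg {ξ : ℝ} (h : xi00 C < ξ) :
    ξ * (6 * C - 8 / 3 * ξ ^ (2 / 3 : ℝ)) < 0 := by
  have := Real.rpow_lt_rpow (xi00_pos hC).le h (show (0 : ℝ) < 2 / 3 by norm_num)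
  rw [xi00_rpow hC] at this
  exact mul_neg_of_pos_of_neg ((xi00_pos hC).trans h) (by linarith)

lemma strictMonoOn_T : StrictMonoOn (T C) (Icc 0 (xi00 C)) := by
  refine strictMonoOn_of_deriv_pos (convex_Icc _ _) (continuous_T C).continuousOn ?_
  intro x hx
  rw [interior_Icc] at hx
  rw [(hasDerivAt_T C hx.1).deriv]
  exact deriv_T_pos hC hx.1 hx.2

lemma strictAntiOn_T : StrictAntiOn (T C) (Ici (xi00 C)) := by
  refine strictAntiOn_of_deriv_neg (convex_Ici _) (continuous_T C).continuousOn ?_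
  intro x hx
  rw [interior_Ici] at hx
  rw [(hasDerivAt_T C ((xi00_pos hC).trans hx)).deriv]
  exact deriv_T_neg hC hx

lemma exists_zeros : ∃ z₁ z₂ : ℝ, 0 < z₁ ∧ z₁ < xi00 C ∧ xi00 C < z₂ ∧ T C z₁ = 0 ∧ T C z₂ = 0 ∧
    {ξ : ℝ | 0 < ξ ∧ T C ξ = 0} = {z₁, z₂} := by
  have hp := T_xi00_pos hC
  have h0 := xi00_pos hC
  have hc := C_pos hC
  have hT0 : T C 0 = -3 := by
    unfold T; rw [Real.zero_rpow (by norm_num)]; norm_num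
  obtain ⟨z₁, hz₁, hz₁'⟩ := intermediate_value_Icc h0.le (continuous_T C).continuousOn
    (show (0 : ℝ) ∈ Icc (T C 0) (T C (xi00 C)) by rw [hT0]; exact ⟨by norm_num, hp.le⟩)
  have hbig : ∃ M, xi00 C ≤ M ∧ T C M ≤ 0 := by
    refine ⟨(xi00 C + (3 * C + 1)) ^ 3, ?_, ?_⟩
    · have : (1 : ℝ) ≤ xi00 C + (3 * C + 1) := by linarith
      calc xi00 C ≤ xi00 C + (3 * C + 1) := by linarith
        _ ≤ _ := le_self_pow₀ this (by norm_num)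
    · rw [T_cube C (by positivity)]
      set y := xi00 C + (3 * C + 1)
      have hy1 : (1 : ℝ) ≤ y := by simp only [y]; linarith
      have hy2 : 3 * C ≤ y ^ 2 := by
        have : 3 * C ≤ y := by simp only [y]; linarith
        nlinarith
      have : 3 * C * y ^ 6 ≤ y ^ 2 * y ^ 6 := by gcongr
      nlinarith
  obtain ⟨M, hM, hTM⟩ := hbig
  obtain ⟨z₂, hz₂, hz₂'⟩ := intermediate_value_Icc' hM (continuous_T C).continuousOn
    (show (0 : ℝ) ∈ Icc (T C M) (T C (xi00 C)) from ⟨hTM, hp.le⟩)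
  have h1 : 0 < z₁ := lt_of_le_of_ne hz₁.1 (by rintro rfl; rw [hT0] at hz₁'; norm_num at hz₁')
  have h2 : z₁ < xi00 C := lt_of_le_of_ne hz₁.2 (by rintro rfl; exact hp.ne' hz₁')
  have h3 : xi00 C < z₂ := lt_of_le_of_ne hz₂.1 (by rintro rfl; exact hp.ne' hz₂')
  refine ⟨z₁, z₂, h1, h2, h3, hz₁', hz₂', ?_⟩
  ext ξ
  simp only [mem_ofPred_eq, mem_insert_iff, mem_singleton_iff]
  constructor
  · rintro ⟨hξ, hT⟩
    rcases le_total ξ (xi00 C) with hle | hle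
    · left
      exact (strictMonoOn_T hC).injOn ⟨hξ.le, hle⟩ ⟨h1.le, h2.le⟩ (by rw [hT, hz₁'])
    · right
      exact (strictAntiOn_T hC).injOn hle h3.le (by rw [hT, hz₂'])
  · rintro (rfl | rfl)
    · exact ⟨h1, hz₁'⟩
    · exact ⟨h0.trans h3, hz₂'⟩

lemma xi_spec : 0 < xi01 C ∧ xi01 C < xi00 C ∧ xi00 C < xi02 C ∧
    T C (xi01 C) = 0 ∧ T C (xi02 C) = 0 := by
  obtain ⟨z₁, z₂, h1, h2, h3, h4, h5, h6⟩ := exists_zeros hC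
  have e1 : xi01 C = z₁ := by
    unfold xi01; rw [h6, csInf_pair]; exact inf_eq_left.2 (h2.trans h3).le
  have e2 : xi02 C = z₂ := by
    unfold xi02; rw [h6, csSup_pair]; exact sup_eq_right.2 (h2.trans h3).le
  rw [e1, e2]; exact ⟨h1, h2, h3, h4, h5⟩

lemma xi01_pos : 0 < xi01 C := (xi_spec hC).1
lemma xi01_lt_xi00 : xi01 C < xi00 C := (xi_spec hC).2.1
lemma xi00_lt_xi02 : xi00 C < xi02 C := (xi_spec hC).2.2.1
lemma T_xi01 : T C (xi01 C) = 0 := (xi_spec hC).2.2.2.1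
lemma T_xi02 : T C (xi02 C) = 0 := (xi_spec hC).2.2.2.2
lemma xi01_lt_xi02 : xi01 C < xi02 C := (xi01_lt_xi00 hC).trans (xi00_lt_xi02 hC)
lemma xi00_mem : xi00 C ∈ Icc (xi01 C) (xi02 C) :=
  ⟨(xi01_lt_xi00 hC).le, (xi00_lt_xi02 hC).le⟩

lemma T_pos {ξ : ℝ} (h : ξ ∈ Ioo (xi01 C) (xi02 C)) : 0 < T C ξ := by
  obtain ⟨h1, h2, h3, h4, h5⟩ := xi_spec hC
  rcases le_total ξ (xi00 C) with hle | hle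
  · rw [← h4]
    exact strictMonoOn_T hC ⟨h1.le, h2.le⟩ ⟨(h1.trans h.1).le, hle⟩ h.1
  · rw [← h5]
    exact strictAntiOn_T hC hle h3.le h.2

lemma T_nonneg {ξ : ℝ} (h : ξ ∈ Icc (xi01 C) (xi02 C)) : 0 ≤ T C ξ := by
  rcases eq_or_lt_of_le h.1 with h1 | h1
  · rw [← h1, T_xi01 hC]
  rcases eq_or_lt_of_le h.2 with h2 | h2
  · rw [h2, T_xi02 hC]
  exact (T_pos hC ⟨h1, h2⟩).le

lemma pos_of_mem {ξ : ℝ} (h : ξ ∈ Icc (xi01 C) (xi02 C)) : 0 < ξ := (xi01_pos hC).trans_le h.1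

lemma one_lt_mul_sq {ξ : ℝ} (h : ξ ∈ Icc (xi01 C) (xi02 C)) : 1 < C * ξ ^ 2 := by
  have h1 := T_nonneg hC h
  have h2 := pos_of_mem hC h
  have h3 : 0 < ξ ^ (8 / 3 : ℝ) := by positivity
  unfold T at h1; linarith

end

/-- The condition on `C*` under which `F` and the profile curve are regular; it contains the
admissible values and the value `0`, for which the height is the arc length. -/
def RegularStar (C Cs : ℝ) : Prop := ∀ ξ ∈ Icc (xi01 C) (xi02 C), Cs ^ 2 * T C ξ < 3 * ξ ^ 2

lemma regularStar_zero {C : ℝ} (hC : critC < C) : RegularStar C 0 := by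
  intro ξ h
  have := pos_of_mem hC h
  simp; positivity

/-- `T ≤ 3 (C - critC) ξ²`, with equality at `ξ^{2/3} = √3`. -/
lemma T_le {C ξ : ℝ} (h : 0 < ξ) : T C ξ ≤ 3 * (C - critC) * ξ ^ 2 := by
  obtain ⟨x, hx, rfl⟩ := exists_cube h
  rw [T_cube C hx.le]
  have h3 : Real.sqrt 3 ^ 2 = 3 := Real.sq_sqrt (by norm_num)
  have hs : 0 < Real.sqrt 3 := by positivity
  have hc : 3 * critC * Real.sqrt 3 = 4 := by linarith [critC_eq]
  have hc' : 3 * critC = 4 / 3 * Real.sqrt 3 := by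
    have : 3 * critC * Real.sqrt 3 ^ 2 = 4 * Real.sqrt 3 := by rw [← hc]; ring
    rw [h3] at this; linarith
  set s := Real.sqrt 3
  have key : 0 ≤ (x ^ 2 - s) ^ 2 * (x ^ 4 + 2 / 3 * s * x ^ 2 + 1) := by positivity
  have : (x ^ 2 - s) ^ 2 * (x ^ 4 + 2 / 3 * s * x ^ 2 + 1)
      = x ^ 8 - 4 / 3 * s * x ^ 6 + (1 - s ^ 2 / 3) * x ^ 4 + (2 / 3 * s ^ 3 - 2 * s) * x ^ 2
        + s ^ 2 := by ring
  rw [this, h3, show s ^ 3 = s ^ 2 * s by ring, h3] at key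
  have : 3 * (C - critC) * (x ^ 3) ^ 2 = 3 * C * x ^ 6 - (3 * critC) * x ^ 6 := by ring
  rw [this, hc']
  nlinarith

lemma AdmissibleStar.regularStar {C Cs : ℝ} (hC : critC < C) (h : AdmissibleStar C Cs) :
    RegularStar C Cs := by
  intro ξ hξ
  have hpos := pos_of_mem hC hξ
  have hd : 0 < C - critC := sub_pos.2 hC
  have h1 : Cs ^ 2 * (C - critC) < 1 := by
    have h2 : Cs ^ 2 < ((C - critC) ^ (-(1 / 2) : ℝ)) ^ 2 :=
      pow_lt_pow_left₀ h.2 h.1.le (by norm_num)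
    have h3 : ((C - critC) ^ (-(1 / 2) : ℝ)) ^ 2 = (C - critC)⁻¹ := by
      rw [← Real.rpow_natCast, ← Real.rpow_mul hd.le, ← Real.rpow_neg_one]; norm_num
    rw [h3] at h2
    calc Cs ^ 2 * (C - critC) < (C - critC)⁻¹ * (C - critC) := by gcongr
      _ = 1 := inv_mul_cancel₀ hd.ne'
  calc Cs ^ 2 * T C ξ ≤ Cs ^ 2 * (3 * (C - critC) * ξ ^ 2) := by
        gcongr; exact T_le hpos
    _ = Cs ^ 2 * (C - critC) * (3 * ξ ^ 2) := by ring
    _ < 1 * (3 * ξ ^ 2) := by gcongr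
    _ = _ := one_mul _


/-! ### The integrals `ζ₀` and `h₀` -/

/-- The inverse of a continuous injection of a compact set is continuous. -/
lemma continuousOn_of_injOn_isCompact {X Y : Type*} [TopologicalSpace X] [TopologicalSpace Y]
    [T2Space X] [T2Space Y] {f : X → Y} {g : Y → X} {K : Set X} {S : Set Y} (hK : IsCompact K)
    (hf : ContinuousOn f K) (hinj : InjOn f K) (hg : MapsTo g S K) (hfg : ∀ y ∈ S, f (g y) = y) :
    ContinuousOn g S := by
  rw [continuousOn_iff_isClosed]
  intro Z hZ
  refine ⟨f '' (K ∩ Z), ((hK.inter_right hZ).image_of_continuousOn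
    (hf.mono inter_subset_left)).isClosed, ?_⟩
  ext y
  constructor
  · rintro ⟨hy, hyS⟩
    exact ⟨⟨g y, ⟨hg hyS, hy⟩, hfg y hyS⟩, hyS⟩
  · rintro ⟨⟨x, ⟨hxK, hxZ⟩, rfl⟩, hyS⟩
    refine ⟨?_, hyS⟩
    have : g (f x) = x := hinj (hg hyS) hxK (hfg _ hyS)
    rwa [mem_preimage, this]

section
variable {C : ℝ} (hC : critC < C)
include hC

/-- `T' / √T` is integrable up to the zeros of `T`, being the derivative of the monotone function
`2 √T`; and `T'` vanishes only at `ξ₀₀`. -/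
lemma intervalIntegrable_inv_sqrt_T :
    IntervalIntegrable (fun τ => 1 / Real.sqrt (T C τ)) MeasureTheory.volume (xi01 C) (xi02 C) := by
  obtain ⟨h1, h2, h3, h4, h5⟩ := xi_spec hC
  obtain ⟨m, hm1, hm2⟩ := exists_between h2
  obtain ⟨n, hn1, hn2⟩ := exists_between h3
  have hcd : ∀ s : Set ℝ, (∀ x ∈ s, 0 < x) →
      ContinuousOn (fun ξ : ℝ => ξ * (6 * C - 8 / 3 * ξ ^ (2 / 3 : ℝ))) s := by
    intro s hs
    have : Continuous fun ξ : ℝ => ξ ^ (2 / 3 : ℝ) := Real.continuous_rpow_const (by norm_num)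
    fun_prop
  have hder : ∀ x ∈ Ioo (xi01 C) (xi02 C), HasDerivAt (fun ξ => 2 * Real.sqrt (T C ξ))
      (x * (6 * C - 8 / 3 * x ^ (2 / 3 : ℝ)) / Real.sqrt (T C x)) x := by
    intro x hx
    have hp := T_pos hC hx
    refine (((hasDerivAt_T C (h1.trans hx.1)).sqrt hp.ne').const_mul 2).congr_deriv ?_
    have : Real.sqrt (T C x) ≠ 0 := (Real.sqrt_pos.2 hp).ne'
    field_simp
  have hcont : Continuous fun ξ => 2 * Real.sqrt (T C ξ) := by
    have := continuous_T C
    fun_prop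
  have i1 : IntervalIntegrable (fun τ => 1 / Real.sqrt (T C τ)) MeasureTheory.volume (xi01 C) m := by
    have hpos : ∀ x ∈ Icc (xi01 C) m, 0 < x * (6 * C - 8 / 3 * x ^ (2 / 3 : ℝ)) := fun x hx =>
      deriv_T_pos hC (h1.trans_le hx.1) (hx.2.trans_lt hm2)
    have := intervalIntegral.intervalIntegrable_deriv_of_nonneg (a := xi01 C) (b := m)
      (g := fun ξ => 2 * Real.sqrt (T C ξ)) hcont.continuousOn
      (fun x hx => hder x (by
        rw [min_eq_left hm1.le, max_eq_right hm1.le] at hx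
        exact ⟨hx.1, hx.2.trans (hm2.trans h3)⟩))
      (fun x hx => by
        rw [min_eq_left hm1.le, max_eq_right hm1.le] at hx
        exact div_nonneg (hpos x ⟨hx.1.le, hx.2.le⟩).le (Real.sqrt_nonneg _))
    refine (this.continuousOn_mul (g := fun ξ : ℝ => (ξ * (6 * C - 8 / 3 * ξ ^ (2 / 3 : ℝ)))⁻¹)
      ?_).congr ?_
    · rw [uIcc_of_le hm1.le]
      exact (hcd _ fun x hx => h1.trans_le hx.1).inv₀ fun x hx => (hpos x hx).ne'
    · intro x hx
      rw [uIoc_of_le hm1.le] at hx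
      have := (hpos x ⟨hx.1.le, hx.2⟩).ne'
      dsimp only
      rw [← mul_div_assoc, inv_mul_cancel₀ this]
  have i2 : IntervalIntegrable (fun τ => 1 / Real.sqrt (T C τ)) MeasureTheory.volume m n := by
    apply ContinuousOn.intervalIntegrable
    have hmn : m ≤ n := (hm2.trans hn1).le
    rw [uIcc_of_le hmn]
    refine continuousOn_const.div (continuous_T C).sqrt.continuousOn fun x hx => ?_
    exact (Real.sqrt_pos.2 (T_pos hC ⟨hm1.trans_le hx.1, hx.2.trans_lt hn2⟩)).ne'
  have i3 : IntervalIntegrable (fun τ => 1 / Real.sqrt (T C τ)) MeasureTheory.volume n (xi02 C) := by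
    have hneg : ∀ x ∈ Icc n (xi02 C), x * (6 * C - 8 / 3 * x ^ (2 / 3 : ℝ)) < 0 := fun x hx =>
      deriv_T_neg hC (hn1.trans_le hx.1)
    have := intervalIntegral.intervalIntegrable_deriv_of_nonneg (a := n) (b := xi02 C)
      (g := fun ξ => -(2 * Real.sqrt (T C ξ))) hcont.neg.continuousOn
      (fun x hx => (hder x (by
        rw [min_eq_left hn2.le, max_eq_right hn2.le] at hx
        exact ⟨(h2.trans hn1).trans hx.1, hx.2⟩)).neg)
      (fun x hx => by
        rw [min_eq_left hn2.le, max_eq_right hn2.le] at hx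
        have := hneg x ⟨hx.1.le, hx.2.le⟩
        rw [neg_div' ]
        exact div_nonneg (by linarith) (Real.sqrt_nonneg _))
    refine (this.continuousOn_mul (g := fun ξ : ℝ => -(ξ * (6 * C - 8 / 3 * ξ ^ (2 / 3 : ℝ)))⁻¹)
      ?_).congr ?_
    · rw [uIcc_of_le hn2.le]
      exact ((hcd _ fun x hx => (xi00_pos hC).trans (hn1.trans_le hx.1)).inv₀
        fun x hx => (hneg x hx).ne).neg
    · intro x hx
      rw [uIoc_of_le hn2.le] at hx
      have := (hneg x ⟨hx.1.le, hx.2⟩).ne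
      dsimp only
      rw [neg_mul_neg, ← mul_div_assoc, inv_mul_cancel₀ this]
  exact (i1.trans i2).trans i3

variable {f g : ℝ → ℝ} (hg : ContinuousOn g (Icc (xi01 C) (xi02 C)))
  (hfg : ∀ x ∈ Icc (xi01 C) (xi02 C), f x = g x * (1 / Real.sqrt (T C x)))
include hg hfg

lemma intervalIntegrable_of_div_sqrt_T :
    IntervalIntegrable f MeasureTheory.volume (xi01 C) (xi02 C) := by
  have hlt := (xi01_lt_xi02 hC).le
  refine ((intervalIntegrable_inv_sqrt_T hC).continuousOn_mul (g := g)
    (by rwa [uIcc_of_le hlt])).congr fun x hx => ?_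
  rw [uIoc_of_le hlt] at hx
  exact (hfg x ⟨hx.1.le, hx.2⟩).symm

lemma continuousOn_primitive_div_sqrt_T :
    ContinuousOn (fun ξ => ∫ τ in (xi00 C)..ξ, f τ) (Icc (xi01 C) (xi02 C)) := by
  have hlt := (xi01_lt_xi02 hC).le
  have := intervalIntegral.continuousOn_primitive_interval'
    (intervalIntegrable_of_div_sqrt_T hC hg hfg) (a := xi00 C)
    (by rw [uIcc_of_le hlt]; exact xi00_mem hC)
  rwa [uIcc_of_le hlt] at this

lemma hasDerivAt_primitive_div_sqrt_T {ξ : ℝ} (h : ξ ∈ Ioo (xi01 C) (xi02 C)) :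
    HasDerivAt (fun ξ => ∫ τ in (xi00 C)..ξ, f τ) (f ξ) ξ := by
  have hfc : ContinuousOn f (Ioo (xi01 C) (xi02 C)) := by
    have : ContinuousOn (fun x => g x * (1 / Real.sqrt (T C x))) (Ioo (xi01 C) (xi02 C)) := by
      refine (hg.mono Ioo_subset_Icc_self).mul (continuousOn_const.div
        (continuous_T C).sqrt.continuousOn fun x hx => (Real.sqrt_pos.2 (T_pos hC hx)).ne')
    exact this.congr fun x hx => hfg x (Ioo_subset_Icc_self hx)
  apply intervalIntegral.integral_hasDerivAt_right
  · refine (intervalIntegrable_of_div_sqrt_T hC hg hfg).mono_set ?_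
    have hlt := (xi01_lt_xi02 hC).le
    rw [uIcc_of_le hlt]
    exact uIcc_subset_Icc (xi00_mem hC) (Ioo_subset_Icc_self h)
  · exact hfc.stronglyMeasurableAtFilter isOpen_Ioo ξ h
  · exact hfc.continuousAt (isOpen_Ioo.mem_nhds h)

lemma strictMonoOn_primitive_div_sqrt_T (hpos : ∀ x ∈ Ioo (xi01 C) (xi02 C), 0 < g x) :
    StrictMonoOn (fun ξ => ∫ τ in (xi00 C)..ξ, f τ) (Icc (xi01 C) (xi02 C)) := by
  refine strictMonoOn_of_deriv_pos (convex_Icc _ _)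
    (continuousOn_primitive_div_sqrt_T hC hg hfg) fun x hx => ?_
  rw [interior_Icc] at hx
  rw [(hasDerivAt_primitive_div_sqrt_T hC hg hfg hx).deriv, hfg x (Ioo_subset_Icc_self hx)]
  have := Real.sqrt_pos.2 (T_pos hC hx)
  have := hpos x hx
  positivity

end

section
variable {C : ℝ} (hC : critC < C)
include hC

lemma zeta0_aux :
    ContinuousOn (fun τ : ℝ => Real.sqrt C * τ ^ (4 / 3 : ℝ) / (-1 + C * τ ^ 2))
      (Icc (xi01 C) (xi02 C)) ∧
    ∀ x ∈ Icc (xi01 C) (xi02 C),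
      Real.sqrt C * x ^ (4 / 3 : ℝ) / ((-1 + C * x ^ 2) * Real.sqrt (T C x)) =
        Real.sqrt C * x ^ (4 / 3 : ℝ) / (-1 + C * x ^ 2) * (1 / Real.sqrt (T C x)) := by
  constructor
  · have : Continuous fun ξ : ℝ => ξ ^ (4 / 3 : ℝ) := Real.continuous_rpow_const (by norm_num)
    refine ContinuousOn.div (by fun_prop) (by fun_prop) fun x hx => ?_
    have := one_lt_mul_sq hC hx
    linarith
  · intro x _
    rw [div_mul_div_comm, mul_one]

lemma continuousOn_zeta0 : ContinuousOn (zeta0 C) (Icc (xi01 C) (xi02 C)) :=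
  continuousOn_primitive_div_sqrt_T hC (zeta0_aux hC).1 (zeta0_aux hC).2

lemma hasDerivAt_zeta0 {ξ : ℝ} (h : ξ ∈ Ioo (xi01 C) (xi02 C)) :
    HasDerivAt (zeta0 C)
      (Real.sqrt C * ξ ^ (4 / 3 : ℝ) / ((-1 + C * ξ ^ 2) * Real.sqrt (T C ξ))) ξ :=
  hasDerivAt_primitive_div_sqrt_T hC (zeta0_aux hC).1 (zeta0_aux hC).2 h

lemma strictMonoOn_zeta0 : StrictMonoOn (zeta0 C) (Icc (xi01 C) (xi02 C)) := by
  refine strictMonoOn_primitive_div_sqrt_T hC (zeta0_aux hC).1 (zeta0_aux hC).2 fun x hx => ?_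
  have h1 := one_lt_mul_sq hC (Ioo_subset_Icc_self hx)
  have h2 := pos_of_mem hC (Ioo_subset_Icc_self hx)
  have h3 := C_pos hC
  have h4 : 0 < -1 + C * x ^ 2 := by linarith
  positivity

variable {Cs : ℝ} (hS : RegularStar C Cs)
include hS

lemma h0_aux :
    ContinuousOn (fun τ : ℝ => Real.sqrt ((3 * τ ^ 2 - Cs ^ 2 * T C τ) / τ ^ 4))
      (Icc (xi01 C) (xi02 C)) ∧
    ∀ x ∈ Icc (xi01 C) (xi02 C),
      Real.sqrt ((3 * x ^ 2 - Cs ^ 2 * T C x) / (x ^ 4 * T C x)) =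
        Real.sqrt ((3 * x ^ 2 - Cs ^ 2 * T C x) / x ^ 4) * (1 / Real.sqrt (T C x)) := by
  have hT := continuous_T C
  constructor
  · refine (ContinuousOn.div (by fun_prop) (by fun_prop) fun x hx => ?_).sqrt
    have := pos_of_mem hC hx
    positivity
  · intro x hx
    have := pos_of_mem hC hx
    have h2 : 0 ≤ (3 * x ^ 2 - Cs ^ 2 * T C x) / x ^ 4 :=
      div_nonneg (by linarith [hS x hx]) (by positivity)
    rw [← div_div, Real.sqrt_div h2, ← div_eq_mul_one_div]

lemma continuousOn_h0 : ContinuousOn (h0 C Cs) (Icc (xi01 C) (xi02 C)) :=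
  continuousOn_primitive_div_sqrt_T hC (h0_aux hC hS).1 (h0_aux hC hS).2

lemma hasDerivAt_h0 {ξ : ℝ} (h : ξ ∈ Ioo (xi01 C) (xi02 C)) :
    HasDerivAt (h0 C Cs)
      (Real.sqrt ((3 * ξ ^ 2 - Cs ^ 2 * T C ξ) / (ξ ^ 4 * T C ξ))) ξ :=
  hasDerivAt_primitive_div_sqrt_T hC (h0_aux hC hS).1 (h0_aux hC hS).2 h

lemma strictMonoOn_h0 : StrictMonoOn (h0 C Cs) (Icc (xi01 C) (xi02 C)) := by
  refine strictMonoOn_primitive_div_sqrt_T hC (h0_aux hC hS).1 (h0_aux hC hS).2 fun x hx => ?_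
  have h2 := pos_of_mem hC (Ioo_subset_Icc_self hx)
  have := hS x (Ioo_subset_Icc_self hx)
  exact Real.sqrt_pos.2 (div_pos (by linarith) (by positivity))

lemma h0M_lt_h0P : h0M C Cs < h0P C Cs :=
  strictMonoOn_h0 hC hS (left_mem_Icc.2 (xi01_lt_xi02 hC).le)
    (right_mem_Icc.2 (xi01_lt_xi02 hC).le) (xi01_lt_xi02 hC)

end


/-! ### Functions given strip by strip -/

section strips
variable {t : ℤ → ℝ} (ht : StrictMono t) (hcov : ∀ x : ℝ, ∃ k, t k ≤ x ∧ x < t (k + 1))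
include ht hcov

lemma locallyFinite_strips : LocallyFinite fun k : ℤ => Icc (t k) (t (k + 1)) := by
  intro x
  obtain ⟨k, hk1, hk2⟩ := hcov x
  refine ⟨Ioo (t (k - 1)) (t (k + 1)), Ioo_mem_nhds ((ht (by lia)).trans_le hk1) hk2,
    (Set.finite_Icc (k - 2) (k + 1)).subset ?_⟩
  rintro j ⟨y, hy1, hy2⟩
  constructor
  · have : t (k - 1) < t (j + 1) := hy2.1.trans_le hy1.2
    have := ht.lt_iff_lt.1 this
    lia
  · have : t j < t (k + 1) := hy1.1.trans_lt hy2.2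
    have := ht.lt_iff_lt.1 this
    lia

lemma continuous_of_strips {X Y : Type*} [TopologicalSpace X] [TopologicalSpace Y] {p : X → ℝ}
    (hp : Continuous p) {f : X → Y}
    (hf : ∀ k, ContinuousOn f (p ⁻¹' Icc (t k) (t (k + 1)))) : Continuous f := by
  refine ((locallyFinite_strips ht hcov).preimage_continuous hp).continuous ?_
    (fun k => isClosed_Icc.preimage hp) hf
  refine eq_univ_of_forall fun x => ?_
  obtain ⟨k, h1, h2⟩ := hcov (p x)
  exact mem_iUnion.2 ⟨k, h1, h2.le⟩

end strips

/-- Off the nodes differentiability suffices when the function and the candidate derivative are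
continuous: the set of nodes is countable. -/
lemma hasDerivAt_of_strips {t : ℤ → ℝ}
    (hcov : ∀ x : ℝ, ∃ k, t k ≤ x ∧ x < t (k + 1)) {f g : ℝ → ℝ} (hf : Continuous f) (hg : Continuous g)
    (hd : ∀ k, ∀ x ∈ Ioo (t k) (t (k + 1)), HasDerivAt f (g x) x) (x : ℝ) :
    HasDerivAt f (g x) x := by
  have h : ∀ y, ∫ s in (0 : ℝ)..y, g s = f y - f 0 := by
    intro y
    refine MeasureTheory.integral_eq_of_hasDerivAt_off_countable f g
      (countable_range t) hf.continuousOn (fun z hz => ?_) (hg.intervalIntegrable _ _)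
    obtain ⟨k, h1, h2⟩ := hcov z
    exact hd k z ⟨lt_of_le_of_ne h1 fun h => hz.2 ⟨k, h⟩, h2⟩
  have h1 := intervalIntegral.integral_hasDerivAt_right (hg.intervalIntegrable 0 x)
    (hg.stronglyMeasurableAtFilter _ _) hg.continuousAt
  have h2 : f = fun y => (∫ s in (0 : ℝ)..y, g s) + f 0 := by ext y; rw [h y]; ring
  rw [h2]
  exact h1.add_const _

/-! ### Nodes and the function `F` -/

/-- The value of `ξ` at the `k`-th node: `ξ₀₁` for even `k`, `ξ₀₂` for odd `k`. -/
noncomputable def eNode (C : ℝ) (k : ℤ) : ℝ := if Even k then xi01 C else xi02 C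

lemma eNode_even {C : ℝ} {k : ℤ} (hk : Even k) : eNode C k = xi01 C := if_pos hk
lemma eNode_odd {C : ℝ} {k : ℤ} (hk : Odd k) : eNode C k = xi02 C :=
  if_neg (Int.not_even_iff_odd.2 hk)

lemma neg_one_zpow_eq (k : ℤ) :
    (Even k ∧ (-1 : ℝ) ^ k = 1) ∨ (Odd k ∧ (-1 : ℝ) ^ k = -1) := by
  rcases Int.even_or_odd k with h | h
  · exact Or.inl ⟨h, h.neg_one_zpow⟩
  · exact Or.inr ⟨h, h.neg_one_zpow⟩

lemma neg_one_zpow_sq (k : ℤ) : ((-1 : ℝ) ^ k) * (-1 : ℝ) ^ k = 1 := by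
  rcases neg_one_zpow_eq k with ⟨_, h⟩ | ⟨_, h⟩ <;> rw [h] <;> norm_num

lemma neg_one_zpow_succ (k : ℤ) : (-1 : ℝ) ^ (k + 1) = -(-1 : ℝ) ^ k := by
  rw [zpow_add₀ (by norm_num)]; simp

/-- The phase recursion written node by node. -/
lemma phaseRec_iff {C : ℝ} {c : ℤ → ℝ} : PhaseRec C c ↔
    ∀ k, c k ≡ -2 * zeta0 C (eNode C k) - c (k - 1) [PMOD (2 * Real.pi)] := by
  unfold PhaseRec zetaP zetaM
  refine forall_congr' fun k => ?_
  rcases Int.even_or_odd k with h | h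
  · rw [eNode_even h]
    exact ⟨fun h' => h'.2 h, fun h' => ⟨fun ho => absurd h (Int.not_even_iff_odd.2 ho), fun _ => h'⟩⟩
  · rw [eNode_odd h]
    exact ⟨fun h' => h'.1 h, fun h' => ⟨fun _ => h', fun ho => absurd ho (Int.not_even_iff_odd.2 h)⟩⟩

section
variable {C Cs : ℝ}

lemma hk_eq (k : ℤ) (ξ : ℝ) :
    hk C Cs k ξ = node C Cs k + (-1) ^ k * (h0 C Cs ξ - h0 C Cs (eNode C k)) := by
  unfold hk node
  rcases neg_one_zpow_eq k with ⟨h, h'⟩ | ⟨h, h'⟩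
  · rw [if_pos h, h', eNode_even h]; unfold h0M; ring
  · rw [if_neg (Int.not_even_iff_odd.2 h), h', eNode_odd h]; unfold h0P; ring

lemma node_succ (k : ℤ) : node C Cs (k + 1) = node C Cs k + (h0P C Cs - h0M C Cs) := by
  unfold node; push_cast; ring

lemma hk_eNode (k : ℤ) : hk C Cs k (eNode C k) = node C Cs k := by
  rw [hk_eq]; ring

lemma hk_eNode_succ (k : ℤ) : hk C Cs k (eNode C (k + 1)) = node C Cs (k + 1) := by
  rw [hk_eq, node_succ]
  unfold h0P h0M
  rcases neg_one_zpow_eq k with ⟨h, h'⟩ | ⟨h, h'⟩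
  · rw [h', eNode_even h, eNode_odd h.add_one]; ring
  · rw [h', eNode_odd h, eNode_even h.add_one]; ring

variable (hC : critC < C) (hS : RegularStar C Cs)
include hC

lemma eNode_mem (k : ℤ) : eNode C k ∈ Icc (xi01 C) (xi02 C) := by
  have := (xi01_lt_xi02 hC).le
  rcases Int.even_or_odd k with h | h
  · rw [eNode_even h]; exact left_mem_Icc.2 this
  · rw [eNode_odd h]; exact right_mem_Icc.2 this

include hS

lemma node_strictMono : StrictMono (node C Cs) := by
  have := h0M_lt_h0P hC hS
  intro j k hjk
  unfold node
  have h : (j : ℝ) < k := by exact_mod_cast hjk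
  nlinarith

lemma node_cover (x : ℝ) : ∃ k, node C Cs k ≤ x ∧ x < node C Cs (k + 1) := by
  have hL : 0 < h0P C Cs - h0M C Cs := sub_pos.2 (h0M_lt_h0P hC hS)
  refine ⟨⌊(x - h0M C Cs) / (h0P C Cs - h0M C Cs)⌋, ?_, ?_⟩
  · have := (le_div_iff₀ hL).1 (Int.floor_le ((x - h0M C Cs) / (h0P C Cs - h0M C Cs)))
    unfold node; linarith
  · have := (div_lt_iff₀ hL).1 (Int.lt_floor_add_one ((x - h0M C Cs) / (h0P C Cs - h0M C Cs)))
    unfold node; push_cast; linarith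

lemma pieceIndex_eq {k : ℤ} {h : ℝ} (hh : h ∈ Ico (node C Cs k) (node C Cs (k + 1))) :
    pieceIndex C Cs h = k := by
  have hL : 0 < h0P C Cs - h0M C Cs := sub_pos.2 (h0M_lt_h0P hC hS)
  unfold pieceIndex
  obtain ⟨h1, h2⟩ := hh
  unfold node at h1 h2
  push_cast at h2
  rw [Int.floor_eq_iff, le_div_iff₀ hL, div_lt_iff₀ hL]
  constructor <;> linarith

lemma continuousOn_hk (k : ℤ) : ContinuousOn (hk C Cs k) (Icc (xi01 C) (xi02 C)) := by
  have : hk C Cs k = fun ξ => node C Cs k + (-1) ^ k * (h0 C Cs ξ - h0 C Cs (eNode C k)) := by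
    ext ξ; exact hk_eq k ξ
  rw [this]
  have := continuousOn_h0 hC hS
  fun_prop

lemma injOn_hk (k : ℤ) : InjOn (hk C Cs k) (Icc (xi01 C) (xi02 C)) := by
  intro x hx y hy hxy
  rw [hk_eq, hk_eq] at hxy
  refine (strictMonoOn_h0 hC hS).injOn hx hy ?_
  rcases neg_one_zpow_eq k with ⟨_, h'⟩ | ⟨_, h'⟩ <;> rw [h'] at hxy <;> linarith

lemma hk_mem_Ioo (k : ℤ) {ξ : ℝ} (h : ξ ∈ Ioo (xi01 C) (xi02 C)) :
    hk C Cs k ξ ∈ Ioo (node C Cs k) (node C Cs (k + 1)) := by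
  have hle := (xi01_lt_xi02 hC).le
  have h1 := strictMonoOn_h0 hC hS (left_mem_Icc.2 hle) (Ioo_subset_Icc_self h) h.1
  have h2 := strictMonoOn_h0 hC hS (Ioo_subset_Icc_self h) (right_mem_Icc.2 hle) h.2
  rw [← hk_eNode_succ k, ← hk_eNode k, hk_eq, hk_eq, hk_eq]
  rcases neg_one_zpow_eq k with ⟨hk, h'⟩ | ⟨hk, h'⟩
  · rw [h', eNode_even hk, eNode_odd hk.add_one]; constructor <;> linarith
  · rw [h', eNode_odd hk, eNode_even hk.add_one]; constructor <;> linarith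

lemma hk_mem_Icc (k : ℤ) {ξ : ℝ} (h : ξ ∈ Icc (xi01 C) (xi02 C)) :
    hk C Cs k ξ ∈ Icc (node C Cs k) (node C Cs (k + 1)) := by
  have hle := (xi01_lt_xi02 hC).le
  have h1 := (strictMonoOn_h0 hC hS).monotoneOn (left_mem_Icc.2 hle) h h.1
  have h2 := (strictMonoOn_h0 hC hS).monotoneOn h (right_mem_Icc.2 hle) h.2
  rw [← hk_eNode_succ k, ← hk_eNode k, hk_eq, hk_eq, hk_eq]
  rcases neg_one_zpow_eq k with ⟨hk, h'⟩ | ⟨hk, h'⟩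
  · rw [h', eNode_even hk, eNode_odd hk.add_one]; constructor <;> linarith
  · rw [h', eNode_odd hk, eNode_even hk.add_one]; constructor <;> linarith

lemma surjOn_hk (k : ℤ) :
    SurjOn (hk C Cs k) (Icc (xi01 C) (xi02 C)) (Icc (node C Cs k) (node C Cs (k + 1))) := by
  have hle := (xi01_lt_xi02 hC).le
  have h1 := hk_eNode (C := C) (Cs := Cs) k
  have h2 := hk_eNode_succ (C := C) (Cs := Cs) k
  rw [← h2, ← h1]
  rcases Int.even_or_odd k with h | h
  · rw [eNode_even h, eNode_odd h.add_one]
    exact intermediate_value_Icc hle (continuousOn_hk hC hS k)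
  · rw [eNode_odd h, eNode_even h.add_one]
    exact intermediate_value_Icc' hle (continuousOn_hk hC hS k)

lemma F_spec_Ico {k : ℤ} {h : ℝ} (hh : h ∈ Ico (node C Cs k) (node C Cs (k + 1))) :
    F C Cs h ∈ Icc (xi01 C) (xi02 C) ∧ hk C Cs k (F C Cs h) = h := by
  unfold F
  rw [pieceIndex_eq hC hS hh]
  have := surjOn_hk hC hS k ⟨hh.1, hh.2.le⟩
  exact ⟨Function.invFunOn_mem this, Function.invFunOn_eq this⟩

lemma F_mem (h : ℝ) : F C Cs h ∈ Icc (xi01 C) (xi02 C) := by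
  obtain ⟨k, h1, h2⟩ := node_cover hC hS h
  exact (F_spec_Ico hC hS ⟨h1, h2⟩).1

lemma F_node (k : ℤ) : F C Cs (node C Cs k) = eNode C k := by
  have := F_spec_Ico hC hS (k := k) (h := node C Cs k)
    ⟨le_rfl, node_strictMono hC hS (by lia)⟩
  exact injOn_hk hC hS k this.1 (eNode_mem hC k) (by rw [this.2, hk_eNode])

lemma hk_F {k : ℤ} {h : ℝ} (hh : h ∈ Icc (node C Cs k) (node C Cs (k + 1))) :
    hk C Cs k (F C Cs h) = h := by
  rcases eq_or_lt_of_le hh.2 with h' | h'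
  · rw [h', F_node hC hS, hk_eNode_succ]
  · exact (F_spec_Ico hC hS ⟨hh.1, h'⟩).2

lemma F_hk (k : ℤ) {ξ : ℝ} (hξ : ξ ∈ Icc (xi01 C) (xi02 C)) : F C Cs (hk C Cs k ξ) = ξ :=
  injOn_hk hC hS k (F_mem hC hS _) hξ (hk_F hC hS (hk_mem_Icc hC hS k hξ))

lemma F_mem_Ioo {k : ℤ} {h : ℝ} (hh : h ∈ Ioo (node C Cs k) (node C Cs (k + 1))) :
    F C Cs h ∈ Ioo (xi01 C) (xi02 C) := by
  obtain ⟨h1, h2⟩ := F_mem hC hS h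
  have h3 := hk_F hC hS (Ioo_subset_Icc_self hh)
  have key : ∀ j, F C Cs h = eNode C j → j = k ∨ j = k + 1 → False := by
    rintro j hj (rfl | rfl)
    · rw [hj, hk_eNode] at h3; exact hh.1.ne h3
    · rw [hj, hk_eNode_succ] at h3; exact hh.2.ne h3.symm
  refine ⟨lt_of_le_of_ne h1 fun h => ?_, lt_of_le_of_ne h2 fun h => ?_⟩
  · rcases Int.even_or_odd k with hk | hk
    · exact key k (by rw [eNode_even hk, h]) (Or.inl rfl)
    · exact key (k + 1) (by rw [eNode_even hk.add_one, h]) (Or.inr rfl)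
  · rcases Int.even_or_odd k with hk | hk
    · exact key (k + 1) (by rw [eNode_odd hk.add_one, h]) (Or.inr rfl)
    · exact key k (by rw [eNode_odd hk, h]) (Or.inl rfl)

lemma continuousOn_F (k : ℤ) :
    ContinuousOn (F C Cs) (Icc (node C Cs k) (node C Cs (k + 1))) :=
  continuousOn_of_injOn_isCompact isCompact_Icc (continuousOn_hk hC hS k) (injOn_hk hC hS k)
    (fun h _ => F_mem hC hS h) fun _ hh => hk_F hC hS hh

lemma continuous_F : Continuous (F C Cs) :=
  continuous_of_strips (node_strictMono hC hS) (node_cover hC hS) continuous_id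
    fun k => continuousOn_F hC hS k

lemma hasDerivAt_F {k : ℤ} {h : ℝ} (hh : h ∈ Ioo (node C Cs k) (node C Cs (k + 1))) :
    HasDerivAt (F C Cs) ((-1) ^ k * (F C Cs h ^ 2 * Real.sqrt (T C (F C Cs h)) /
      Real.sqrt (3 * F C Cs h ^ 2 - Cs ^ 2 * T C (F C Cs h)))) h := by
  have hF := F_mem_Ioo hC hS hh
  set ξ := F C Cs h with hξ
  have hpos := pos_of_mem hC (Ioo_subset_Icc_self hF)
  have hT := T_pos hC hF
  have hq : 0 < 3 * ξ ^ 2 - Cs ^ 2 * T C ξ := sub_pos.2 (hS ξ (Ioo_subset_Icc_self hF))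
  have hk' : hk C Cs k = fun ξ => node C Cs k + (-1) ^ k * (h0 C Cs ξ - h0 C Cs (eNode C k)) := by
    ext ξ; exact hk_eq k ξ
  have hd := (((hasDerivAt_h0 hC hS hF).sub_const (h0 C Cs (eNode C k))).const_mul
    ((-1 : ℝ) ^ k)).const_add (node C Cs k)
  rw [← hk'] at hd
  have hsq : Real.sqrt ((3 * ξ ^ 2 - Cs ^ 2 * T C ξ) / (ξ ^ 4 * T C ξ)) =
      Real.sqrt (3 * ξ ^ 2 - Cs ^ 2 * T C ξ) / (ξ ^ 2 * Real.sqrt (T C ξ)) := by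
    rw [Real.sqrt_div hq.le, Real.sqrt_mul (by positivity),
      show ξ ^ 4 = (ξ ^ 2) ^ 2 by ring, Real.sqrt_sq (by positivity)]
  rw [hsq] at hd
  have hq' := Real.sqrt_pos.2 hq
  have hT' := Real.sqrt_pos.2 hT
  have hne : (-1 : ℝ) ^ k ≠ 0 := zpow_ne_zero _ (by norm_num)
  refine (HasDerivAt.of_local_left_inverse (continuous_F hC hS).continuousAt hd
    (mul_ne_zero hne (by positivity)) ?_).congr_deriv ?_
  · filter_upwards [isOpen_Ioo.mem_nhds hh] with y hy
    exact hk_F hC hS (Ioo_subset_Icc_self hy)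
  · have h1 := neg_one_zpow_sq k
    rw [mul_inv, inv_div, inv_eq_of_mul_eq_one_left h1]

end


/-! ### The flow of the profile curve -/

/-- The profile curve of a biconservative rotational surface in `𝕊³`, as a solution of a regular
system of ordinary differential equations. The surface is
`(r a, r b, ρ cos (√C θ), ρ sin (√C θ))` with `r = √(1 - ρ²)`; `α` is the derivative of the radius
`ρ` by arc length and `β` the component of the unit normal in the direction of the radius. The
parameter runs with speed `(1 - μ² α²)^{-1/2}`, so that `μ = 0` means arc length. -/
structure ProfileFlow where
  (C μ : ℝ)
  (ρ α β a b : ℝ → ℝ)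
  C_pos : 0 < C
  ρ_pos : ∀ h, 0 < ρ h
  β_pos : ∀ h, 0 < β h
  sphere : ∀ h, ρ h ^ 2 + α h ^ 2 + β h ^ 2 = 1
  circle : ∀ h, a h ^ 2 + b h ^ 2 = 1
  speed : ∀ h, 0 < 1 - μ ^ 2 * α h ^ 2
  const : ∀ h, β h ^ 3 * ρ h * (3 * Real.sqrt 3 * C ^ 2) = 1
  dρ : ∀ h, HasDerivAt ρ (1 / Real.sqrt (1 - μ ^ 2 * α h ^ 2) * α h) h
  dα : ∀ h, HasDerivAt α
    (1 / Real.sqrt (1 - μ ^ 2 * α h ^ 2) * (-ρ h + β h / (3 * ρ h) * β h)) h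
  dβ : ∀ h, HasDerivAt β (-(1 / Real.sqrt (1 - μ ^ 2 * α h ^ 2) * (β h / (3 * ρ h)) * α h)) h
  da : ∀ h, HasDerivAt a (-(1 / Real.sqrt (1 - μ ^ 2 * α h ^ 2) * (β h / (1 - ρ h ^ 2)) * b h)) h
  db : ∀ h, HasDerivAt b (1 / Real.sqrt (1 - μ ^ 2 * α h ^ 2) * (β h / (1 - ρ h ^ 2)) * a h) h

namespace ProfileFlow
variable (P : ProfileFlow)

/-- The speed of the parametrization. -/
noncomputable def v (h : ℝ) : ℝ := 1 / Real.sqrt (1 - P.μ ^ 2 * P.α h ^ 2)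

/-- The distance `√(1 - ρ²)` to the second plane of coordinates. -/
noncomputable def r (h : ℝ) : ℝ := Real.sqrt (1 - P.ρ h ^ 2)

/-- The curvature of the profile curve in the sphere. -/
noncomputable def κ (h : ℝ) : ℝ := P.β h / (3 * P.ρ h)

lemma v_pos (h : ℝ) : 0 < P.v h := by
  have := Real.sqrt_pos.2 (P.speed h)
  unfold v; positivity

lemma κ_pos (h : ℝ) : 0 < P.κ h := by
  have := P.ρ_pos h
  have := P.β_pos h
  unfold κ; positivity

lemma one_sub_sq_pos (h : ℝ) : 0 < 1 - P.ρ h ^ 2 := by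
  have := P.sphere h
  have := pow_pos (P.β_pos h) 2
  nlinarith [sq_nonneg (P.α h)]

lemma r_pos (h : ℝ) : 0 < P.r h := Real.sqrt_pos.2 (P.one_sub_sq_pos h)

lemma r_sq (h : ℝ) : P.r h ^ 2 = 1 - P.ρ h ^ 2 := Real.sq_sqrt (P.one_sub_sq_pos h).le

lemma hρ (h : ℝ) : HasDerivAt P.ρ (P.v h * P.α h) h := P.dρ h
lemma hα (h : ℝ) : HasDerivAt P.α (P.v h * (-P.ρ h + P.κ h * P.β h)) h := P.dα h
lemma hβ (h : ℝ) : HasDerivAt P.β (-(P.v h * P.κ h * P.α h)) h := P.dβ h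
lemma ha (h : ℝ) : HasDerivAt P.a (-(P.v h * (P.β h / P.r h ^ 2) * P.b h)) h := by
  rw [r_sq]; exact P.da h
lemma hb (h : ℝ) : HasDerivAt P.b (P.v h * (P.β h / P.r h ^ 2) * P.a h) h := by
  rw [r_sq]; exact P.db h

lemma hr (h : ℝ) : HasDerivAt P.r (-(P.v h * P.ρ h * P.α h / P.r h)) h := by
  have := (((P.hρ h).pow 2).const_sub 1).sqrt (P.one_sub_sq_pos h).ne'
  refine this.congr_deriv ?_
  have h1 := P.r_pos h
  simp only [Pi.pow_apply]
  change _ / (2 * P.r h) = _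
  field_simp
  push_cast
  ring

lemma contDiff_data_nat (n : ℕ) : ContDiff ℝ n P.ρ ∧ ContDiff ℝ n P.α ∧ ContDiff ℝ n P.β ∧
    ContDiff ℝ n P.a ∧ ContDiff ℝ n P.b := by
  have base : Continuous P.ρ ∧ Continuous P.α ∧ Continuous P.β ∧ Continuous P.a ∧
      Continuous P.b :=
    ⟨continuous_iff_continuousAt.2 fun h => (P.dρ h).continuousAt,
     continuous_iff_continuousAt.2 fun h => (P.dα h).continuousAt,
     continuous_iff_continuousAt.2 fun h => (P.dβ h).continuousAt,
     continuous_iff_continuousAt.2 fun h => (P.da h).continuousAt,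
     continuous_iff_continuousAt.2 fun h => (P.db h).continuousAt⟩
  induction n with
  | zero => simpa [contDiff_zero] using base
  | succ n ih =>
    obtain ⟨i1, i2, i3, i4, i5⟩ := ih
    have step : ∀ f g : ℝ → ℝ, (∀ h, HasDerivAt f (g h) h) → ContDiff ℝ n g →
        ContDiff ℝ ((n + 1 : ℕ) : WithTop ℕ∞) f := by
      intro f g hfg hg
      push_cast
      rw [contDiff_succ_iff_deriv]
      refine ⟨fun h => (hfg h).differentiableAt, by simp, ?_⟩
      rwa [show deriv f = g from funext fun h => (hfg h).deriv]
    have hv : ContDiff ℝ n fun h => 1 / Real.sqrt (1 - P.μ ^ 2 * P.α h ^ 2) :=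
      contDiff_const.div ((contDiff_const.sub (contDiff_const.mul (i2.pow 2))).sqrt
        fun h => (P.speed h).ne') fun h => (Real.sqrt_pos.2 (P.speed h)).ne'
    have hκ : ContDiff ℝ n fun h => P.β h / (3 * P.ρ h) :=
      i3.div (contDiff_const.mul i1) fun h => by have := P.ρ_pos h; positivity
    have hg : ContDiff ℝ n fun h => P.β h / (1 - P.ρ h ^ 2) :=
      i3.div (contDiff_const.sub (i1.pow 2)) fun h => (P.one_sub_sq_pos h).ne'
    exact ⟨step _ _ P.dρ (hv.mul i2), step _ _ P.dα (hv.mul (i1.neg.add (hκ.mul i3))),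
      step _ _ P.dβ ((hv.mul hκ).mul i2).neg, step _ _ P.da ((hv.mul hg).mul i5).neg,
      step _ _ P.db ((hv.mul hg).mul i4)⟩

lemma contDiff_ρ : ContDiff ℝ 3 P.ρ := (P.contDiff_data_nat 3).1
lemma contDiff_α : ContDiff ℝ 3 P.α := (P.contDiff_data_nat 3).2.1
lemma contDiff_β : ContDiff ℝ 3 P.β := (P.contDiff_data_nat 3).2.2.1
lemma contDiff_a : ContDiff ℝ 3 P.a := (P.contDiff_data_nat 3).2.2.2.1
lemma contDiff_b : ContDiff ℝ 3 P.b := (P.contDiff_data_nat 3).2.2.2.2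
lemma contDiff_r : ContDiff ℝ 3 P.r :=
  (contDiff_const.sub (P.contDiff_ρ.pow 2)).sqrt fun h => (P.one_sub_sq_pos h).ne'

/-! ### The adapted frame -/

/-- The radial unit vector of the profile curve in the first coordinate plane. -/
noncomputable def u (h : ℝ) : E4 := !₂[P.a h, P.b h, 0, 0]
/-- The vector `u` turned by a right angle. -/
noncomputable def ju (h : ℝ) : E4 := !₂[-P.b h, P.a h, 0, 0]
/-- The radial unit vector in the plane of rotation. -/
noncomputable def w (θ : ℝ) : E4 := !₂[0, 0, Real.cos (Real.sqrt P.C * θ), Real.sin (Real.sqrt P.C * θ)]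
/-- The unit tangent vector of the parallel circles. -/
noncomputable def τ (θ : ℝ) : E4 :=
  !₂[0, 0, -Real.sin (Real.sqrt P.C * θ), Real.cos (Real.sqrt P.C * θ)]
/-- The rotational surface. -/
noncomputable def Y (p : ℝ × ℝ) : E4 := P.r p.1 • P.u p.1 + P.ρ p.1 • P.w p.2
/-- The unit tangent vector of the meridians. -/
noncomputable def e (p : ℝ × ℝ) : E4 :=
  (-(P.ρ p.1 * P.α p.1 / P.r p.1)) • P.u p.1 + (P.β p.1 / P.r p.1) • P.ju p.1 + P.α p.1 • P.w p.2
/-- The unit normal of the surface in the sphere. -/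
noncomputable def η (p : ℝ × ℝ) : E4 :=
  (-(P.ρ p.1 * P.β p.1 / P.r p.1)) • P.u p.1 + (-(P.α p.1 / P.r p.1)) • P.ju p.1 + P.β p.1 • P.w p.2

lemma _root_.BiconsSphere.hasDerivAt_E4 {f0 f1 f2 f3 : ℝ → ℝ} {d0 d1 d2 d3 x : ℝ} (h0 : HasDerivAt f0 d0 x)
    (h1 : HasDerivAt f1 d1 x) (h2 : HasDerivAt f2 d2 x) (h3 : HasDerivAt f3 d3 x) :
    HasDerivAt (fun y => (!₂[f0 y, f1 y, f2 y, f3 y] : E4)) !₂[d0, d1, d2, d3] x := by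
  have : HasDerivAt (fun y => ![f0 y, f1 y, f2 y, f3 y]) ![d0, d1, d2, d3] x := by
    rw [hasDerivAt_pi]
    intro i; fin_cases i <;> assumption
  exact (PiLp.continuousLinearEquiv 2 ℝ fun _ : Fin 4 => ℝ).symm.hasFDerivAt.comp_hasDerivAt x this

lemma hu (h : ℝ) : HasDerivAt P.u ((P.v h * (P.β h / P.r h ^ 2)) • P.ju h) h := by
  refine (hasDerivAt_E4 (P.ha h) (P.hb h) (hasDerivAt_const h (0 : ℝ))
    (hasDerivAt_const h (0 : ℝ))).congr_deriv ?_
  ext i; fin_cases i <;> simp [ju]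

lemma hju (h : ℝ) : HasDerivAt P.ju (-(P.v h * (P.β h / P.r h ^ 2)) • P.u h) h := by
  refine (hasDerivAt_E4 (P.hb h).neg (P.ha h) (hasDerivAt_const h (0 : ℝ))
    (hasDerivAt_const h (0 : ℝ))).congr_deriv ?_
  ext i; fin_cases i <;> simp [u]

lemma hw (θ : ℝ) : HasDerivAt P.w (Real.sqrt P.C • P.τ θ) θ := by
  have h := (hasDerivAt_id θ).const_mul (Real.sqrt P.C)
  refine (hasDerivAt_E4 (hasDerivAt_const θ (0 : ℝ)) (hasDerivAt_const θ (0 : ℝ)) h.cos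
    h.sin).congr_deriv ?_
  ext i; fin_cases i <;> simp [τ] <;> ring

lemma hτ (θ : ℝ) : HasDerivAt P.τ (-(Real.sqrt P.C) • P.w θ) θ := by
  have h := (hasDerivAt_id θ).const_mul (Real.sqrt P.C)
  refine (hasDerivAt_E4 (hasDerivAt_const θ (0 : ℝ)) (hasDerivAt_const θ (0 : ℝ)) h.sin.neg
    h.cos).congr_deriv ?_
  ext i; fin_cases i <;> simp [w] <;> ring

lemma contDiff_u : ContDiff ℝ 3 P.u := by
  rw [contDiff_euclidean]
  have := P.contDiff_a
  have := P.contDiff_b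
  intro i; fin_cases i <;> simp [u] <;> fun_prop

lemma contDiff_ju : ContDiff ℝ 3 P.ju := by
  rw [contDiff_euclidean]
  have := P.contDiff_a
  have := P.contDiff_b
  intro i; fin_cases i <;> simp [ju] <;> fun_prop

lemma contDiff_w : ContDiff ℝ 3 P.w := by
  rw [contDiff_euclidean]
  intro i; fin_cases i <;> simp [w] <;> fun_prop

lemma contDiff_Y : ContDiff ℝ 3 P.Y := by
  have := P.contDiff_u
  have := P.contDiff_w
  have := P.contDiff_r
  have := P.contDiff_ρ
  unfold Y; fun_prop

lemma contDiff_η : ContDiff ℝ 3 P.η := by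
  have := P.contDiff_u
  have := P.contDiff_ju
  have := P.contDiff_w
  have := P.contDiff_r
  have := P.contDiff_ρ
  have := P.contDiff_α
  have := P.contDiff_β
  unfold η; simp only [div_eq_mul_inv]
  fun_prop (disch := exact fun x => (P.r_pos x.1).ne')

/-- The differential with values `x` and `y` on the two coordinate vectors of `ℝ²`. -/
noncomputable abbrev _root_.BiconsSphere.lin2 (x y : E4) : ℝ × ℝ →L[ℝ] E4 :=
  (ContinuousLinearMap.fst ℝ ℝ ℝ).smulRight x + (ContinuousLinearMap.snd ℝ ℝ ℝ).smulRight y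

lemma _root_.BiconsSphere.hasFDerivAt_smul_fst {f : ℝ → ℝ} {g : ℝ → E4} {f' : ℝ} {g' : E4} {p : ℝ × ℝ}
    (hf : HasDerivAt f f' p.1) (hg : HasDerivAt g g' p.1) :
    HasFDerivAt (fun q : ℝ × ℝ => f q.1 • g q.1) (lin2 (f p.1 • g' + f' • g p.1) 0) p := by
  have h1 := (hf.smul hg).hasFDerivAt.comp p (hasFDerivAt_fst (𝕜 := ℝ) (E := ℝ) (F := ℝ))
  refine h1.congr_fderiv ?_
  ext <;> simp

lemma _root_.BiconsSphere.hasFDerivAt_smul_fst_snd {f : ℝ → ℝ} {g : ℝ → E4} {f' : ℝ} {g' : E4} {p : ℝ × ℝ}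
    (hf : HasDerivAt f f' p.1) (hg : HasDerivAt g g' p.2) :
    HasFDerivAt (fun q : ℝ × ℝ => f q.1 • g q.2) (lin2 (f' • g p.2) (f p.1 • g')) p := by
  have h1 := hf.hasFDerivAt.comp p (hasFDerivAt_fst (𝕜 := ℝ) (E := ℝ) (F := ℝ))
  have h2 := hg.hasFDerivAt.comp p (hasFDerivAt_snd (𝕜 := ℝ) (E := ℝ) (F := ℝ))
  refine (h1.smul h2).congr_fderiv ?_
  ext <;> simp

lemma _root_.BiconsSphere.lin2_add (x y x' y' : E4) : lin2 x y + lin2 x' y' = lin2 (x + x') (y + y') := by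
  ext <;> simp

lemma hasFDerivAt_Y (p : ℝ × ℝ) : HasFDerivAt P.Y
    (lin2 (P.v p.1 • P.e p) ((Real.sqrt P.C * P.ρ p.1) • P.τ p.2)) p := by
  refine ((hasFDerivAt_smul_fst (P.hr p.1) (P.hu p.1)).add
    (hasFDerivAt_smul_fst_snd (P.hρ p.1) (P.hw p.2))).congr_fderiv ?_
  rw [lin2_add]
  have h1 := P.r_pos p.1
  congr 2
  · unfold e
    match_scalars <;> field_simp
  · match_scalars; ring

lemma hasFDerivAt_e (p : ℝ × ℝ) : HasFDerivAt P.e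
    (lin2 (P.v p.1 • (-P.Y p + P.κ p.1 • P.η p)) ((Real.sqrt P.C * P.α p.1) • P.τ p.2)) p := by
  have h1 := P.r_pos p.1
  have h2 := P.r_sq p.1
  have h3 := P.sphere p.1
  have h4 := P.ρ_pos p.1
  refine (((hasFDerivAt_smul_fst (((P.hρ p.1).mul (P.hα p.1)).div (P.hr p.1) h1.ne').neg
    (P.hu p.1)).add (hasFDerivAt_smul_fst ((P.hβ p.1).div (P.hr p.1) h1.ne') (P.hju p.1))).add
    (hasFDerivAt_smul_fst_snd (P.hα p.1) (P.hw p.2))).congr_fderiv ?_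
  rw [lin2_add, lin2_add]
  congr 2
  · unfold Y η κ
    match_scalars <;> simp <;> field_simp <;> grind
  · match_scalars; ring

lemma hasFDerivAt_η (p : ℝ × ℝ) : HasFDerivAt P.η
    (lin2 (-(P.v p.1 * P.κ p.1) • P.e p) ((Real.sqrt P.C * P.β p.1) • P.τ p.2)) p := by
  have h1 := P.r_pos p.1
  have h2 := P.r_sq p.1
  have h3 := P.sphere p.1
  have h4 := P.ρ_pos p.1
  refine (((hasFDerivAt_smul_fst (((P.hρ p.1).mul (P.hβ p.1)).div (P.hr p.1) h1.ne').neg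
    (P.hu p.1)).add (hasFDerivAt_smul_fst ((P.hα p.1).div (P.hr p.1) h1.ne').neg (P.hju p.1))).add
    (hasFDerivAt_smul_fst_snd (P.hβ p.1) (P.hw p.2))).congr_fderiv ?_
  rw [lin2_add, lin2_add]
  congr 2
  · unfold e κ
    match_scalars <;> simp <;> field_simp <;> grind
  · match_scalars; ring

end ProfileFlow


/-! ### Completeness of the induced metric -/

/-- An immersion whose differential is bounded below expands distances, so Cauchy sequences of the
induced distance are Cauchy sequences of the plane. -/
lemma complete_of_le_fderiv {Ψ : ℝ × ℝ → E4} (hΨ : ContDiff ℝ 3 Ψ) {m : ℝ} (hm : 0 < m)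
    (hbd : ∀ p x, m * ‖x‖ ≤ ‖fderiv ℝ Ψ p x‖) (u : ℕ → ℝ × ℝ)
    (hu : ∀ ε > 0, ∃ N, ∀ i ≥ N, ∀ j ≥ N, surfDist Ψ (u i) (u j) < ε) :
    ∃ p, Tendsto u atTop (𝓝 p) := by
  have hlen : ∀ σ : ℝ → ℝ × ℝ, ContDiff ℝ 1 σ → m * ‖σ 1 - σ 0‖ ≤ curveLength Ψ σ := by
    intro σ hσ
    have hc : Continuous (deriv σ) := hσ.continuous_deriv le_rfl
    have hc2 : Continuous fun u => fderiv ℝ Ψ (σ u) (deriv σ u) :=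
      ((hΨ.continuous_fderiv (by norm_num)).comp hσ.continuous).clm_apply hc
    have h1 : ∫ u in (0 : ℝ)..1, deriv σ u = σ 1 - σ 0 :=
      intervalIntegral.integral_deriv_eq_sub
        (fun x _ => (hσ.differentiable (by norm_num)).differentiableAt)
        (hc.intervalIntegrable _ _)
    have h2 : ‖∫ u in (0 : ℝ)..1, deriv σ u‖ ≤ ∫ u in (0 : ℝ)..1, ‖deriv σ u‖ :=
      intervalIntegral.norm_integral_le_integral_norm (by norm_num)
    have h3 : ∫ u in (0 : ℝ)..1, m * ‖deriv σ u‖ ≤ curveLength Ψ σ :=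
      intervalIntegral.integral_mono_on (by norm_num)
        ((continuous_const.mul hc.norm).intervalIntegrable _ _)
        (hc2.norm.intervalIntegrable _ _) fun x _ => hbd _ _
    rw [intervalIntegral.integral_const_mul] at h3
    rw [← h1]
    exact (mul_le_mul_of_nonneg_left h2 hm.le).trans h3
  refine cauchySeq_tendsto_of_complete (Metric.cauchySeq_iff.2 fun ε hε => ?_)
  obtain ⟨N, hN⟩ := hu (m * ε) (by positivity)
  refine ⟨N, fun i hi j hj => ?_⟩
  have hne : {l : ℝ | ∃ σ : ℝ → ℝ × ℝ, ContDiff ℝ 1 σ ∧ σ 0 = u i ∧ σ 1 = u j ∧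
      l = curveLength Ψ σ}.Nonempty :=
    ⟨_, fun s => u i + s • (u j - u i), by fun_prop, by simp, by simp, rfl⟩
  obtain ⟨l, ⟨σ, hσ, h0, h1, rfl⟩, hl⟩ := exists_lt_of_csInf_lt hne (hN i hi j hj)
  have := hlen σ hσ
  rw [h0, h1] at this
  rw [dist_comm, dist_eq_norm]
  exact lt_of_mul_lt_mul_left (this.trans_lt hl) hm.le

namespace ProfileFlow
variable (P : ProfileFlow)

/-! ### Geometry of the rotational surface -/

lemma inner_E4 (x y : E4) : inner ℝ x y = x 0 * y 0 + x 1 * y 1 + x 2 * y 2 + x 3 * y 3 := by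
  simp [PiLp.inner_apply, Fin.sum_univ_four, mul_comm]

lemma inner_uu (h : ℝ) : inner ℝ (P.u h) (P.u h) = 1 := by
  rw [inner_E4]; simp [u]; linarith [P.circle h]
lemma inner_ujju (h : ℝ) : inner ℝ (P.ju h) (P.ju h) = 1 := by
  rw [inner_E4]; simp [ju]; linarith [P.circle h]
lemma inner_uju (h : ℝ) : inner ℝ (P.u h) (P.ju h) = 0 := by
  rw [inner_E4]; simp [ju, u]; ring
lemma inner_juu (h : ℝ) : inner ℝ (P.ju h) (P.u h) = 0 := by
  rw [inner_E4]; simp [ju, u]; ring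
lemma inner_uw (h θ : ℝ) : inner ℝ (P.u h) (P.w θ) = 0 := by
  rw [inner_E4]; simp [w, u]
lemma inner_juw (h θ : ℝ) : inner ℝ (P.ju h) (P.w θ) = 0 := by
  rw [inner_E4]; simp [w, ju]
lemma inner_wu (h θ : ℝ) : inner ℝ (P.w θ) (P.u h) = 0 := by
  rw [inner_E4]; simp [w, u]
lemma inner_wju (h θ : ℝ) : inner ℝ (P.w θ) (P.ju h) = 0 := by
  rw [inner_E4]; simp [w, ju]
lemma inner_uτ (h θ : ℝ) : inner ℝ (P.u h) (P.τ θ) = 0 := by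
  rw [inner_E4]; simp [τ, u]
lemma inner_juτ (h θ : ℝ) : inner ℝ (P.ju h) (P.τ θ) = 0 := by
  rw [inner_E4]; simp [τ, ju]
lemma inner_ww (θ : ℝ) : inner ℝ (P.w θ) (P.w θ) = 1 := by
  rw [inner_E4]; simp [w]; linarith [Real.cos_sq_add_sin_sq (Real.sqrt P.C * θ)]
lemma inner_ττ (θ : ℝ) : inner ℝ (P.τ θ) (P.τ θ) = 1 := by
  rw [inner_E4]; simp [τ]; linarith [Real.cos_sq_add_sin_sq (Real.sqrt P.C * θ)]
lemma inner_wτ (θ : ℝ) : inner ℝ (P.w θ) (P.τ θ) = 0 := by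
  rw [inner_E4]; simp [τ, w]; ring

lemma _root_.BiconsSphere.norm_eq_one_of_inner {x : E4} (h : inner ℝ x x = 1) : ‖x‖ = 1 := by
  rw [real_inner_self_eq_norm_sq] at h
  nlinarith [norm_nonneg x]

lemma norm_w (θ : ℝ) : ‖P.w θ‖ = 1 := norm_eq_one_of_inner (P.inner_ww θ)
lemma norm_τ (θ : ℝ) : ‖P.τ θ‖ = 1 := norm_eq_one_of_inner (P.inner_ττ θ)

lemma frame_aux {x y z x' y' z' : ℝ} (p : ℝ × ℝ) :
    inner ℝ (x • P.u p.1 + y • P.ju p.1 + z • P.w p.2)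
      (x' • P.u p.1 + y' • P.ju p.1 + z' • P.w p.2) = x * x' + y * y' + z * z' := by
  simp only [inner_add_left, inner_add_right, inner_smul_left, inner_smul_right, inner_uu,
    inner_ujju, inner_uju, inner_juu, inner_uw, inner_juw, inner_wu, inner_wju, inner_ww]
  simp; ring

lemma Y_eq (p : ℝ × ℝ) :
    P.Y p = P.r p.1 • P.u p.1 + (0 : ℝ) • P.ju p.1 + P.ρ p.1 • P.w p.2 := by
  unfold Y; simp

lemma inner_YY (p : ℝ × ℝ) : inner ℝ (P.Y p) (P.Y p) = 1 := by
  rw [Y_eq, frame_aux]; linarith [P.r_sq p.1]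

lemma inner_ee (p : ℝ × ℝ) : inner ℝ (P.e p) (P.e p) = 1 := by
  have := P.r_pos p.1
  have := P.r_sq p.1
  have := P.sphere p.1
  unfold e; rw [frame_aux]; field_simp; grind

lemma inner_ηη (p : ℝ × ℝ) : inner ℝ (P.η p) (P.η p) = 1 := by
  have := P.r_pos p.1
  have := P.r_sq p.1
  have := P.sphere p.1
  unfold η; rw [frame_aux]; field_simp; grind

lemma norm_Y (p : ℝ × ℝ) : ‖P.Y p‖ = 1 := norm_eq_one_of_inner (P.inner_YY p)
lemma norm_e (p : ℝ × ℝ) : ‖P.e p‖ = 1 := norm_eq_one_of_inner (P.inner_ee p)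
lemma norm_η (p : ℝ × ℝ) : ‖P.η p‖ = 1 := norm_eq_one_of_inner (P.inner_ηη p)

lemma inner_Ye (p : ℝ × ℝ) : inner ℝ (P.Y p) (P.e p) = 0 := by
  have := P.r_pos p.1
  rw [Y_eq]; unfold e; rw [frame_aux]; field_simp; ring

lemma inner_Yη (p : ℝ × ℝ) : inner ℝ (P.Y p) (P.η p) = 0 := by
  have := P.r_pos p.1
  rw [Y_eq]; unfold η; rw [frame_aux]; field_simp; ring

lemma inner_eη (p : ℝ × ℝ) : inner ℝ (P.e p) (P.η p) = 0 := by
  have := P.r_pos p.1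
  have := P.r_sq p.1
  have := P.sphere p.1
  unfold e η; rw [frame_aux]; field_simp; grind

lemma inner_Yτ (p : ℝ × ℝ) : inner ℝ (P.Y p) (P.τ p.2) = 0 := by
  unfold Y; simp [inner_add_left, inner_smul_left, inner_uτ, inner_wτ]
lemma inner_eτ (p : ℝ × ℝ) : inner ℝ (P.e p) (P.τ p.2) = 0 := by
  unfold e; simp [inner_add_left, inner_smul_left, inner_uτ, inner_juτ, inner_wτ]
lemma inner_ητ (p : ℝ × ℝ) : inner ℝ (P.η p) (P.τ p.2) = 0 := by
  unfold η; simp [inner_add_left, inner_smul_left, inner_uτ, inner_juτ, inner_wτ]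
lemma inner_ηe (p : ℝ × ℝ) : inner ℝ (P.η p) (P.e p) = 0 := by
  rw [real_inner_comm]; exact P.inner_eη p
lemma inner_ηY (p : ℝ × ℝ) : inner ℝ (P.η p) (P.Y p) = 0 := by
  rw [real_inner_comm]; exact P.inner_Yη p
lemma inner_τe (p : ℝ × ℝ) : inner ℝ (P.τ p.2) (P.e p) = 0 := by
  rw [real_inner_comm]; exact P.inner_eτ p

lemma inner_ηw (p : ℝ × ℝ) : inner ℝ (P.η p) (P.w p.2) = P.β p.1 := by
  unfold η; simp [inner_add_left, inner_smul_left, inner_uw, inner_juw, norm_w]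

/-- The radial vector of the rotation plane in the adapted frame. -/
lemma w_eq (p : ℝ × ℝ) : P.w p.2 = P.ρ p.1 • P.Y p + P.α p.1 • P.e p + P.β p.1 • P.η p := by
  have h1 := P.r_pos p.1
  have h2 := P.r_sq p.1
  have h3 := P.sphere p.1
  unfold Y e η
  match_scalars <;> field_simp <;> grind

lemma fderiv_Y (p x : ℝ × ℝ) : fderiv ℝ P.Y p x =
    (x.1 * P.v p.1) • P.e p + (x.2 * (Real.sqrt P.C * P.ρ p.1)) • P.τ p.2 := by
  rw [(P.hasFDerivAt_Y p).fderiv]; simp [smul_smul]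

lemma norm_fderiv_Y_sq (p x : ℝ × ℝ) : ‖fderiv ℝ P.Y p x‖ ^ 2 =
    (x.1 * P.v p.1) ^ 2 + (x.2 * (Real.sqrt P.C * P.ρ p.1)) ^ 2 := by
  rw [fderiv_Y, ← real_inner_self_eq_norm_sq]
  simp only [inner_add_left, inner_add_right, inner_smul_left, inner_smul_right, inner_ee,
    inner_eτ, inner_τe, inner_ττ]
  simp; ring

lemma injective_fderiv_Y (p : ℝ × ℝ) : Function.Injective (fderiv ℝ P.Y p) := by
  rw [injective_iff_map_eq_zero]
  intro x hx
  have h := P.norm_fderiv_Y_sq p x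
  rw [hx, norm_zero] at h
  have h1 := P.v_pos p.1
  have h2 := P.ρ_pos p.1
  have h3 := Real.sqrt_pos.2 P.C_pos
  have e1 : (x.1 * P.v p.1) ^ 2 = 0 := by nlinarith [sq_nonneg (x.1 * P.v p.1), sq_nonneg (x.2 * (Real.sqrt P.C * P.ρ p.1))]
  have e2 : (x.2 * (Real.sqrt P.C * P.ρ p.1)) ^ 2 = 0 := by nlinarith [sq_nonneg (x.1 * P.v p.1), sq_nonneg (x.2 * (Real.sqrt P.C * P.ρ p.1))]
  ext
  · simpa [h1.ne'] using e1
  · simpa [h2.ne', h3.ne'] using e2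

lemma one_le_v (h : ℝ) : 1 ≤ P.v h := by
  unfold v
  rw [one_le_div (Real.sqrt_pos.2 (P.speed h)), Real.sqrt_le_one]
  nlinarith [sq_nonneg (P.μ * P.α h)]

lemma le_ρ (h : ℝ) : 1 / (3 * Real.sqrt 3 * P.C ^ 2) ≤ P.ρ h := by
  have hc := P.C_pos
  have h1 := P.const h
  have h2 := P.β_pos h
  have h3 : P.β h ^ 3 ≤ 1 := by
    refine pow_le_one₀ h2.le ?_
    nlinarith [P.sphere h, sq_nonneg (P.α h), sq_nonneg (P.ρ h)]
  rw [div_le_iff₀ (by positivity), ← h1]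
  have := P.ρ_pos h
  have : P.β h ^ 3 * P.ρ h ≤ 1 * P.ρ h := by gcongr
  have h5 : 0 < 3 * Real.sqrt 3 * P.C ^ 2 := by positivity
  nlinarith

lemma le_norm_fderiv_Y : ∃ m > 0, ∀ p x, m * ‖x‖ ≤ ‖fderiv ℝ P.Y p x‖ := by
  have hc := P.C_pos
  set l := Real.sqrt P.C * (1 / (3 * Real.sqrt 3 * P.C ^ 2)) with hl
  have hl0 : 0 < l := by positivity
  refine ⟨min 1 l, lt_min one_pos hl0, fun p x => ?_⟩
  have h := P.norm_fderiv_Y_sq p x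
  have hm0 : 0 < min 1 l := lt_min one_pos hl0
  have h1 : min 1 l ≤ P.v p.1 := (min_le_left _ _).trans (P.one_le_v p.1)
  have h2 : min 1 l ≤ Real.sqrt P.C * P.ρ p.1 :=
    (min_le_right _ _).trans (mul_le_mul_of_nonneg_left (P.le_ρ p.1) (Real.sqrt_nonneg _))
  rw [Prod.norm_def, mul_max_of_nonneg _ _ hm0.le, Real.norm_eq_abs, Real.norm_eq_abs]
  refine max_le ?_ ?_
  · refine abs_le_of_sq_le_sq' ?_ (norm_nonneg _) |>.2
    rw [h, mul_pow, sq_abs, mul_pow]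
    have : min 1 l ^ 2 ≤ P.v p.1 ^ 2 := by gcongr
    nlinarith [sq_nonneg x.1, sq_nonneg (x.2 * (Real.sqrt P.C * P.ρ p.1))]
  · refine abs_le_of_sq_le_sq' ?_ (norm_nonneg _) |>.2
    rw [h, mul_pow, sq_abs, mul_pow x.2]
    have : min 1 l ^ 2 ≤ (Real.sqrt P.C * P.ρ p.1) ^ 2 := by gcongr
    nlinarith [sq_nonneg x.2, sq_nonneg (x.1 * P.v p.1)]

lemma isCompleteImmersion_Y : IsCompleteImmersion P.Y where
  contDiff := P.contDiff_Y
  sphere := P.norm_Y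
  immersion := P.injective_fderiv_Y
  complete := by
    obtain ⟨m, hm, h⟩ := P.le_norm_fderiv_Y
    exact complete_of_le_fderiv P.contDiff_Y hm h

lemma pd_zero_Y : pd 0 P.Y = fun p => P.v p.1 • P.e p := by
  ext1 p; simp [pd, fderiv_Y]

lemma pd_one_Y : pd 1 P.Y = fun p => (Real.sqrt P.C * P.ρ p.1) • P.τ p.2 := by
  ext1 p; simp [pd, fderiv_Y]

lemma firstForm_Y (p : ℝ × ℝ) :
    firstForm P.Y p = Matrix.diagonal ![P.v p.1 ^ 2, P.C * P.ρ p.1 ^ 2] := by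
  have hc : Real.sqrt P.C ^ 2 = P.C := Real.sq_sqrt P.C_pos.le
  ext i j
  fin_cases i <;> fin_cases j <;>
    simp [firstForm, pd_zero_Y, pd_one_Y, inner_smul_left, inner_smul_right, inner_eτ,
      inner_τe, norm_smul, norm_e, norm_τ]
  rw [mul_pow, sq_abs, sq_abs, hc]

lemma differentiableAt_v (h : ℝ) : DifferentiableAt ℝ P.v h := by
  have h1 := (P.hα h).differentiableAt
  have h2 := (P.speed h).ne'
  have h3 := (Real.sqrt_pos.2 (P.speed h)).ne'
  unfold v
  fun_prop (disch := assumption)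

lemma secondForm_Y (p : ℝ × ℝ) : secondForm P.Y P.η p =
    Matrix.diagonal ![P.v p.1 ^ 2 * P.κ p.1, -(P.C * P.ρ p.1 * P.β p.1)] := by
  have hc : Real.sqrt P.C ^ 2 = P.C := Real.sq_sqrt P.C_pos.le
  have h0 : ∀ x, fderiv ℝ (pd 0 P.Y) p x =
      (x.1 * deriv P.v p.1) • P.e p + P.v p.1 • ((x.1 * P.v p.1) • (-P.Y p + P.κ p.1 • P.η p) +
        (x.2 * (Real.sqrt P.C * P.α p.1)) • P.τ p.2) := by
    intro x
    rw [pd_zero_Y]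
    have h1 := (P.differentiableAt_v p.1).hasDerivAt.hasFDerivAt.comp p
      (hasFDerivAt_fst (𝕜 := ℝ) (E := ℝ) (F := ℝ))
    have h2 := h1.smul (P.hasFDerivAt_e p)
    erw [h2.fderiv]
    simp only [Function.comp, add_apply, smul_apply,
      ContinuousLinearMap.smulRight_apply, ContinuousLinearMap.comp_apply,
      ContinuousLinearMap.coe_fst', ContinuousLinearMap.coe_snd',
      ContinuousLinearMap.toSpanSingleton_apply, smul_smul]
    module
  have h1 : ∀ x, fderiv ℝ (pd 1 P.Y) p x =
      (x.1 * (Real.sqrt P.C * (P.v p.1 * P.α p.1))) • P.τ p.2 +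
        (x.2 * (Real.sqrt P.C * P.ρ p.1 * -Real.sqrt P.C)) • P.w p.2 := by
    intro x
    rw [pd_one_Y]
    have h2 := hasFDerivAt_smul_fst_snd ((P.hρ p.1).const_mul (Real.sqrt P.C)) (P.hτ p.2)
    rw [h2.fderiv]
    simp [smul_smul]
  ext i j
  fin_cases i <;> fin_cases j <;>
    simp [secondForm, pd.eq_1 _ (pd _ _), h0, h1, inner_add_right, inner_smul_right, inner_ηe,
      inner_ητ, inner_ηY, norm_η, inner_ηw]
  · ring
  · left; linear_combination (P.ρ p.1) * hc

lemma inv_firstForm_Y (p : ℝ × ℝ) : (firstForm P.Y p)⁻¹ =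
    Matrix.diagonal ![1 / P.v p.1 ^ 2, 1 / (P.C * P.ρ p.1 ^ 2)] := by
  have h1 := P.v_pos p.1
  have h2 := P.ρ_pos p.1
  have h3 := P.C_pos
  rw [firstForm_Y]
  refine Matrix.inv_eq_left_inv ?_
  rw [Matrix.diagonal_mul_diagonal, ← Matrix.diagonal_one]
  congr 1
  ext i; fin_cases i <;> simp <;> field_simp

lemma shapeOp_Y (p : ℝ × ℝ) :
    shapeOp P.Y P.η p = Matrix.diagonal ![P.κ p.1, -(3 * P.κ p.1)] := by
  have h1 := P.v_pos p.1
  have h2 := P.ρ_pos p.1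
  have h3 := P.C_pos
  unfold shapeOp
  rw [inv_firstForm_Y, secondForm_Y, Matrix.diagonal_mul_diagonal]
  congr 1
  ext i; fin_cases i <;> simp [κ] <;> field_simp

lemma meanCurv_Y : meanCurv P.Y P.η = fun p => -(2 * P.κ p.1) := by
  ext p
  simp [meanCurv, shapeOp_Y, Matrix.trace, Fin.sum_univ_two]
  ring

lemma differentiableAt_κ (h : ℝ) : DifferentiableAt ℝ P.κ h := by
  have h1 := (P.hρ h).differentiableAt
  have h2 := (P.hβ h).differentiableAt
  have h3 : 3 * P.ρ h ≠ 0 := by have := P.ρ_pos h; positivity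
  unfold κ
  fun_prop (disch := assumption)

lemma isBiconservative_Y : IsBiconservative P.Y := by
  refine ⟨P.η, P.contDiff_η.continuous, fun p => ⟨P.norm_η p, P.inner_ηY p, fun i => ?_⟩,
    fun p => ?_⟩
  · fin_cases i <;> simp [pd_zero_Y, pd_one_Y, inner_smul_right, inner_ηe, inner_ητ]
  · have h1 : pd 1 (meanCurv P.Y P.η) p = 0 := by
      have h2 := ((P.differentiableAt_κ p.1).hasDerivAt.const_mul 2).neg.hasFDerivAt.comp p
        (hasFDerivAt_fst (𝕜 := ℝ) (E := ℝ) (F := ℝ))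
      unfold pd
      rw [meanCurv_Y]
      erw [h2.fderiv]
      simp
    have h3 : gradient P.Y (meanCurv P.Y P.η) p 1 = 0 := by
      unfold gradient
      rw [inv_firstForm_Y, Matrix.mulVec_diagonal]
      simp [h1]
    rw [shapeOp_Y]
    ext i
    rw [Matrix.mulVec_diagonal]
    fin_cases i
    · simp [meanCurv_Y]; ring
    · simp [h3]

end ProfileFlow


/-! ### The maps `Φ_{C, C*}` as profile flows -/

lemma exists_of_modEq {x y : ℝ} (h : x ≡ y [PMOD (2 * Real.pi)]) :
    ∃ n : ℤ, x = y + n * (2 * Real.pi) := by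
  obtain ⟨n, hn⟩ := AddCommGroup.modEq_iff_zsmul.1 h.symm
  exact ⟨n, by rw [zsmul_eq_mul] at hn; linarith⟩

lemma cos_eq_of_modEq {x y : ℝ} (h : x ≡ y [PMOD (2 * Real.pi)]) : Real.cos x = Real.cos y := by
  obtain ⟨n, rfl⟩ := exists_of_modEq h
  exact Real.cos_add_int_mul_two_pi _ _

lemma sin_eq_of_modEq {x y : ℝ} (h : x ≡ y [PMOD (2 * Real.pi)]) : Real.sin x = Real.sin y := by
  obtain ⟨n, rfl⟩ := exists_of_modEq h
  exact Real.sin_add_int_mul_two_pi _ _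

/-- At the common node two consecutive pieces have the same position in the first plane. -/
lemma cos_sin_node {z c c' : ℝ} (h : c' ≡ -2 * z - c [PMOD (2 * Real.pi)]) :
    Real.cos (z + c') = Real.cos (z + c) ∧ Real.sin (z + c') = -Real.sin (z + c) := by
  have h1 : z + c' ≡ -(z + c) [PMOD (2 * Real.pi)] := by
    have := h.add_left z
    rwa [show z + (-2 * z - c) = -(z + c) by ring] at this
  rw [cos_eq_of_modEq h1, sin_eq_of_modEq h1, Real.cos_neg, Real.sin_neg]
  exact ⟨rfl, rfl⟩

/-- The radius of the parallel circle as a function of `ξ`. -/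
noncomputable def rhoX (C ξ : ℝ) : ℝ := 1 / (Real.sqrt C * ξ)
/-- The radial component of the unit normal as a function of `ξ`. -/
noncomputable def betaX (C ξ : ℝ) : ℝ := ξ ^ (1 / 3 : ℝ) / (Real.sqrt 3 * Real.sqrt C)
/-- The absolute value of the derivative of the radius by arc length, as a function of `ξ`. -/
noncomputable def alphaX (C ξ : ℝ) : ℝ := Real.sqrt (1 - rhoX C ξ ^ 2 - betaX C ξ ^ 2)

section
variable {C : ℝ} (hC : critC < C)
include hC

lemma one_sub_rhoX {ξ : ℝ} (h : 0 < ξ) :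
    1 - rhoX C ξ ^ 2 - betaX C ξ ^ 2 = T C ξ / (3 * C * ξ ^ 2) := by
  have hc := C_pos hC
  obtain ⟨x, hx, rfl⟩ := exists_cube h
  unfold rhoX betaX
  rw [T_cube C hx.le, rpow_two_thirds_pow x hx.le 3 1 (1 / 3) (by norm_num)]
  have h3 : Real.sqrt 3 ^ 2 = 3 := Real.sq_sqrt (by norm_num)
  have hs : Real.sqrt C ^ 2 = C := Real.sq_sqrt hc.le
  have h4 := Real.sqrt_pos.2 hc
  rw [div_pow, div_pow, mul_pow, mul_pow, h3, hs]
  field_simp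
  ring

lemma alphaX_sq {ξ : ℝ} (h : ξ ∈ Icc (xi01 C) (xi02 C)) :
    alphaX C ξ ^ 2 = T C ξ / (3 * C * ξ ^ 2) := by
  have h1 := pos_of_mem hC h
  have h2 := T_nonneg hC h
  have hc := C_pos hC
  unfold alphaX
  rw [Real.sq_sqrt, one_sub_rhoX hC h1]
  rw [one_sub_rhoX hC h1]; positivity

lemma alphaX_eq {ξ : ℝ} (h : ξ ∈ Icc (xi01 C) (xi02 C)) :
    alphaX C ξ = Real.sqrt (T C ξ) / (Real.sqrt 3 * Real.sqrt C * ξ) := by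
  have h1 := pos_of_mem hC h
  have hc := C_pos hC
  unfold alphaX
  rw [one_sub_rhoX hC h1, Real.sqrt_div' _ (by positivity), Real.sqrt_mul (by positivity),
    Real.sqrt_mul (by positivity), Real.sqrt_sq h1.le]

lemma alphaX_eNode (k : ℤ) : alphaX C (eNode C k) = 0 := by
  rw [alphaX_eq hC (eNode_mem hC k)]
  have : T C (eNode C k) = 0 := by
    rcases Int.even_or_odd k with h | h
    · rw [eNode_even h, T_xi01 hC]
    · rw [eNode_odd h, T_xi02 hC]
  simp [this]

lemma rhoX_pos {ξ : ℝ} (h : 0 < ξ) : 0 < rhoX C ξ := by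
  have := Real.sqrt_pos.2 (C_pos hC)
  unfold rhoX; positivity

lemma betaX_pos {ξ : ℝ} (h : 0 < ξ) : 0 < betaX C ξ := by
  have := Real.sqrt_pos.2 (C_pos hC)
  unfold betaX; positivity

lemma continuousOn_alphaX : ContinuousOn (alphaX C) (Icc (xi01 C) (xi02 C)) := by
  have hs := Real.sqrt_pos.2 (C_pos hC)
  have h1 : ContinuousOn (fun x => rhoX C x) (Icc (xi01 C) (xi02 C)) := by
    unfold rhoX
    refine continuousOn_const.div (by fun_prop) fun x hx => ?_
    have := pos_of_mem hC hx
    positivity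
  have h2 : Continuous fun x => betaX C x := by
    unfold betaX
    exact (Real.continuous_rpow_const (by norm_num)).div_const _
  unfold alphaX
  have := h2.continuousOn (s := Icc (xi01 C) (xi02 C))
  fun_prop

end

/-- The derivative of the radius by arc length along the profile curve, as a function of the height:
its absolute value is `alphaX`, its sign alternates with the index of the piece. -/
noncomputable def alphaF (C Cs h : ℝ) : ℝ := -(-1 : ℝ) ^ pieceIndex C Cs h * alphaX C (F C Cs h)
/-- The cosine of the angle of the profile curve in the first plane. -/
noncomputable def cosF (C Cs : ℝ) (c : ℤ → ℝ) (h : ℝ) : ℝ :=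
  Real.cos (zeta0 C (F C Cs h) + c (pieceIndex C Cs h))
/-- The sine of the angle of the profile curve in the first plane, with the sign `(-1) ^ k` that
the piece of index `k` carries in its second coordinate. -/
noncomputable def sinF (C Cs : ℝ) (c : ℤ → ℝ) (h : ℝ) : ℝ :=
  (-1 : ℝ) ^ pieceIndex C Cs h * Real.sin (zeta0 C (F C Cs h) + c (pieceIndex C Cs h))

section
variable {C Cs : ℝ} (hC : critC < C) (hS : RegularStar C Cs)
include hC hS

lemma pieceIndex_node (k : ℤ) : pieceIndex C Cs (node C Cs k) = k :=
  pieceIndex_eq hC hS ⟨le_rfl, node_strictMono hC hS (by lia)⟩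

lemma alphaF_eq {k : ℤ} {h : ℝ} (hh : h ∈ Icc (node C Cs k) (node C Cs (k + 1))) :
    alphaF C Cs h = -(-1 : ℝ) ^ k * alphaX C (F C Cs h) := by
  unfold alphaF
  rcases eq_or_lt_of_le hh.2 with h' | h'
  · rw [h', F_node hC hS, alphaX_eNode hC]; simp
  · rw [pieceIndex_eq hC hS ⟨hh.1, h'⟩]

lemma cosF_sinF_eq {c : ℤ → ℝ} (hc : PhaseRec C c) {k : ℤ} {h : ℝ}
    (hh : h ∈ Icc (node C Cs k) (node C Cs (k + 1))) :
    cosF C Cs c h = Real.cos (zeta0 C (F C Cs h) + c k) ∧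
    sinF C Cs c h = (-1 : ℝ) ^ k * Real.sin (zeta0 C (F C Cs h) + c k) := by
  unfold cosF sinF
  rcases eq_or_lt_of_le hh.2 with h' | h'
  · have h1 := phaseRec_iff.1 hc (k + 1)
    rw [add_sub_cancel_right] at h1
    obtain ⟨h2, h3⟩ := cos_sin_node h1
    rw [h', F_node hC hS, pieceIndex_node hC hS, h2, h3, neg_one_zpow_succ]
    simp
  · rw [pieceIndex_eq hC hS ⟨hh.1, h'⟩]; simp

lemma continuous_rhoF : Continuous fun h => rhoX C (F C Cs h) := by
  have := Real.sqrt_pos.2 (C_pos hC)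
  unfold rhoX
  refine continuous_const.div (continuous_const.mul (continuous_F hC hS)) fun h => ?_
  have := pos_of_mem hC (F_mem hC hS h)
  positivity

lemma continuous_betaF : Continuous fun h => betaX C (F C Cs h) := by
  unfold betaX
  exact ((continuous_F hC hS).rpow_const fun _ => Or.inr (by norm_num)).div_const _

lemma continuous_alphaF : Continuous (alphaF C Cs) := by
  refine continuous_of_strips (node_strictMono hC hS) (node_cover hC hS) continuous_id fun k => ?_
  refine ContinuousOn.congr (f := fun h => -(-1 : ℝ) ^ k * alphaX C (F C Cs h)) ?_
    fun h hh => alphaF_eq hC hS hh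
  exact continuousOn_const.mul ((continuousOn_alphaX hC).comp
    (continuous_F hC hS).continuousOn fun h _ => F_mem hC hS h)

lemma continuous_cosF_sinF {c : ℤ → ℝ} (hc : PhaseRec C c) :
    Continuous (cosF C Cs c) ∧ Continuous (sinF C Cs c) := by
  have hz : Continuous fun h => zeta0 C (F C Cs h) :=
    continuousOn_univ.1 ((continuousOn_zeta0 hC).comp (continuous_F hC hS).continuousOn
      fun h _ => F_mem hC hS h)
  constructor
  · refine continuous_of_strips (node_strictMono hC hS) (node_cover hC hS) continuous_id
      fun k => ?_
    exact ContinuousOn.congr (f := fun h => Real.cos (zeta0 C (F C Cs h) + c k)) 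
      (Real.continuous_cos.comp (hz.add_const _)).continuousOn
      fun h hh => (cosF_sinF_eq hC hS hc hh).1
  · refine continuous_of_strips (node_strictMono hC hS) (node_cover hC hS) continuous_id
      fun k => ?_
    exact ContinuousOn.congr
      (f := fun h => (-1 : ℝ) ^ k * Real.sin (zeta0 C (F C Cs h) + c k)) 
      (continuous_const.mul (Real.continuous_sin.comp (hz.add_const _))).continuousOn
      fun h hh => (cosF_sinF_eq hC hS hc hh).2

lemma speed_eq (h : ℝ) : 1 - (Cs * Real.sqrt C) ^ 2 * alphaF C Cs h ^ 2 =
    (3 * F C Cs h ^ 2 - Cs ^ 2 * T C (F C Cs h)) / (3 * F C Cs h ^ 2) := by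
  have hF := F_mem hC hS h
  have hp := pos_of_mem hC hF
  have hc := C_pos hC
  have h1 : alphaF C Cs h ^ 2 = T C (F C Cs h) / (3 * C * F C Cs h ^ 2) := by
    rw [← alphaX_sq hC hF]
    unfold alphaF
    rw [mul_pow, neg_sq, sq, neg_one_zpow_sq, one_mul]
  rw [h1, mul_pow, Real.sq_sqrt hc.le]
  field_simp

lemma speed_pos (h : ℝ) : 0 < 1 - (Cs * Real.sqrt C) ^ 2 * alphaF C Cs h ^ 2 := by
  have hF := F_mem hC hS h
  have hp := pos_of_mem hC hF
  rw [speed_eq hC hS]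
  exact div_pos (sub_pos.2 (hS _ hF)) (by positivity)

lemma inv_speed_eq (h : ℝ) : 1 / Real.sqrt (1 - (Cs * Real.sqrt C) ^ 2 * alphaF C Cs h ^ 2) =
    Real.sqrt 3 * F C Cs h / Real.sqrt (3 * F C Cs h ^ 2 - Cs ^ 2 * T C (F C Cs h)) := by
  have hF := F_mem hC hS h
  have hp := pos_of_mem hC hF
  rw [speed_eq hC hS, Real.sqrt_div' _ (by positivity), Real.sqrt_mul (by norm_num),
    Real.sqrt_sq hp.le, one_div_div]

lemma rhoX_sq_lt (h : ℝ) : rhoX C (F C Cs h) ^ 2 < 1 := by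
  have hF := F_mem hC hS h
  have hp := pos_of_mem hC hF
  have h1 := one_sub_rhoX hC hp
  have h2 := betaX_pos hC hp
  have h3 := T_nonneg hC hF
  have hc := C_pos hC
  have : 0 ≤ T C (F C Cs h) / (3 * C * F C Cs h ^ 2) := by positivity
  nlinarith

lemma hasDerivAt_rhoF {k : ℤ} {h : ℝ} (hh : h ∈ Ioo (node C Cs k) (node C Cs (k + 1))) :
    HasDerivAt (fun h => rhoX C (F C Cs h))
      (1 / Real.sqrt (1 - (Cs * Real.sqrt C) ^ 2 * alphaF C Cs h ^ 2) * alphaF C Cs h) h := by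
  have hF := F_mem hC hS h
  have hp := pos_of_mem hC hF
  have hc := Real.sqrt_pos.2 (C_pos hC)
  have h1 := ((hasDerivAt_F hC hS hh).const_mul (Real.sqrt C)).inv (by positivity)
  unfold rhoX
  simp only [one_div (Real.sqrt C * _)]
  refine h1.congr_deriv ?_
  rw [inv_speed_eq hC hS, alphaF_eq hC hS (Ioo_subset_Icc_self hh), alphaX_eq hC hF]
  have hq := Real.sqrt_pos.2 (sub_pos.2 (hS _ hF))
  field_simp

lemma hasDerivAt_betaF {k : ℤ} {h : ℝ} (hh : h ∈ Ioo (node C Cs k) (node C Cs (k + 1))) :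
    HasDerivAt (fun h => betaX C (F C Cs h))
      (-(1 / Real.sqrt (1 - (Cs * Real.sqrt C) ^ 2 * alphaF C Cs h ^ 2) *
        (betaX C (F C Cs h) / (3 * rhoX C (F C Cs h))) * alphaF C Cs h)) h := by
  have hF := F_mem hC hS h
  have hp := pos_of_mem hC hF
  have hc := Real.sqrt_pos.2 (C_pos hC)
  have h1 := ((hasDerivAt_F hC hS hh).rpow_const (p := 1 / 3) (Or.inl hp.ne')).div_const
    (Real.sqrt 3 * Real.sqrt C)
  unfold betaX
  refine h1.congr_deriv ?_
  rw [inv_speed_eq hC hS, alphaF_eq hC hS (Ioo_subset_Icc_self hh), alphaX_eq hC hF]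
  have hq := Real.sqrt_pos.2 (sub_pos.2 (hS _ hF))
  unfold rhoX
  rw [Real.rpow_sub_one hp.ne']
  field_simp

lemma hasDerivAt_alphaF {k : ℤ} {h : ℝ} (hh : h ∈ Ioo (node C Cs k) (node C Cs (k + 1))) :
    HasDerivAt (alphaF C Cs)
      (1 / Real.sqrt (1 - (Cs * Real.sqrt C) ^ 2 * alphaF C Cs h ^ 2) *
        (-rhoX C (F C Cs h) + betaX C (F C Cs h) / (3 * rhoX C (F C Cs h)) *
          betaX C (F C Cs h))) h := by
  have hF := F_mem_Ioo hC hS hh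
  have hF' := Ioo_subset_Icc_self hF
  have hp := pos_of_mem hC hF'
  have hT := T_pos hC hF
  have hc := C_pos hC
  have hpos : 0 < 1 - rhoX C (F C Cs h) ^ 2 - betaX C (F C Cs h) ^ 2 := by
    rw [one_sub_rhoX hC hp]; positivity
  have h1 := (((((hasDerivAt_rhoF hC hS hh).pow 2).const_sub 1).sub
    ((hasDerivAt_betaF hC hS hh).pow 2)).sqrt hpos.ne').const_mul (-(-1 : ℝ) ^ k)
  have heq : alphaF C Cs =ᶠ[𝓝 h] fun h => -(-1 : ℝ) ^ k *
      Real.sqrt (1 - rhoX C (F C Cs h) ^ 2 - betaX C (F C Cs h) ^ 2) := by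
    filter_upwards [isOpen_Ioo.mem_nhds hh] with y hy
    exact alphaF_eq hC hS (Ioo_subset_Icc_self hy)
  refine (h1.congr_of_eventuallyEq heq).congr_deriv ?_
  have hroot : Real.sqrt (1 - rhoX C (F C Cs h) ^ 2 - betaX C (F C Cs h) ^ 2) =
    alphaX C (F C Cs h) := rfl
  have hα : 0 < alphaX C (F C Cs h) := Real.sqrt_pos.2 hpos
  have hρ := rhoX_pos hC hp
  rw [inv_speed_eq hC hS]
  have hq := Real.sqrt_pos.2 (sub_pos.2 (hS _ hF'))
  simp only [Pi.pow_apply, Pi.sub_apply]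
  rw [hroot, alphaF_eq hC hS (Ioo_subset_Icc_self hh)]
  have h2 := neg_one_zpow_sq k
  have h3 : ((-1 : ℝ) ^ k) ^ 2 = 1 := by rw [sq, h2]
  field_simp
  rw [h3]
  push_cast
  ring

lemma hasDerivAt_zetaF {k : ℤ} {h : ℝ} (hh : h ∈ Ioo (node C Cs k) (node C Cs (k + 1))) :
    HasDerivAt (fun h => zeta0 C (F C Cs h)) ((-1 : ℝ) ^ k *
      (1 / Real.sqrt (1 - (Cs * Real.sqrt C) ^ 2 * alphaF C Cs h ^ 2) *
        (betaX C (F C Cs h) / (1 - rhoX C (F C Cs h) ^ 2)))) h := by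
  have hF := F_mem_Ioo hC hS hh
  have hF' := Ioo_subset_Icc_self hF
  have hp := pos_of_mem hC hF'
  have hc := C_pos hC
  have hc' := Real.sqrt_pos.2 hc
  have h1 := (hasDerivAt_zeta0 hC hF).comp h (hasDerivAt_F hC hS hh)
  refine h1.congr_deriv ?_
  rw [inv_speed_eq hC hS]
  have hq := Real.sqrt_pos.2 (sub_pos.2 (hS _ hF'))
  have hT := Real.sqrt_pos.2 (T_pos hC hF)
  have h4 : F C Cs h ^ (4 / 3 : ℝ) = F C Cs h ^ (1 / 3 : ℝ) * F C Cs h := by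
    nth_rewrite 3 [← Real.rpow_one (F C Cs h)]
    rw [← Real.rpow_add hp]; norm_num
  have h5 : 0 < -1 + C * F C Cs h ^ 2 := by linarith [one_lt_mul_sq hC hF']
  have h6 : 1 - rhoX C (F C Cs h) ^ 2 = (-1 + C * F C Cs h ^ 2) / (C * F C Cs h ^ 2) := by
    unfold rhoX
    rw [div_pow, mul_pow, Real.sq_sqrt hc.le]
    field_simp
    ring
  rw [h6, h4]
  unfold betaX
  have h7 : Real.sqrt C ^ 2 = C := Real.sq_sqrt hc.le
  field_simp
  rw [h7]

end

/-- The profile flow of `Φ_{C, C*}`. -/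
noncomputable def profile {C Cs : ℝ} (hC : critC < C) (hS : RegularStar C Cs) {c : ℤ → ℝ}
    (hc : PhaseRec C c) : ProfileFlow where
  C := C
  μ := Cs * Real.sqrt C
  ρ := fun h => rhoX C (F C Cs h)
  α := alphaF C Cs
  β := fun h => betaX C (F C Cs h)
  a := cosF C Cs c
  b := sinF C Cs c
  C_pos := C_pos hC
  ρ_pos h := rhoX_pos hC (pos_of_mem hC (F_mem hC hS h))
  β_pos h := betaX_pos hC (pos_of_mem hC (F_mem hC hS h))
  sphere h := by
    have hF := F_mem hC hS h
    have h1 := one_sub_rhoX hC (pos_of_mem hC hF)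
    rw [← alphaX_sq hC hF] at h1
    have h2 : alphaF C Cs h ^ 2 = alphaX C (F C Cs h) ^ 2 := by
      unfold alphaF
      rw [mul_pow, neg_sq, sq, neg_one_zpow_sq, one_mul]
    rw [h2]; linarith
  circle h := by
    unfold cosF sinF
    rw [mul_pow, sq ((-1 : ℝ) ^ _), neg_one_zpow_sq, one_mul, Real.cos_sq_add_sin_sq]
  speed := speed_pos hC hS
  const h := by
    have hp := pos_of_mem hC (F_mem hC hS h)
    have hc := C_pos hC
    have h3 : Real.sqrt 3 ^ 2 = 3 := Real.sq_sqrt (by norm_num)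
    have hs : Real.sqrt C ^ 2 = C := Real.sq_sqrt hc.le
    have h4 := Real.sqrt_pos.2 hc
    obtain ⟨x, hx, hxF⟩ := exists_cube hp
    unfold rhoX betaX
    rw [hxF, rpow_two_thirds_pow x hx.le 3 1 (1 / 3) (by norm_num)]
    rw [show C ^ 2 = Real.sqrt C ^ 4 by rw [← hs]; ring_nf; rw [hs]]
    field_simp
    linear_combination -h3
  dρ := by
    have hcont := continuous_rhoF hC hS
    have hα := continuous_alphaF hC hS
    refine hasDerivAt_of_strips (node_cover hC hS) hcont
      ((continuous_const.div (by fun_prop) fun h =>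
        (Real.sqrt_pos.2 (speed_pos hC hS h)).ne').mul hα)
      fun k x hx => hasDerivAt_rhoF hC hS hx
  dα := by
    have h1 := continuous_rhoF hC hS
    have h2 := continuous_betaF hC hS
    have hα := continuous_alphaF hC hS
    refine hasDerivAt_of_strips (node_cover hC hS) hα
      ((continuous_const.div (by fun_prop) fun h =>
        (Real.sqrt_pos.2 (speed_pos hC hS h)).ne').mul
        (h1.neg.add ((h2.div (continuous_const.mul h1) fun h => ?_).mul h2)))
      fun k x hx => hasDerivAt_alphaF hC hS hx
    exact (mul_pos three_pos (rhoX_pos hC (pos_of_mem hC (F_mem hC hS h)))).ne'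
  dβ := by
    have h1 := continuous_rhoF hC hS
    have h2 := continuous_betaF hC hS
    have hα := continuous_alphaF hC hS
    refine hasDerivAt_of_strips (node_cover hC hS) h2
      (((continuous_const.div (by fun_prop) fun h =>
        (Real.sqrt_pos.2 (speed_pos hC hS h)).ne').mul
        (h2.div (continuous_const.mul h1) fun h => ?_)).mul hα).neg
      fun k x hx => hasDerivAt_betaF hC hS hx
    exact (mul_pos three_pos (rhoX_pos hC (pos_of_mem hC (F_mem hC hS h)))).ne'
  da := by
    have h1 := continuous_rhoF hC hS
    have h2 := continuous_betaF hC hS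
    have hα := continuous_alphaF hC hS
    obtain ⟨hca, hcb⟩ := continuous_cosF_sinF hC hS hc
    refine hasDerivAt_of_strips (node_cover hC hS) hca
      (((continuous_const.div (by fun_prop) fun h =>
        (Real.sqrt_pos.2 (speed_pos hC hS h)).ne').mul
        (h2.div (by fun_prop) fun h => (sub_pos.2 (rhoX_sq_lt hC hS h)).ne')).mul hcb).neg
      fun k x hx => ?_
    refine (((hasDerivAt_zetaF hC hS hx).add_const (c k)).cos.congr_of_eventuallyEq
      ?_).congr_deriv ?_
    · filter_upwards [isOpen_Ioo.mem_nhds hx] with y hy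
      exact (cosF_sinF_eq hC hS hc (Ioo_subset_Icc_self hy)).1
    · rw [(cosF_sinF_eq hC hS hc (Ioo_subset_Icc_self hx)).2]; ring
  db := by
    have h1 := continuous_rhoF hC hS
    have h2 := continuous_betaF hC hS
    have hα := continuous_alphaF hC hS
    obtain ⟨hca, hcb⟩ := continuous_cosF_sinF hC hS hc
    refine hasDerivAt_of_strips (node_cover hC hS) hcb
      (((continuous_const.div (by fun_prop) fun h =>
        (Real.sqrt_pos.2 (speed_pos hC hS h)).ne').mul
        (h2.div (by fun_prop) fun h => (sub_pos.2 (rhoX_sq_lt hC hS h)).ne')).mul hca)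
      fun k x hx => ?_
    refine ((((hasDerivAt_zetaF hC hS hx).add_const (c k)).sin.const_mul
      ((-1 : ℝ) ^ k)).congr_of_eventuallyEq ?_).congr_deriv ?_
    · filter_upwards [isOpen_Ioo.mem_nhds hx] with y hy
      exact (cosF_sinF_eq hC hS hc (Ioo_subset_Icc_self hy)).2
    · rw [(cosF_sinF_eq hC hS hc (Ioo_subset_Icc_self hx)).1]
      have := neg_one_zpow_sq k
      linear_combination (Real.cos (zeta0 C (F C Cs x) + c k)) *
        (1 / Real.sqrt (1 - (Cs * Real.sqrt C) ^ 2 * alphaF C Cs x ^ 2) *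
        (betaX C (F C Cs x) / (1 - rhoX C (F C Cs x) ^ 2))) * this

lemma profile_Y {C Cs : ℝ} (hC : critC < C) (hS : RegularStar C Cs) {c : ℤ → ℝ}
    (hc : PhaseRec C c) : (profile hC hS hc).Y = Phi C Cs c := by
  have h0 := C_pos hC
  have key : ∀ x : ℝ, rhoX C x ^ 2 = 1 / (C * x ^ 2) := fun x => by
    unfold rhoX
    rw [div_pow, mul_pow, Real.sq_sqrt h0.le, one_pow]
  ext p i
  fin_cases i <;>
    simp [ProfileFlow.Y, Phi, pieceMap, profile, ProfileFlow.r, ProfileFlow.u, ProfileFlow.w,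
      cosF, sinF, key]
  · ring
  · unfold rhoX; field_simp
  · unfold rhoX; field_simp

lemma Phi_eq_pieceMap {C Cs : ℝ} (hC : critC < C) (hS : RegularStar C Cs) {c : ℤ → ℝ}
    (hc : PhaseRec C c) {k : ℤ} {h : ℝ} (hh : h ∈ Icc (node C Cs k) (node C Cs (k + 1))) (θ : ℝ) :
    Phi C Cs c (h, θ) = pieceMap C k (c k) (F C Cs h, θ) := by
  obtain ⟨h1, h2⟩ := cosF_sinF_eq hC hS hc hh
  unfold cosF at h1
  unfold sinF at h2
  unfold Phi pieceMap
  ext i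
  fin_cases i
  · simp [h1]
  · simp only [Fin.mk_one, Matrix.cons_val_one, Matrix.cons_val_zero]
    rw [mul_left_comm, h2]; ring
  · simp
  · simp

lemma isPieceChain_Phi {C Cs : ℝ} (hC : critC < C) (hS : RegularStar C Cs) {c : ℤ → ℝ}
    (hc : PhaseRec C c) : IsPieceChain (Phi C Cs c) (node C Cs) (fun _ => C) c
        (fun _ => LinearIsometryEquiv.refl ℝ E4) := by
  refine ⟨node_strictMono hC hS, node_cover hC hS, fun k => ⟨hC, fun p => (F C Cs p.1, p.2), ?_, ⟨?_, ?_, ?_⟩, ?_⟩⟩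
  · have := continuous_F hC hS
    fun_prop
  · rintro p ⟨hp, -⟩
    exact ⟨F_mem_Ioo hC hS hp, mem_univ _⟩
  · rintro p ⟨hp, -⟩ q ⟨hq, -⟩ hpq
    have h1 := hk_F hC hS (Ioo_subset_Icc_self hp)
    have h2 := hk_F hC hS (Ioo_subset_Icc_self hq)
    simp only [Prod.mk.injEq] at hpq
    ext
    · rw [← h1, ← h2, hpq.1]
    · exact hpq.2
  · rintro p ⟨hp, -⟩
    exact ⟨(hk C Cs k p.1, p.2), ⟨hk_mem_Ioo hC hS k hp, mem_univ _⟩, by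
      simp [F_hk hC hS k (Ioo_subset_Icc_self hp)]⟩
  · rintro ⟨h, θ⟩ ⟨hp, -⟩
    simp [Phi_eq_pieceMap hC hS hc (Ioo_subset_Icc_self hp)]


/-! ### Pieces, their closures and phases -/

lemma modEq_of_eq {x y : ℝ} (h : x = y) : x ≡ y [PMOD (2 * Real.pi)] :=
  h ▸ AddCommGroup.modEq_refl x

/-- Every phase constant of a single piece extends to a solution of the recursion. -/
lemma exists_phaseRec (C : ℝ) (k₀ : ℤ) (x : ℝ) : ∃ c : ℤ → ℝ, PhaseRec C c ∧ c k₀ = x := by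
  have key : ∀ y : ℝ, PhaseRec C fun k => if Even k then y + k * (zetaP C - zetaM C)
      else -(y + k * (zetaP C - zetaM C) + (zetaP C + zetaM C)) := by
    intro y k
    refine ⟨fun hk => ?_, fun hk => ?_⟩
    · have h1 : ¬ Even k := Int.not_even_iff_odd.2 hk
      have h2 : Even (k - 1) := hk.sub_odd odd_one
      simp only [h1, h2, if_true, if_false]
      refine modEq_of_eq ?_
      push_cast; ring
    · have h2 : ¬ Even (k - 1) := Int.not_even_iff_odd.2 (hk.sub_odd odd_one)
      simp only [hk, h2, if_true, if_false]
      refine modEq_of_eq ?_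
      push_cast; ring
  rcases Int.even_or_odd k₀ with hk | hk
  · exact ⟨_, key (x - k₀ * (zetaP C - zetaM C)), by simp [hk]⟩
  · exact ⟨_, key (-x - k₀ * (zetaP C - zetaM C) - (zetaP C + zetaM C)), by
      simp only [Int.not_even_iff_odd.2 hk, if_false]; ring⟩

lemma pieceMap_add_period {C : ℝ} (hC : critC < C) (k : ℤ) (c ξ θ : ℝ) (n : ℤ) :
    pieceMap C k c (ξ, θ + n * (2 * Real.pi / Real.sqrt C)) = pieceMap C k c (ξ, θ) := by
  have hs := (Real.sqrt_pos.2 (C_pos hC)).ne'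
  have : Real.sqrt C * (θ + n * (2 * Real.pi / Real.sqrt C)) =
      Real.sqrt C * θ + n * (2 * Real.pi) := by field_simp
  unfold pieceMap
  simp only [this, Real.cos_add_int_mul_two_pi, Real.sin_add_int_mul_two_pi]

lemma norm_sq_tail {C : ℝ} (k : ℤ) (c : ℝ) (p : ℝ × ℝ) :
    pieceMap C k c p 2 ^ 2 + pieceMap C k c p 3 ^ 2 = rhoX C p.1 ^ 2 := by
  unfold pieceMap rhoX
  simp only [Matrix.cons_val, div_pow, one_pow]
  rw [← add_div, Real.cos_sq_add_sin_sq]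

lemma rhoX_injOn {C : ℝ} (hC : critC < C) {x y : ℝ} (hx : 0 < x) (hy : 0 < y)
    (h : rhoX C x ^ 2 = rhoX C y ^ 2) : x = y := by
  have hs := Real.sqrt_pos.2 (C_pos hC)
  have h1 := (sq_eq_sq₀ (rhoX_pos hC hx).le (rhoX_pos hC hy).le).1 h
  unfold rhoX at h1
  rw [one_div, one_div, inv_inj] at h1
  exact mul_left_cancel₀ hs.ne' h1

/-- Two points of pieces with the same constant agree only if they have the same `ξ` and their
angles of rotation agree up to the period. -/
lemma pieceMap_eq {C : ℝ} (hC : critC < C) {k l : ℤ} {c c' : ℝ} {p q : ℝ × ℝ}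
    (hp : 0 < p.1) (hq : 0 < q.1) (h : pieceMap C k c p = pieceMap C l c' q) :
    p.1 = q.1 ∧ ∃ n : ℤ, p.2 = q.2 + n * (2 * Real.pi / Real.sqrt C) := by
  have hs := Real.sqrt_pos.2 (C_pos hC)
  have h1 : p.1 = q.1 := rhoX_injOn hC hp hq (by rw [← norm_sq_tail k c p, ← norm_sq_tail l c' q, h])
  refine ⟨h1, ?_⟩
  have h2 := congrFun (congrArg WithLp.ofLp h) 2
  have h3 := congrFun (congrArg WithLp.ofLp h) 3
  simp only [pieceMap, Matrix.cons_val, h1] at h2 h3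
  have hd : Real.sqrt C * q.1 ≠ 0 := by positivity
  rw [div_left_inj' hd] at h2 h3
  obtain ⟨n, hn⟩ := Real.Angle.angle_eq_iff_two_pi_dvd_sub.1 (Real.Angle.cos_sin_inj h2 h3)
  refine ⟨n, ?_⟩
  field_simp
  linarith

section
variable {C Cs : ℝ} (hC : critC < C) (hS : RegularStar C Cs) {c : ℤ → ℝ} (hc : PhaseRec C c)
include hC

lemma continuousOn_pieceMap (k : ℤ) (x : ℝ) :
    ContinuousOn (pieceMap C k x) (Icc (xi01 C) (xi02 C) ×ˢ univ) := by
  have hS := regularStar_zero hC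
  obtain ⟨c, hc, rfl⟩ := exists_phaseRec C k x
  have h1 : ContinuousOn (fun p : ℝ × ℝ => Phi C 0 c (hk C 0 k p.1, p.2))
      (Icc (xi01 C) (xi02 C) ×ˢ univ) := by
    rw [← profile_Y hC hS hc]
    refine (profile hC hS hc).contDiff_Y.continuous.comp_continuousOn
      (ContinuousOn.prodMk ((continuousOn_hk hC hS k).comp continuousOn_fst fun p hp => hp.1)
        continuousOn_snd)
  refine h1.congr fun p hp => ?_
  dsimp only
  rw [Phi_eq_pieceMap hC hS hc (hk_mem_Icc hC hS k hp.1), F_hk hC hS k hp.1]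

/-- The closure of a piece is parametrized by the closed strip. -/
lemma closure_piece (k : ℤ) (x : ℝ) :
    closure (piece C k x) = pieceMap C k x '' (Icc (xi01 C) (xi02 C) ×ˢ univ) := by
  have hs := Real.sqrt_pos.2 (C_pos hC)
  have hT : 0 < 2 * Real.pi / Real.sqrt C := by positivity
  have hcont := continuousOn_pieceMap hC k x
  apply Subset.antisymm
  · refine closure_minimal (image_mono (prod_mono Ioo_subset_Icc_self le_rfl)) ?_
    have hcomp : pieceMap C k x '' (Icc (xi01 C) (xi02 C) ×ˢ univ) =
        pieceMap C k x '' (Icc (xi01 C) (xi02 C) ×ˢ Icc 0 (2 * Real.pi / Real.sqrt C)) := by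
      apply Subset.antisymm
      · rintro _ ⟨⟨ξ, θ⟩, ⟨h1, -⟩, rfl⟩
        obtain ⟨n, hn, -⟩ := existsUnique_sub_zsmul_mem_Ico hT θ 0
        simp only [zsmul_eq_mul, zero_add] at hn
        refine ⟨(ξ, θ - n * (2 * Real.pi / Real.sqrt C)), ⟨h1, hn.1, hn.2.le⟩, ?_⟩
        have := pieceMap_add_period hC k x ξ θ (-n)
        push_cast at this
        rw [← this]; ring_nf
      · exact image_mono (prod_mono le_rfl (subset_univ _))
    rw [hcomp]
    exact ((isCompact_Icc.prod isCompact_Icc).image_of_continuousOn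
      (hcont.mono (prod_mono le_rfl (subset_univ _)))).isClosed
  · have hcl : closure (D C) = Icc (xi01 C) (xi02 C) ×ˢ univ := by
      unfold D
      rw [closure_prod_eq, closure_Ioo (xi01_lt_xi02 hC).ne, closure_univ]
    rw [← hcl] at hcont ⊢
    exact hcont.image_closure

lemma mem_piece_iff (k : ℤ) (x : ℝ) {ξ θ : ℝ} (hξ : ξ ∈ Icc (xi01 C) (xi02 C)) :
    pieceMap C k x (ξ, θ) ∈ piece C k x ↔ ξ ∈ Ioo (xi01 C) (xi02 C) := by
  constructor
  · rintro ⟨q, hq, hqe⟩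
    have : q.1 = ξ :=
      (pieceMap_eq hC (pos_of_mem hC (Ioo_subset_Icc_self hq.1)) (pos_of_mem hC hξ) hqe).1
    rw [← this]; exact hq.1
  · exact fun h => ⟨_, ⟨h, mem_univ _⟩, rfl⟩

/-- The boundary of a piece consists of its two boundary circles. -/
lemma boundary_piece (k : ℤ) (x : ℝ) : closure (piece C k x) \ piece C k x =
    bdryCircle C k x (xi01 C) ∪ bdryCircle C k x (xi02 C) := by
  have hle := (xi01_lt_xi02 hC).le
  rw [closure_piece hC]
  ext y
  constructor
  · rintro ⟨⟨⟨ξ, θ⟩, ⟨h1, -⟩, rfl⟩, h2⟩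
    rw [mem_piece_iff hC k x h1] at h2
    rcases eq_or_lt_of_le h1.1 with h3 | h3
    · left; exact ⟨θ, by rw [h3]⟩
    rcases eq_or_lt_of_le h1.2 with h4 | h4
    · right; exact ⟨θ, by rw [← h4]⟩
    exact absurd ⟨h3, h4⟩ h2
  · rintro (⟨θ, rfl⟩ | ⟨θ, rfl⟩)
    · have hm := left_mem_Icc.2 hle
      exact ⟨⟨_, ⟨hm, mem_univ _⟩, rfl⟩, fun h => lt_irrefl _ ((mem_piece_iff hC k x hm).1 h).1⟩
    · have hm := right_mem_Icc.2 hle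
      exact ⟨⟨_, ⟨hm, mem_univ _⟩, rfl⟩, fun h => lt_irrefl _ ((mem_piece_iff hC k x hm).1 h).2⟩

include hS hc

lemma closure_piece_eq_Phi (k : ℤ) : closure (piece C k (c k)) =
    Phi C Cs c '' (Icc (node C Cs k) (node C Cs (k + 1)) ×ˢ univ) := by
  rw [closure_piece hC]
  apply Subset.antisymm
  · rintro _ ⟨⟨ξ, θ⟩, ⟨h1, -⟩, rfl⟩
    refine ⟨(hk C Cs k ξ, θ), ⟨hk_mem_Icc hC hS k h1, mem_univ _⟩, ?_⟩
    rw [Phi_eq_pieceMap hC hS hc (hk_mem_Icc hC hS k h1), F_hk hC hS k h1]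
  · rintro _ ⟨⟨h, θ⟩, ⟨h1, -⟩, rfl⟩
    exact ⟨(F C Cs h, θ), ⟨F_mem hC hS h, mem_univ _⟩, (Phi_eq_pieceMap hC hS hc h1 θ).symm⟩

lemma Phi_eq_iff {k : ℤ} {p q : ℝ × ℝ} (hp : p.1 ∈ Icc (node C Cs k) (node C Cs (k + 1)))
    (hq : q.1 ∈ Icc (node C Cs k) (node C Cs (k + 1))) (h : Phi C Cs c p = Phi C Cs c q) :
    p.1 = q.1 ∧ ∃ n : ℤ, p.2 = q.2 + n * (2 * Real.pi / Real.sqrt C) := by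
  rw [show p = (p.1, p.2) from rfl, show q = (q.1, q.2) from rfl, Phi_eq_pieceMap hC hS hc hp,
    Phi_eq_pieceMap hC hS hc hq] at h
  obtain ⟨h1, h2⟩ := pieceMap_eq hC (pos_of_mem hC (F_mem hC hS _))
    (pos_of_mem hC (F_mem hC hS _)) h
  refine ⟨?_, h2⟩
  have h1 : F C Cs p.1 = F C Cs q.1 := h1
  rw [← hk_F hC hS hp, h1, hk_F hC hS hq]

omit hS hc in
lemma Phi_add_period (h θ : ℝ) (n : ℤ) :
    Phi C Cs c (h, θ + n * (2 * Real.pi / Real.sqrt C)) = Phi C Cs c (h, θ) := by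
  unfold Phi
  exact pieceMap_add_period hC _ _ _ _ _

/-- The closed pieces are embedded: points of the closure near `Φ q₀` have parameters near `q₀`. -/
lemma eventually_exists_param {k : ℤ} {q₀ : ℝ × ℝ}
    (hq₀ : q₀.1 ∈ Icc (node C Cs k) (node C Cs (k + 1))) {V : Set (ℝ × ℝ)} (hV : V ∈ 𝓝 q₀) :
    ∀ᶠ x in 𝓝 (Phi C Cs c q₀), x ∈ closure (piece C k (c k)) →
      ∃ q ∈ V, q.1 ∈ Icc (node C Cs k) (node C Cs (k + 1)) ∧ Phi C Cs c q = x := by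
  have hs := Real.sqrt_pos.2 (C_pos hC)
  set T := 2 * Real.pi / Real.sqrt C with hTdef
  have hT : 0 < T := by positivity
  set K := (Icc (node C Cs k) (node C Cs (k + 1)) ×ˢ Icc (q₀.2 - T / 2) (q₀.2 + T / 2)) \
    interior V with hK
  have hKc : IsCompact K := (isCompact_Icc.prod isCompact_Icc).diff isOpen_interior
  have hcont : Continuous (Phi C Cs c) := by
    rw [← profile_Y hC hS hc]; exact (profile hC hS hc).contDiff_Y.continuous
  have hnot : Phi C Cs c q₀ ∉ Phi C Cs c '' K := by
    rintro ⟨q, ⟨⟨hq1, hq2⟩, hq3⟩, hqe⟩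
    obtain ⟨h1, n, h2⟩ := Phi_eq_iff hC hS hc hq1 hq₀ hqe
    have hn : n = 0 := by
      rw [h2] at hq2
      have ha : (n : ℝ) < 1 := by
        by_contra hh; push Not at hh
        have : T ≤ n * T := by nlinarith
        linarith [hq2.2]
      have hb : (-1 : ℝ) < n := by
        by_contra hh; push Not at hh
        have : n * T ≤ -T := by nlinarith
        linarith [hq2.1]
      have ha' : n < 1 := by exact_mod_cast ha
      have hb' : -1 < n := by exact_mod_cast hb
      lia
    have : q = q₀ := by
      ext
      · exact h1
      · rw [h2, hn]; simp
    exact hq3 (this ▸ mem_interior_iff_mem_nhds.2 hV)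
  filter_upwards [(hKc.image hcont).isClosed.isOpen_compl.mem_nhds hnot] with x hx hxc
  rw [closure_piece_eq_Phi hC hS hc] at hxc
  obtain ⟨⟨h, θ⟩, ⟨hh, -⟩, rfl⟩ := hxc
  obtain ⟨n, hn, -⟩ := existsUnique_sub_zsmul_mem_Ico hT θ (q₀.2 - T / 2)
  simp only [zsmul_eq_mul] at hn
  have hper : Phi C Cs c (h, θ - n * T) = Phi C Cs c (h, θ) := by
    have := Phi_add_period (Cs := Cs) (c := c) hC h θ (-n)
    push_cast at this
    rw [← this, ← hTdef]; ring_nf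
  refine ⟨(h, θ - n * T), ?_, hh, hper⟩
  by_contra hV'
  refine hx ⟨(h, θ - n * T), ⟨⟨hh, hn.1, by linarith [hn.2]⟩, fun hi => hV' (interior_subset hi)⟩, hper⟩

end

/-! ### Gluing along a boundary circle -/

/-- Across a node the surface `Φ_{C, 0}` itself glues the two adjacent pieces; for the other
direction its parameter is reversed. -/
lemma gluedAlong_of_phase {C : ℝ} (hC : critC < C) {k l : ℤ} {c c' e : ℝ}
    (he : e = xi01 C ∨ e = xi02 C) (hkl : Odd (k + l))
    (hcc : c' ≡ -2 * zeta0 C e - c [PMOD (2 * Real.pi)]) (a b : ℝ) :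
    GluedAlong (piece C k c) (piece C l c') (fun θ => pieceMap C k c (e, θ)) a b := by
  have hS := regularStar_zero hC
  obtain ⟨f, hf, rfl⟩ := exists_phaseRec C k c
  have hL : 0 < h0P C 0 - h0M C 0 := sub_pos.2 (h0M_lt_h0P hC hS)
  set P := profile hC hS hf with hP
  have hY : P.Y = Phi C 0 f := profile_Y hC hS hf
  have hpar : ∀ m : ℤ, Odd (k + m) → f m ≡ c' [PMOD (2 * Real.pi)] →
      piece C m (f m) = piece C l c' := by
    intro m hm hfm
    have h1 : (-1 : ℝ) ^ m = (-1) ^ l := by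
      have : Even (m - l) := by
        have := hm.sub_odd hkl
        rwa [add_sub_add_left_eq_sub] at this
      rw [show m = (m - l) + l by ring, zpow_add₀ (by norm_num), this.neg_one_zpow, one_mul]
    unfold piece
    refine image_congr' fun p => ?_
    unfold pieceMap
    rw [h1, cos_eq_of_modEq (hfm.add_left _), sin_eq_of_modEq (hfm.add_left _)]
  have hee : e = eNode C (k + 1) ∨ e = eNode C k := by
    rcases Int.even_or_odd k with h | h
    · rw [eNode_even h, eNode_odd h.add_one]; exact he.symm
    · rw [eNode_odd h, eNode_even h.add_one]; exact he
  rcases hee with rfl | rfl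
  · have hm : piece C (k + 1) (f (k + 1)) = piece C l c' := by
      refine hpar _ ⟨k, by ring⟩ ?_
      have h1 := phaseRec_iff.1 hf (k + 1)
      rw [add_sub_cancel_right] at h1
      exact h1.trans hcc.symm
    rw [← hm]
    refine ⟨Ioo (-(h0P C 0 - h0M C 0)) (h0P C 0 - h0M C 0) ×ˢ univ,
      fun p => P.Y (node C 0 (k + 1) + p.1, p.2), isOpen_Ioo.prod isOpen_univ, ?_, ?_, ?_, ?_, ?_, ?_⟩
    · rintro ⟨t, s⟩ ⟨ht, -⟩
      obtain rfl : t = 0 := ht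
      exact ⟨⟨by linarith, hL⟩, mem_univ _⟩
    · exact (P.contDiff_Y.comp (by fun_prop)).contDiffOn
    · intro p _
      have h1 := (P.hasFDerivAt_Y (node C 0 (k + 1) + p.1, p.2)).differentiableAt.hasFDerivAt
      have h2 : HasFDerivAt (fun p : ℝ × ℝ => (node C 0 (k + 1) + p.1, p.2))
          (ContinuousLinearMap.id ℝ (ℝ × ℝ)) p := by
        refine ((hasFDerivAt_fst.const_add _).prodMk hasFDerivAt_snd).congr_fderiv ?_
        ext <;> simp
      erw [(h1.comp p h2).fderiv]
      exact P.injective_fderiv_Y _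
    · intro s _
      simp only [add_zero]
      rw [hY, Phi_eq_pieceMap hC hS hf (k := k)
        ⟨(node_strictMono hC hS (by lia)).le, le_rfl⟩, F_node hC hS]
    · rintro p ⟨hp, -⟩ hp'
      rw [closure_piece_eq_Phi hC hS hf, ← hY]
      refine mem_image_of_mem _ ⟨⟨?_, by simpa using hp'⟩, mem_univ _⟩
      dsimp only
      rw [node_succ]; linarith [hp.1]
    · rintro p ⟨hp, -⟩ hp'
      rw [closure_piece_eq_Phi hC hS hf, ← hY]
      refine mem_image_of_mem _ ⟨⟨by simpa using hp', ?_⟩, mem_univ _⟩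
      dsimp only
      rw [node_succ (k + 1)]; linarith [hp.2]
  · have hm : piece C (k - 1) (f (k - 1)) = piece C l c' := by
      refine hpar _ ⟨k - 1, by ring⟩ ?_
      have h1 := phaseRec_iff.1 hf k
      have h2 := (h1.add_right (f (k - 1))).sub_right (f k)
      rw [show -2 * zeta0 C (eNode C k) - f (k - 1) + f (k - 1) - f k
        = -2 * zeta0 C (eNode C k) - f k by ring, add_sub_cancel_left] at h2
      exact h2.trans hcc.symm
    rw [← hm]
    have hn : node C 0 k = node C 0 (k - 1) + (h0P C 0 - h0M C 0) := by
      rw [← node_succ, sub_add_cancel]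
    refine ⟨Ioo (-(h0P C 0 - h0M C 0)) (h0P C 0 - h0M C 0) ×ˢ univ,
      fun p => P.Y (node C 0 k - p.1, p.2), isOpen_Ioo.prod isOpen_univ, ?_, ?_, ?_, ?_, ?_, ?_⟩
    · rintro ⟨t, s⟩ ⟨ht, -⟩
      obtain rfl : t = 0 := ht
      exact ⟨⟨by linarith, hL⟩, mem_univ _⟩
    · exact (P.contDiff_Y.comp (by fun_prop)).contDiffOn
    · intro p _
      have h1 := (P.hasFDerivAt_Y (node C 0 k - p.1, p.2)).differentiableAt.hasFDerivAt
      have h2 : HasFDerivAt (fun p : ℝ × ℝ => (node C 0 k - p.1, p.2))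
          ((-ContinuousLinearMap.fst ℝ ℝ ℝ).prod (ContinuousLinearMap.snd ℝ ℝ ℝ)) p := by
        exact (hasFDerivAt_fst.const_sub _).prodMk hasFDerivAt_snd
      erw [(h1.comp p h2).fderiv]
      refine (P.injective_fderiv_Y _).comp fun x y hxy => ?_
      simpa [Prod.ext_iff] using hxy
    · intro s _
      simp only [sub_zero]
      rw [hY, Phi_eq_pieceMap hC hS hf (k := k)
        ⟨le_rfl, (node_strictMono hC hS (by lia)).le⟩, F_node hC hS]
    · rintro p ⟨hp, -⟩ hp'
      rw [closure_piece_eq_Phi hC hS hf, ← hY]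
      refine mem_image_of_mem _ ⟨⟨by simpa using hp', ?_⟩, mem_univ _⟩
      dsimp only
      rw [node_succ]; linarith [hp.1]
    · rintro p ⟨hp, -⟩ hp'
      rw [closure_piece_eq_Phi hC hS hf, ← hY, sub_add_cancel]
      refine mem_image_of_mem _ ⟨⟨?_, by simpa using hp'⟩, mem_univ _⟩
      dsimp only
      rw [hn]; linarith [hp.2]


/-! ### Local lifts of an immersion to the parameter plane -/

/-- An immersion has a `C³` local left inverse: compose it with a linear left inverse of its
differential and invert the resulting local diffeomorphism. -/
lemma exists_local_left_inverse {Y : ℝ × ℝ → E4} {q₀ : ℝ × ℝ} (hY : ContDiffAt ℝ 3 Y q₀)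
    (hinj : Function.Injective (fderiv ℝ Y q₀)) :
    ∃ π : E4 → ℝ × ℝ, ContDiffAt ℝ 3 π (Y q₀) ∧ ∀ᶠ q in 𝓝 q₀, π (Y q) = q := by
  obtain ⟨M₀, hM₀⟩ := LinearMap.exists_leftInverse_of_injective
    (fderiv ℝ Y q₀ : ℝ × ℝ →ₗ[ℝ] E4) (LinearMap.ker_eq_bot.2 hinj)
  set M : E4 →L[ℝ] ℝ × ℝ := LinearMap.toContinuousLinearMap M₀ with hM
  have hM' : ∀ x, M (fderiv ℝ Y q₀ x) = x := fun x => LinearMap.congr_fun hM₀ x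
  have hG : ContDiffAt ℝ 3 (fun q => M (Y q)) q₀ := M.contDiff.contDiffAt.comp q₀ hY
  have hd : HasFDerivAt (fun q => M (Y q))
      ((ContinuousLinearEquiv.refl ℝ (ℝ × ℝ) : (ℝ × ℝ) ≃L[ℝ] ℝ × ℝ) : ℝ × ℝ →L[ℝ] ℝ × ℝ) q₀ := by
    refine (M.hasFDerivAt.comp q₀ (hY.differentiableAt (by norm_num)).hasFDerivAt).congr_fderiv ?_
    ext <;> simp [hM']
  have h3 : (3 : WithTop ℕ∞) ≠ 0 := by norm_num
  refine ⟨fun x => hG.localInverse hd h3 (M x), ?_, ?_⟩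
  · exact (hG.to_localInverse hd h3).comp (Y q₀) M.contDiff.contDiffAt
  · exact (hG.hasStrictFDerivAt' hd h3).eventually_left_inverse

/-- A `C¹` map that vanishes on an open set vanishes to first order on its closure. -/
lemma fderiv_eq_zero_of_side {V : Type*} [NormedAddCommGroup V] [NormedSpace ℝ V]
    {G : ℝ × ℝ → V} {R : Set (ℝ × ℝ)} {p : ℝ × ℝ} (hR : IsOpen R) (hp : p ∈ closure R)
    (hG : ContDiffAt ℝ 1 G p) (hz : ∀ᶠ q in 𝓝 p, q ∈ R → G q = 0) :
    G p = 0 ∧ fderiv ℝ G p = 0 := by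
  have hne : (𝓝[R] p).NeBot := mem_closure_iff_nhdsWithin_neBot.1 hp
  constructor
  · have h1 : Tendsto G (𝓝[R] p) (𝓝 (G p)) := hG.continuousAt.tendsto.mono_left nhdsWithin_le_nhds
    have h2 : G =ᶠ[𝓝[R] p] fun _ => 0 := by
      filter_upwards [nhdsWithin_le_nhds hz, self_mem_nhdsWithin] with q h h' using h h'
    exact tendsto_nhds_unique h1 (tendsto_const_nhds.congr' h2.symm)
  · have hc : ContinuousAt (fderiv ℝ G) p :=
      (hG.fderiv_right (m := 0) (by norm_num)).continuousAt
    have h1 : Tendsto (fderiv ℝ G) (𝓝[R] p) (𝓝 (fderiv ℝ G p)) :=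
      hc.tendsto.mono_left nhdsWithin_le_nhds
    have h2 : fderiv ℝ G =ᶠ[𝓝[R] p] fun _ => 0 := by
      filter_upwards [nhdsWithin_le_nhds hz.eventually_nhds, self_mem_nhdsWithin] with q h h'
      have : G =ᶠ[𝓝 q] fun _ => 0 := by
        filter_upwards [h, hR.mem_nhds h'] with x hx hx' using hx hx'
      rw [this.fderiv_eq]; simp
    exact tendsto_nhds_unique h1 (tendsto_const_nhds.congr' h2.symm)

/-- A lift `ω` of the map `X` to the parameter plane of a rotational surface, defined on the open
set `N` and correct on the side `R`. -/
structure SideLift (P : ProfileFlow) (X : ℝ × ℝ → E4) (N R : Set (ℝ × ℝ)) (ω : ℝ × ℝ → ℝ × ℝ) :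
    Prop where
  isOpen : IsOpen N
  isOpen_side : IsOpen R
  contDiffAt_map : ∀ p ∈ N, ContDiffAt ℝ 3 X p
  contDiffAt_lift : ∀ p ∈ N, ContDiffAt ℝ 3 ω p
  eq : ∀ p ∈ N, p ∈ R → P.Y (ω p) = X p

namespace SideLift
variable {P : ProfileFlow} {X : ℝ × ℝ → E4} {N R : Set (ℝ × ℝ)} {ω : ℝ × ℝ → ℝ × ℝ}

/-- The meridian component of the differential of `X`. -/
noncomputable def ca (P : ProfileFlow) (ω : ℝ × ℝ → ℝ × ℝ) (p x : ℝ × ℝ) : ℝ :=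
  (fderiv ℝ ω p x).1 * P.v (ω p).1
/-- The component of the differential of `X` along the parallel circle. -/
noncomputable def cb (P : ProfileFlow) (ω : ℝ × ℝ → ℝ × ℝ) (p x : ℝ × ℝ) : ℝ :=
  (fderiv ℝ ω p x).2 * (Real.sqrt P.C * P.ρ (ω p).1)

variable (S : SideLift P X N R ω)
include S

lemma first {p : ℝ × ℝ} (hp : p ∈ N) (hpR : p ∈ closure R) : P.Y (ω p) = X p ∧
    ∀ x, fderiv ℝ X p x = ca P ω p x • P.e (ω p) + cb P ω p x • P.τ (ω p).2 := by
  have h1 : ContDiffAt ℝ 3 (fun q => P.Y (ω q)) p :=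
    P.contDiff_Y.contDiffAt.comp p (S.contDiffAt_lift p hp)
  have hd := h1.sub (S.contDiffAt_map p hp)
  obtain ⟨h2, h3⟩ := fderiv_eq_zero_of_side S.isOpen_side hpR (hd.of_le (by norm_num)) (by
    filter_upwards [S.isOpen.mem_nhds hp] with q hq hqR
    exact sub_eq_zero.2 (S.eq q hq hqR))
  refine ⟨sub_eq_zero.1 h2, fun x => ?_⟩
  have hω := ((S.contDiffAt_lift p hp).differentiableAt (by norm_num)).hasFDerivAt
  have hX := ((S.contDiffAt_map p hp).differentiableAt (by norm_num)).hasFDerivAt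
  have h4 := ((P.hasFDerivAt_Y (ω p)).differentiableAt.hasFDerivAt.comp p hω).sub hX
  have h5 := h4.fderiv.symm.trans h3
  have h6 := DFunLike.congr_fun h5 x
  simp only [sub_apply, ContinuousLinearMap.comp_apply, P.fderiv_Y] at h6
  exact (sub_eq_zero.1 h6).symm

/-- The second fundamental form of `X`, computed from either side of the line of gluing. -/
lemma second {p : ℝ × ℝ} (hp : p ∈ N) (hpR : p ∈ closure R) (x y : ℝ × ℝ) :
    inner ℝ (P.η (ω p)) (fderiv ℝ (fun q => fderiv ℝ X q y) p x) =
      P.κ (ω p).1 * (ca P ω p x * ca P ω p y - 3 * (cb P ω p x * cb P ω p y)) := by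
  have hω := S.contDiffAt_lift p hp
  have h1 : ContDiffAt ℝ 3 (fun q => P.η (ω q)) p := P.contDiff_η.contDiffAt.comp p hω
  have h2 : ContDiffAt ℝ 2 (fun q => fderiv ℝ X q y) p :=
    ((S.contDiffAt_map p hp).fderiv_right (m := 2) (by norm_num)).clm_apply contDiffAt_const
  have hG : ContDiffAt ℝ 1 (fun q => inner ℝ (P.η (ω q)) (fderiv ℝ X q y)) p :=
    (h1.of_le (by norm_num)).inner ℝ (h2.of_le (by norm_num))
  obtain ⟨-, h3⟩ := fderiv_eq_zero_of_side S.isOpen_side hpR hG (by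
    filter_upwards [S.isOpen.mem_nhds hp] with q hq hqR
    rw [(S.first hq (subset_closure hqR)).2 y]
    simp [inner_add_right, inner_smul_right, P.inner_ηe, P.inner_ητ])
  have h4 := DFunLike.congr_fun h3 x
  rw [fderiv_inner_apply ℝ (h1.differentiableAt (by norm_num))
    (h2.differentiableAt (by norm_num))] at h4
  have h5 : fderiv ℝ (fun q => P.η (ω q)) p x =
      -(P.κ (ω p).1 * ca P ω p x) • P.e (ω p) + (3 * P.κ (ω p).1 * cb P ω p x) • P.τ (ω p).2 := by
    have := (P.hasFDerivAt_η (ω p)).comp p (hω.differentiableAt (by norm_num)).hasFDerivAt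
    erw [this.fderiv]
    have hρ := P.ρ_pos (ω p).1
    simp only [ContinuousLinearMap.comp_apply, add_apply, ContinuousLinearMap.smulRight_apply,
      ContinuousLinearMap.coe_fst', ContinuousLinearMap.coe_snd', ca, cb, ProfileFlow.κ]
    match_scalars <;> field_simp
  rw [h5, (S.first hp hpR).2 y] at h4
  simp only [inner_add_left, inner_add_right, inner_smul_left, inner_smul_right, P.inner_ee,
    P.inner_eτ, P.inner_τe, P.inner_ττ] at h4
  simp at h4
  linarith

end SideLift

/-! ### Matching of the frames of two surfaces in contact -/

/-- Expansion in an orthonormal frame of `ℝ⁴`. -/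
lemma eq_frame_sum {f : Fin 4 → E4} (hf : Orthonormal ℝ f) (x : E4) :
    x = inner ℝ (f 0) x • f 0 + inner ℝ (f 1) x • f 1 + inner ℝ (f 2) x • f 2 +
      inner ℝ (f 3) x • f 3 := by
  have hspan : ⊤ ≤ Submodule.span ℝ (range f) :=
    (hf.linearIndependent.span_eq_top_of_card_eq_finrank (by simp)).ge
  have := (OrthonormalBasis.mk hf hspan).sum_repr' x
  rw [Fin.sum_univ_four] at this
  simpa using this.symm

lemma ProfileFlow.orthonormal_frame (P : ProfileFlow) (p : ℝ × ℝ) :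
    Orthonormal ℝ ![P.Y p, P.e p, P.τ p.2, P.η p] := by
  rw [orthonormal_iff_ite]
  have h1 : inner ℝ (P.τ p.2) (P.Y p) = 0 := by rw [real_inner_comm]; exact P.inner_Yτ p
  have h2 : inner ℝ (P.e p) (P.Y p) = 0 := by rw [real_inner_comm]; exact P.inner_Ye p
  have h3 : inner ℝ (P.τ p.2) (P.η p) = 0 := by rw [real_inner_comm]; exact P.inner_ητ p
  intro i j
  fin_cases i <;> fin_cases j <;>
    simp [P.norm_Y, P.norm_e, P.norm_τ, P.norm_η, P.inner_Ye, P.inner_Yτ, P.inner_Yη, P.inner_eη,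
      P.inner_ηe, P.inner_eτ, P.inner_τe, P.inner_ητ, P.inner_ηY, h1, h2, h3]

/-- Two orthonormal frames with the same first vector, the same tangent plane and the same second
derivatives, whose second fundamental forms are `κ (a² - 3 b²)` and `κ' (a'² - 3 b'²)` with positive
`κ`, `κ'`, agree up to the signs of the tangent vectors: the eigenvalue of larger modulus
has the sign opposite to the other one. -/
lemma frame_match {Y e τ η e' τ' η' : E4} (hf : Orthonormal ℝ ![Y, e, τ, η])
    (hf' : Orthonormal ℝ ![Y, e', τ', η']) {L : ℝ × ℝ →L[ℝ] E4} (hL : Function.Injective L)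
    {a b a' b' : ℝ × ℝ → ℝ} (h1 : ∀ x, L x = a x • e + b x • τ)
    (h2 : ∀ x, L x = a' x • e' + b' x • τ') {B : ℝ × ℝ → ℝ × ℝ → E4} {κ κ' : ℝ} (hκ : 0 < κ)
    (hκ' : 0 < κ')
    (h3 : ∀ x y, inner ℝ η (B x y) = κ * (a x * a y - 3 * (b x * b y)))
    (h4 : ∀ x y, inner ℝ η' (B x y) = κ' * (a' x * a' y - 3 * (b' x * b' y))) :
    κ' = κ ∧ η' = η ∧ ∃ ε₁ ε₂ : ℝ, ε₁ ^ 2 = 1 ∧ ε₂ ^ 2 = 1 ∧ e' = ε₁ • e ∧ τ' = ε₂ • τ := by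
  have o := orthonormal_iff_ite.1 hf
  have o' := orthonormal_iff_ite.1 hf'
  have hee : inner ℝ e e = 1 := by simpa using o 1 1
  have hττ : inner ℝ τ τ = 1 := by simpa using o 2 2
  have heτ : inner ℝ e τ = 0 := by simpa using o 1 2
  have hτe : inner ℝ τ e = 0 := by simpa using o 2 1
  have hee' : inner ℝ e' e' = 1 := by simpa using o' 1 1
  have hττ' : inner ℝ τ' τ' = 1 := by simpa using o' 2 2
  have heτ' : inner ℝ e' τ' = 0 := by simpa using o' 1 2
  have hτe' : inner ℝ τ' e' = 0 := by simpa using o' 2 1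
  have hηe' : inner ℝ e' η' = 0 := by simpa using o' 1 3
  have hητ' : inner ℝ τ' η' = 0 := by simpa using o' 2 3
  have hYη' : inner ℝ Y η' = 0 := by simpa using o' 0 3
  have hηη' : inner ℝ η' η' = 1 := by simpa using o' 3 3
  have hηη : inner ℝ η η = 1 := by simpa using o 3 3
  -- the components of `L x` are inner products, so the tangent plane is the range of `L`
  have ha : ∀ x, a x = inner ℝ e (L x) := fun x => by
    rw [h1, inner_add_right, inner_smul_right, inner_smul_right, hee, heτ]; ring
  have hb : ∀ x, b x = inner ℝ τ (L x) := fun x => by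
    rw [h1, inner_add_right, inner_smul_right, inner_smul_right, hττ, hτe]; ring
  have ha' : ∀ x, a' x = inner ℝ e' (L x) := fun x => by
    rw [h2, inner_add_right, inner_smul_right, inner_smul_right, hee', heτ']; ring
  have hb' : ∀ x, b' x = inner ℝ τ' (L x) := fun x => by
    rw [h2, inner_add_right, inner_smul_right, inner_smul_right, hττ', hτe']; ring
  let AB : ℝ × ℝ →ₗ[ℝ] ℝ × ℝ :=
    { toFun := fun x => (inner ℝ e (L x), inner ℝ τ (L x))
      map_add' := fun x y => by simp [inner_add_right]
      map_smul' := fun c x => by simp [inner_smul_right] }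
  have hAB : Function.Injective AB := by
    intro x y hxy
    have hxy' : inner ℝ e (L x) = inner ℝ e (L y) ∧ inner ℝ τ (L x) = inner ℝ τ (L y) :=
      Prod.ext_iff.1 hxy
    refine hL ?_
    rw [h1 x, h1 y, ha, hb, ha, hb, hxy'.1, hxy'.2]
  have hsurj := LinearMap.injective_iff_surjective.1 hAB
  obtain ⟨x, hx⟩ := hsurj (1, 0)
  obtain ⟨y, hy⟩ := hsurj (0, 1)
  have hx' : inner ℝ e (L x) = 1 ∧ inner ℝ τ (L x) = 0 := Prod.ext_iff.1 hx
  have hy' : inner ℝ e (L y) = 0 ∧ inner ℝ τ (L y) = 1 := Prod.ext_iff.1 hy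
  have hLx : L x = e := by rw [h1, ha, hb, hx'.1, hx'.2]; simp
  have hLy : L y = τ := by rw [h1, ha, hb, hy'.1, hy'.2]; simp
  set m11 := a' x with hm11
  set m21 := b' x with hm21
  set m12 := a' y with hm12
  set m22 := b' y with hm22
  have he : e = m11 • e' + m21 • τ' := by rw [← hLx, h2]
  have hτ : τ = m12 • e' + m22 • τ' := by rw [← hLy, h2]
  have q1 : m11 ^ 2 + m21 ^ 2 = 1 := by
    rw [he] at hee
    simp only [inner_add_left, inner_add_right, real_inner_smul_left, inner_smul_right, hee', heτ',
      hτe', hττ'] at hee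
    linarith
  have q2 : m12 ^ 2 + m22 ^ 2 = 1 := by
    rw [hτ] at hττ
    simp only [inner_add_left, inner_add_right, real_inner_smul_left, inner_smul_right, hee', heτ',
      hτe', hττ'] at hττ
    linarith
  have q3 : m11 * m12 + m21 * m22 = 0 := by
    rw [he, hτ] at heτ
    simp only [inner_add_left, inner_add_right, real_inner_smul_left, inner_smul_right, hee', heτ',
      hτe', hττ'] at heτ
    linarith
  -- the normals agree up to a sign `δ`
  have hδ : η' = inner ℝ η η' • η := by
    have h := eq_frame_sum hf η'
    have t1 : inner ℝ e η' = 0 := by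
      rw [he, inner_add_left, real_inner_smul_left, real_inner_smul_left, hηe', hητ']; ring
    have t2 : inner ℝ τ η' = 0 := by
      rw [hτ, inner_add_left, real_inner_smul_left, real_inner_smul_left, hηe', hητ']; ring
    simpa [hYη', t1, t2] using h
  set δ := inner ℝ η η' with hδdef
  have hδ2 : δ ^ 2 = 1 := by
    rw [hδ, real_inner_smul_left, inner_smul_right, hηη] at hηη'
    linarith
  have hBx : δ * κ = κ' * (m11 ^ 2 - 3 * m21 ^ 2) := by
    have u1 := h3 x x
    have u2 := h4 x x
    rw [hδ, real_inner_smul_left, u1, ha, hb, hx'.1, hx'.2] at u2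
    linarith
  have hBy : -(3 * (δ * κ)) = κ' * (m12 ^ 2 - 3 * m22 ^ 2) := by
    have u1 := h3 y y
    have u2 := h4 y y
    rw [hδ, real_inner_smul_left, u1, ha, hb, hy'.1, hy'.2] at u2
    linarith
  have q4 : m12 ^ 2 = m21 ^ 2 := by grind
  have q5 : m22 ^ 2 = m11 ^ 2 := by linarith
  have hδκ : δ * κ = κ' := by
    rw [q4, q5] at hBy
    have : κ' * (m11 ^ 2 - 3 * m21 ^ 2) + κ' * (m21 ^ 2 - 3 * m11 ^ 2) =
      -2 * κ' * (m11 ^ 2 + m21 ^ 2) := by ring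
    rw [q1] at this
    linarith
  have hδ1 : δ = 1 := by
    have : 0 < δ := pos_of_mul_pos_left (hδκ ▸ hκ') hκ.le
    nlinarith
  have hκκ : κ' = κ := by rw [← hδκ, hδ1, one_mul]
  have hm21' : m21 = 0 := by
    rw [hδκ] at hBx
    have h5 : m11 ^ 2 - 3 * m21 ^ 2 = 1 := by
      have := mul_left_cancel₀ hκ'.ne' (hBx.symm.trans (mul_one κ').symm)
      exact this
    have : m21 ^ 2 = 0 := by linarith
    exact pow_eq_zero_iff (two_ne_zero) |>.1 this
  have hm12' : m12 = 0 := by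
    rw [hm21'] at q4
    exact pow_eq_zero_iff (two_ne_zero) |>.1 (by rw [q4]; norm_num)
  rw [hm21', zero_smul, add_zero] at he
  rw [hm12', zero_smul, zero_add] at hτ
  have q6 : m11 ^ 2 = 1 := by rw [hm21'] at q1; linarith
  have q7 : m22 ^ 2 = 1 := by rw [hm12'] at q2; linarith
  refine ⟨hκκ, by rw [hδ, hδ1, one_smul], m11, m22, q6, q7, ?_, ?_⟩
  · rw [he, smul_smul, ← sq, q6, one_smul]
  · rw [hτ, smul_smul, ← sq, q7, one_smul]


/-! ### Rigidity of the contact along a curve -/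

lemma ProfileFlow.hκ (P : ProfileFlow) (h : ℝ) :
    HasDerivAt P.κ (-(4 / 3) * P.κ h * (P.α h / P.ρ h) * P.v h) h := by
  have h1 := P.ρ_pos h
  refine ((P.hβ h).div ((P.hρ h).const_mul 3) (by positivity)).congr_deriv ?_
  unfold ProfileFlow.κ
  field_simp
  ring

lemma ProfileFlow.inner_we (P : ProfileFlow) (p : ℝ × ℝ) :
    inner ℝ (P.w p.2) (P.e p) = P.α p.1 := by
  rw [real_inner_comm]
  unfold ProfileFlow.e
  simp [inner_add_left, inner_smul_left, P.inner_uw, P.inner_juw, P.norm_w]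

lemma mem_closure_neg (s : ℝ) : ((0 : ℝ), s) ∈ closure {p : ℝ × ℝ | p.1 < 0} := by
  have : {p : ℝ × ℝ | p.1 < 0} = Iio 0 ×ˢ univ := by ext; simp
  rw [this, closure_prod_eq, closure_Iio, closure_univ]
  exact ⟨le_refl (0 : ℝ), mem_univ _⟩

lemma mem_closure_pos (s : ℝ) : ((0 : ℝ), s) ∈ closure {p : ℝ × ℝ | 0 < p.1} := by
  have : {p : ℝ × ℝ | 0 < p.1} = Ioi 0 ×ˢ univ := by ext; simp
  rw [this, closure_prod_eq, closure_Ioi, closure_univ]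
  exact ⟨le_refl (0 : ℝ), mem_univ _⟩

/-- The data of two surfaces agree at the points with parameters `q` and `q'`, up to
the isometry `A` and up to the orientations `ε₁`, `ε₂` of the meridian and the parallel. -/
structure FrameContact (P P' : ProfileFlow) (A : E4 ≃ₗᵢ[ℝ] E4) (q q' : ℝ × ℝ) (ε₁ ε₂ : ℝ) :
    Prop where
  sq₁ : ε₁ ^ 2 = 1
  sq₂ : ε₂ ^ 2 = 1
  const : P'.C = P.C
  ρ : P'.ρ q'.1 = P.ρ q.1
  α : P.α q.1 = ε₁ * P'.α q'.1
  β : P'.β q'.1 = P.β q.1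
  Y : A (P'.Y q') = P.Y q
  e : A (P'.e q') = ε₁ • P.e q
  η : A (P'.η q') = P.η q
  τ : A (P'.τ q'.2) = ε₂ • P.τ q.2

section
variable {P P' : ProfileFlow} {X : ℝ × ℝ → E4} {N : Set (ℝ × ℝ)} {ω ω' : ℝ × ℝ → ℝ × ℝ}
  {A : E4 ≃ₗᵢ[ℝ] E4}
  (S : SideLift P X N {p | p.1 < 0} ω)
  (S' : SideLift P' (fun p => A.symm (X p)) N {p | 0 < p.1} ω')
  (hX : ∀ p ∈ N, Function.Injective (fderiv ℝ X p))
include S S' hX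

lemma contact_second_order {s : ℝ} (hs : ((0 : ℝ), s) ∈ N) :
    P'.κ (ω' (0, s)).1 = P.κ (ω (0, s)).1 ∧ A (P'.η (ω' (0, s))) = P.η (ω (0, s)) ∧
    ∃ ε₁ ε₂ : ℝ, ε₁ ^ 2 = 1 ∧ ε₂ ^ 2 = 1 ∧ A (P'.e (ω' (0, s))) = ε₁ • P.e (ω (0, s)) ∧
      A (P'.τ (ω' (0, s)).2) = ε₂ • P.τ (ω (0, s)).2 := by
  obtain ⟨f1, f2⟩ := S.first hs (mem_closure_neg s)
  obtain ⟨g1, g2⟩ := S'.first hs (mem_closure_pos s)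
  have hY : A (P'.Y (ω' (0, s))) = P.Y (ω (0, s)) := by rw [g1, f1]; simp
  have ho := (P'.orthonormal_frame (ω' (0, s))).comp_linearIsometryEquiv A
  have hoe : (A ∘ ![P'.Y (ω' (0, s)), P'.e (ω' (0, s)), P'.τ (ω' (0, s)).2, P'.η (ω' (0, s))]) =
      ![P.Y (ω (0, s)), A (P'.e (ω' (0, s))), A (P'.τ (ω' (0, s)).2),
        A (P'.η (ω' (0, s)))] := by
    ext i : 1
    fin_cases i
    · exact hY
    · rfl
    · rfl
    · rfl
  have ho' : Orthonormal ℝ ![P.Y (ω (0, s)), A (P'.e (ω' (0, s))), A (P'.τ (ω' (0, s)).2),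
        A (P'.η (ω' (0, s)))] := by rw [← hoe]; exact ho
  have hfd : ∀ p ∈ N, ∀ x, fderiv ℝ (fun p => A.symm (X p)) p x = A.symm (fderiv ℝ X p x) := by
    intro p hp x
    have h1 := ((S.contDiffAt_map p hp).differentiableAt (by norm_num)).hasFDerivAt
    have h2 := (A.symm.toContinuousLinearEquiv : E4 →L[ℝ] E4).hasFDerivAt.comp p h1
    have h3 : HasFDerivAt (fun p => A.symm (X p))
      ((A.symm.toContinuousLinearEquiv : E4 →L[ℝ] E4) ∘L fderiv ℝ X p) p := h2
    rw [h3.fderiv]; rfl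
  refine frame_match (P.orthonormal_frame (ω (0, s))) ho' (hX _ hs) f2 (fun x => ?_)
    (P.κ_pos _) (P'.κ_pos _) (B := fun x y => fderiv ℝ (fun q => fderiv ℝ X q y) (0, s) x)
    (S.second hs (mem_closure_neg s)) (fun x y => ?_)
    (a' := fun x => SideLift.ca P' ω' (0, s) x) (b' := fun x => SideLift.cb P' ω' (0, s) x)
  · have := congrArg A (g2 x)
    rw [hfd _ hs] at this
    simpa using this
  · rw [← S'.second hs (mem_closure_pos s)]
    have h1 : (fun q => fderiv ℝ (fun p => A.symm (X p)) q y) =ᶠ[𝓝 (0, s)]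
        fun q => A.symm (fderiv ℝ X q y) := by
      filter_upwards [S.isOpen.mem_nhds hs] with q hq using hfd q hq y
    have h2 : ContDiffAt ℝ 2 (fun q => fderiv ℝ X q y) (0, s) :=
      ((S.contDiffAt_map _ hs).fderiv_right (m := 2) (by norm_num)).clm_apply contDiffAt_const
    have h3 := (A.symm.toContinuousLinearEquiv : E4 →L[ℝ] E4).hasFDerivAt.comp (0, s)
      (h2.differentiableAt (by norm_num)).hasFDerivAt
    have h4 : HasFDerivAt (fun q => A.symm (fderiv ℝ X q y))
      ((A.symm.toContinuousLinearEquiv : E4 →L[ℝ] E4) ∘L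
        fderiv ℝ (fun q => fderiv ℝ X q y) (0, s)) (0, s) := h3
    rw [h1.fderiv_eq, h4.fderiv]
    change _ = inner ℝ (P'.η (ω' (0, s))) (A.symm (fderiv ℝ (fun q => fderiv ℝ X q y) (0, s) x))
    conv_rhs => rw [← A.inner_map_map, A.apply_symm_apply]

/-- Differentiating the agreement of curvatures and of the parallel directions along the curve of
contact yields the equality of `α / ρ`, hence of all data. -/
lemma exists_frameContact {s : ℝ} (hs : ((0 : ℝ), s) ∈ N) :
    ∃ ε₁ ε₂, FrameContact P P' A (ω (0, s)) (ω' (0, s)) ε₁ ε₂ := by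
  obtain ⟨hκ, hη, ε₁, ε₂, hε₁, hε₂, he, hτ⟩ := contact_second_order S S' hX hs
  obtain ⟨f1, f2⟩ := S.first hs (mem_closure_neg s)
  obtain ⟨g1, g2⟩ := S'.first hs (mem_closure_pos s)
  have hY : A (P'.Y (ω' (0, s))) = P.Y (ω (0, s)) := by rw [g1, f1]; simp
  have hline : HasDerivAt (fun x : ℝ => ((0 : ℝ), x)) ((0 : ℝ), (1 : ℝ)) s :=
    (hasDerivAt_const s (0 : ℝ)).prodMk (hasDerivAt_id s)
  have hnear : ∀ᶠ x in 𝓝 s, ((0 : ℝ), x) ∈ N :=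
    hline.continuousAt.eventually (S.isOpen.mem_nhds hs)
  have hω := ((S.contDiffAt_lift _ hs).differentiableAt (by norm_num)).hasFDerivAt.comp_hasDerivAt
    s hline
  have hω' := ((S'.contDiffAt_lift _ hs).differentiableAt
    (by norm_num)).hasFDerivAt.comp_hasDerivAt s hline
  have hω1 := hasFDerivAt_fst.comp_hasDerivAt (𝕜 := ℝ) s hω
  have hω1' := hasFDerivAt_fst.comp_hasDerivAt (𝕜 := ℝ) s hω'
  have hω2' := hasFDerivAt_snd.comp_hasDerivAt (𝕜 := ℝ) s hω'
  set p : ℝ × ℝ := (0, s) with hp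
  set q := ω p with hq
  set q' := ω' p with hq'
  set a := SideLift.ca P ω p (0, 1) with ha
  set b := SideLift.cb P ω p (0, 1) with hb
  set a' := SideLift.ca P' ω' p (0, 1) with ha'
  set b' := SideLift.cb P' ω' p (0, 1) with hb'
  have hρ := P.ρ_pos q.1
  have hρ' := P'.ρ_pos q'.1
  have hfd : ∀ x, fderiv ℝ (fun p => A.symm (X p)) p x = A.symm (fderiv ℝ X p x) := by
    intro x
    have h1 := ((S.contDiffAt_map p hs).differentiableAt (by norm_num)).hasFDerivAt
    have h3 : HasFDerivAt (fun p => A.symm (X p))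
      ((A.symm.toContinuousLinearEquiv : E4 →L[ℝ] E4) ∘L fderiv ℝ X p) p :=
      (A.symm.toContinuousLinearEquiv : E4 →L[ℝ] E4).hasFDerivAt.comp p h1
    rw [h3.fderiv]; rfl
  -- the components of the tangent vector of the curve
  have hab : a • P.e q + b • P.τ q.2 = (a' * ε₁) • P.e q + (b' * ε₂) • P.τ q.2 := by
    rw [← f2 (0, 1), ← smul_smul, ← smul_smul, ← he, ← hτ]
    have := congrArg A (g2 (0, 1))
    rw [hfd] at this
    simpa using this
  have haa : a = a' * ε₁ := by
    have := congrArg (fun x => inner ℝ (P.e q) x) hab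
    simpa [inner_add_right, inner_smul_right, P.norm_e, P.inner_eτ] using this
  have hbb : b = b' * ε₂ := by
    have := congrArg (fun x => inner ℝ (P.τ q.2) x) hab
    simpa [inner_add_right, inner_smul_right, P.norm_τ, P.inner_τe] using this
  -- derivative of the curvature along the curve
  have e1 : a * (P.α q.1 / P.ρ q.1 - ε₁ * (P'.α q'.1 / P'.ρ q'.1)) = 0 := by
    have d1 := (P.hκ q.1).comp s hω1
    have d2 := (P'.hκ q'.1).comp s hω1'
    have d3 : (P.κ ∘ fun x => (ω ((0 : ℝ), x)).1) =ᶠ[𝓝 s] (P'.κ ∘ fun x => (ω' ((0 : ℝ), x)).1) := by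
      filter_upwards [hnear] with x hx
      exact (contact_second_order S S' hX hx).1.symm
    have d4 := (d2.congr_of_eventuallyEq d3).unique d1
    simp only [ContinuousLinearMap.coe_fst'] at d4
    have d5 : P'.κ q'.1 * (P'.α q'.1 / P'.ρ q'.1) * a' = P.κ q.1 * (P.α q.1 / P.ρ q.1) * a := by
      rw [ha, ha']
      unfold SideLift.ca
      linear_combination (-3 / 4) * d4
    rw [hκ] at d5
    have d6 := mul_left_cancel₀ (P.κ_pos q.1).ne' (a := P.κ q.1)
      (b := P'.α q'.1 / P'.ρ q'.1 * a') (c := P.α q.1 / P.ρ q.1 * a) (by linarith)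
    have : a' = a * ε₁ := by rw [haa, mul_assoc, ← sq, hε₁, mul_one]
    rw [this] at d6
    linarith
  -- derivative of the orthogonality of meridian and parallel directions along the curve
  have e2 : b * (P.α q.1 / P.ρ q.1 - ε₁ * (P'.α q'.1 / P'.ρ q'.1)) = 0 := by
    have d1 := (P.hasFDerivAt_e q).comp_hasDerivAt s hω
    have d2 := (P'.hτ q'.2).scomp s hω2'
    have d2' : HasDerivAt (fun x => A (P'.τ (ω' ((0 : ℝ), x)).2)) _ s :=
      (A.toContinuousLinearEquiv : E4 →L[ℝ] E4).hasFDerivAt.comp_hasDerivAt s d2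
    have d3 := d2'.inner ℝ d1
    have d4 : (fun x => inner ℝ (A (P'.τ (ω' ((0 : ℝ), x)).2)) (P.e (ω ((0 : ℝ), x)))) =ᶠ[𝓝 s]
        fun _ => (0 : ℝ) := by
      filter_upwards [hnear] with x hx
      obtain ⟨-, -, δ₁, δ₂, -, -, -, h⟩ := contact_second_order S S' hX hx
      rw [h, real_inner_smul_left, P.inner_τe, mul_zero]
    have d5 := d3.unique ((hasDerivAt_const s (0 : ℝ)).congr_of_eventuallyEq d4)
    have heA : inner ℝ (A (P'.w q'.2)) (P.e q) = ε₁ * P'.α q'.1 := by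
      have : P.e q = ε₁ • A (P'.e q') := by rw [he, smul_smul, ← sq, hε₁, one_smul]
      rw [this, inner_smul_right, A.inner_map_map, P'.inner_we]
    simp only [ContinuousLinearEquiv.coe_coe, map_smul, inner_smul_left] at d5
    change inner ℝ (A (P'.τ q'.2)) _ + (fderiv ℝ ω' p (0, 1)).2 *
      (-Real.sqrt P'.C * inner ℝ (A (P'.w q'.2)) (P.e q)) = 0 at d5
    rw [hτ, real_inner_smul_left, heA] at d5
    simp only [add_apply, ContinuousLinearMap.smulRight_apply, ContinuousLinearMap.coe_fst',
      ContinuousLinearMap.coe_snd', inner_add_right, inner_smul_right, inner_neg_right] at d5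
    have t1 : inner ℝ (P.τ q.2) (P.Y q) = 0 := by rw [real_inner_comm]; exact P.inner_Yτ q
    have t2 : inner ℝ (P.τ q.2) (P.η q) = 0 := by rw [real_inner_comm]; exact P.inner_ητ q
    rw [t1, t2, P.inner_ττ] at d5
    have d6 : ε₂ * (P.α q.1 / P.ρ q.1 * b) = b' / P'.ρ q'.1 * (ε₁ * P'.α q'.1) := by
      have hb1 : b = (fderiv ℝ ω p (0, 1)).2 * (Real.sqrt P.C * P.ρ q.1) := rfl
      have hb2 : b' = (fderiv ℝ ω' p (0, 1)).2 * (Real.sqrt P'.C * P'.ρ q'.1) := rfl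
      rw [hb1, hb2]
      field_simp
      linear_combination d5
    have : b' = b * ε₂ := by rw [hbb, mul_assoc, ← sq, hε₂, mul_one]
    rw [this] at d6
    have h7 : ε₂ * (b * (P.α q.1 / P.ρ q.1 - ε₁ * (P'.α q'.1 / P'.ρ q'.1))) = 0 := by
      linear_combination d6
    rcases mul_eq_zero.1 h7 with h | h
    · rw [h] at hε₂; norm_num at hε₂
    · exact h
  have hα : P.α q.1 / P.ρ q.1 = ε₁ * (P'.α q'.1 / P'.ρ q'.1) := by
    by_contra hne
    have hne' := sub_ne_zero.2 hne
    have a0 := (mul_eq_zero.1 e1).resolve_right hne'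
    have b0 := (mul_eq_zero.1 e2).resolve_right hne'
    have h1 := f2 (0, 1)
    rw [show SideLift.ca P ω p (0, 1) = 0 from a0, show SideLift.cb P ω p (0, 1) = 0 from b0,
      zero_smul, zero_smul, add_zero] at h1
    have h2 := hX p hs (h1.trans (map_zero _).symm)
    simp at h2
  have hβρ : P'.β q'.1 / P'.ρ q'.1 = P.β q.1 / P.ρ q.1 := by
    have : P'.β q'.1 / (3 * P'.ρ q'.1) = P.β q.1 / (3 * P.ρ q.1) := hκ
    rw [mul_comm 3, mul_comm 3, ← div_div, ← div_div] at this
    linarith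
  have hρρ : P'.ρ q'.1 = P.ρ q.1 := by
    have s1 := P.sphere q.1
    have s2 := P'.sphere q'.1
    have a1 : P.α q.1 = ε₁ * (P'.α q'.1 / P'.ρ q'.1) * P.ρ q.1 := by rw [← hα]; field_simp
    have a2 : P.β q.1 = (P'.β q'.1 / P'.ρ q'.1) * P.ρ q.1 := by rw [hβρ]; field_simp
    rw [a1, a2] at s1
    have s3 : P.ρ q.1 ^ 2 * (P'.ρ q'.1 ^ 2 + P'.α q'.1 ^ 2 + P'.β q'.1 ^ 2) = P'.ρ q'.1 ^ 2 := by
      field_simp at s1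
      rw [hε₁] at s1
      linarith
    rw [s2, mul_one] at s3
    exact ((sq_eq_sq₀ hρ.le hρ'.le).1 s3).symm
  have hββ : P'.β q'.1 = P.β q.1 := by
    rw [hρρ] at hβρ
    exact (div_left_inj' hρ.ne').1 hβρ
  refine ⟨ε₁, ε₂, hε₁, hε₂, ?_, hρρ, ?_, hββ, hY, he, hη, hτ⟩
  · have c1 := P.const q.1
    have c2 := P'.const q'.1
    rw [hρρ, hββ] at c2
    have hpos : 0 < P.β q.1 ^ 3 * P.ρ q.1 := mul_pos (pow_pos (P.β_pos _) 3) hρ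
    have h3 : (0 : ℝ) < 3 * Real.sqrt 3 := by positivity
    have c3 := mul_left_cancel₀ h3.ne' (mul_left_cancel₀ hpos.ne' (c2.trans c1.symm))
    exact (sq_eq_sq₀ P'.C_pos.le P.C_pos.le).1 c3
  · rw [hρρ] at hα
    field_simp at hα
    linarith

end


/-! ### Isometries carrying one piece to another -/

namespace FrameContact
variable {P P' : ProfileFlow} {A : E4 ≃ₗᵢ[ℝ] E4} {q q' : ℝ × ℝ} {ε₁ ε₂ : ℝ}
  (H : FrameContact P P' A q q' ε₁ ε₂)
include H

lemma r : P'.r q'.1 = P.r q.1 := by unfold ProfileFlow.r; rw [H.ρ]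

lemma α' : P'.α q'.1 = ε₁ * P.α q.1 := by
  rw [H.α, ← mul_assoc, ← sq, H.sq₁, one_mul]

lemma w : A (P'.w q'.2) = P.w q.2 := by
  rw [P'.w_eq q', P.w_eq q]
  simp only [map_add, map_smul, H.Y, H.e, H.η, H.ρ, H.β, smul_smul, H.α, mul_comm ε₁]

lemma u : A (P'.u q'.1) = P.u q.1 := by
  have h1 := H.Y
  unfold ProfileFlow.Y at h1
  rw [map_add, map_smul, map_smul, H.w, H.ρ, H.r, add_left_inj] at h1
  exact smul_right_injective E4 (P.r_pos q.1).ne' h1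

lemma ju : A (P'.ju q'.1) = ε₁ • P.ju q.1 := by
  have h1 := H.e
  unfold ProfileFlow.e at h1
  simp only [map_add, map_smul, H.w, H.u, H.ρ, H.r, H.β, H.α', smul_add, smul_smul] at h1
  have h2 : (P.β q.1 / P.r q.1) • A (P'.ju q'.1) = (P.β q.1 / P.r q.1) • (ε₁ • P.ju q.1) := by
    have h3 : -(P.ρ q.1 * (ε₁ * P.α q.1) / P.r q.1) = ε₁ * -(P.ρ q.1 * P.α q.1 / P.r q.1) := by ring
    rw [h3, add_left_inj, add_right_inj] at h1
    rw [h1, smul_smul, mul_comm]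
  exact smul_right_injective E4 (div_pos (P.β_pos q.1) (P.r_pos q.1)).ne' h2

end FrameContact

/-- The isometry `A` carries the parametrization of one piece to that of another, up to a rotation
or reflection of the parameter `θ`. -/
def CarriesPiece (A : E4 ≃ₗᵢ[ℝ] E4) (C : ℝ) (l : ℤ) (c' : ℝ) (k : ℤ) (c : ℝ) : Prop :=
  ∃ ε δ : ℝ, ε ^ 2 = 1 ∧ ∀ ξ θ, A (pieceMap C l c' (ξ, θ)) = pieceMap C k c (ξ, ε * θ + δ)

namespace CarriesPiece
variable {A B : E4 ≃ₗᵢ[ℝ] E4} {C : ℝ} {l k m : ℤ} {c' c d : ℝ}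

lemma refl (C : ℝ) (k : ℤ) (c : ℝ) : CarriesPiece (LinearIsometryEquiv.refl ℝ E4) C k c k c :=
  ⟨1, 0, one_pow 2, fun ξ θ => by simp⟩

lemma symm (h : CarriesPiece A C l c' k c) : CarriesPiece A.symm C k c l c' := by
  obtain ⟨ε, δ, hε, h⟩ := h
  refine ⟨ε, -(ε * δ), hε, fun ξ θ => ?_⟩
  rw [LinearIsometryEquiv.symm_apply_eq, h]
  congr 2
  linear_combination (δ - θ) * hε

lemma trans (h : CarriesPiece A C l c' k c) (h' : CarriesPiece B C k c m d) :
    CarriesPiece (A.trans B) C l c' m d := by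
  obtain ⟨ε, δ, hε, h⟩ := h
  obtain ⟨ε', δ', hε', h'⟩ := h'
  refine ⟨ε' * ε, ε' * δ + δ', by rw [mul_pow, hε, hε', one_mul], fun ξ θ => ?_⟩
  rw [LinearIsometryEquiv.trans_apply, h, h']
  congr 2
  ring

lemma image_prod (h : CarriesPiece A C l c' k c) (s : Set ℝ) :
    A '' (pieceMap C l c' '' (s ×ˢ univ)) = pieceMap C k c '' (s ×ˢ univ) := by
  obtain ⟨ε, δ, hε, h⟩ := h
  ext y
  constructor
  · rintro ⟨_, ⟨⟨ξ, θ⟩, ⟨hξ, -⟩, rfl⟩, rfl⟩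
    exact ⟨(ξ, ε * θ + δ), ⟨hξ, mem_univ _⟩, (h ξ θ).symm⟩
  · rintro ⟨⟨ξ, θ⟩, ⟨hξ, -⟩, rfl⟩
    refine ⟨_, ⟨(ξ, ε * (θ - δ)), ⟨hξ, mem_univ _⟩, rfl⟩, ?_⟩
    rw [h]
    congr 2
    linear_combination (θ - δ) * hε

lemma image_piece (h : CarriesPiece A C l c' k c) : A '' piece C l c' = piece C k c :=
  h.image_prod _

/-- The parametrization depends only on the parity of the index and on the phase mod `2π`. -/
lemma of_modEq (hkl : Even (k + l)) (h : c' ≡ c [PMOD (2 * Real.pi)]) :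
    CarriesPiece (LinearIsometryEquiv.refl ℝ E4) C l c' k c := by
  refine ⟨1, 0, one_pow 2, fun ξ θ => ?_⟩
  have h1 : (-1 : ℝ) ^ l = (-1) ^ k := by
    have : (-1 : ℝ) ^ (k + l) = 1 := hkl.neg_one_zpow
    rw [zpow_add₀ (by norm_num)] at this
    have h2 := neg_one_zpow_sq k
    have h3 : ((-1 : ℝ) ^ k) ≠ 0 := zpow_ne_zero _ (by norm_num)
    exact mul_left_cancel₀ h3 (this.trans h2.symm)
  simp only [LinearIsometryEquiv.coe_refl, id, pieceMap, h1, one_mul, add_zero,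
    cos_eq_of_modEq (h.add_left (zeta0 C ξ)), sin_eq_of_modEq (h.add_left (zeta0 C ξ))]

end CarriesPiece

/-- A piece in terms of the adapted frame at one of its points. -/
lemma pieceMap_eq_frame {C Cs : ℝ} (hC : critC < C) (hS : RegularStar C Cs) {c : ℤ → ℝ}
    (hc : PhaseRec C c) {k : ℤ} {q : ℝ × ℝ} (hq : q.1 ∈ Icc (node C Cs k) (node C Cs (k + 1)))
    (ξ θ : ℝ) : pieceMap C k (c k) (ξ, θ) =
      (Real.sqrt (1 - 1 / (C * ξ ^ 2)) * Real.cos (zeta0 C ξ - zeta0 C (F C Cs q.1))) •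
        (profile hC hS hc).u q.1 +
      (Real.sqrt (1 - 1 / (C * ξ ^ 2)) * ((-1) ^ k * Real.sin (zeta0 C ξ - zeta0 C (F C Cs q.1)))) •
        (profile hC hS hc).ju q.1 +
      (1 / (Real.sqrt C * ξ) * Real.cos (Real.sqrt C * (θ - q.2))) • (profile hC hS hc).w q.2 +
      (1 / (Real.sqrt C * ξ) * Real.sin (Real.sqrt C * (θ - q.2))) • (profile hC hS hc).τ q.2 := by
  obtain ⟨h1, h2⟩ := cosF_sinF_eq hC hS hc hq
  have h4 := neg_one_zpow_sq k
  set z := zeta0 C (F C Cs q.1) with hz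
  have hzz : zeta0 C ξ + c k = (zeta0 C ξ - z) + (z + c k) := by ring
  have htt : Real.sqrt C * θ = Real.sqrt C * (θ - q.2) + Real.sqrt C * q.2 := by ring
  ext i
  fin_cases i
  · simp only [pieceMap, hzz, Real.cos_add, ProfileFlow.u, ProfileFlow.ju, ProfileFlow.w,
      ProfileFlow.τ, profile, h1, h2]
    simp
    linear_combination (√(1 - (ξ ^ 2)⁻¹ * C⁻¹) * Real.sin (zeta0 C ξ - z) * Real.sin (z + c k)) * h4
  · simp only [pieceMap, hzz, Real.sin_add, ProfileFlow.u, ProfileFlow.ju, ProfileFlow.w,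
      ProfileFlow.τ, profile, h1, h2]
    simp
    ring
  · simp only [pieceMap, htt, Real.cos_add, ProfileFlow.u, ProfileFlow.ju, ProfileFlow.w,
      ProfileFlow.τ, profile]
    simp
    ring
  · simp only [pieceMap, htt, Real.sin_add, ProfileFlow.u, ProfileFlow.ju, ProfileFlow.w,
      ProfileFlow.τ, profile]
    simp
    ring

lemma alphaX_eq_zero_iff {C : ℝ} (hC : critC < C) {ξ : ℝ} (hξ : ξ ∈ Icc (xi01 C) (xi02 C)) :
    alphaX C ξ = 0 ↔ ξ = xi01 C ∨ ξ = xi02 C := by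
  have hp := pos_of_mem hC hξ
  have hc := C_pos hC
  rw [← sq_eq_zero_iff, alphaX_sq hC hξ]
  constructor
  · intro h
    by_contra hne
    push Not at hne
    have := T_pos hC ⟨lt_of_le_of_ne hξ.1 (Ne.symm hne.1), lt_of_le_of_ne hξ.2 hne.2⟩
    have : 0 < T C ξ / (3 * C * ξ ^ 2) := by positivity
    linarith
  · rintro (rfl | rfl)
    · rw [T_xi01 hC, zero_div]
    · rw [T_xi02 hC, zero_div]

/-- Contact of the frames determines the isometry: it carries the second piece either to the first
one or to its continuation across a boundary circle. -/
lemma FrameContact.carriesPiece {C Cs : ℝ} (hC : critC < C) (hS : RegularStar C Cs) {c c' : ℤ → ℝ}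
    (hc : PhaseRec C c) (hc' : PhaseRec C c') {k l : ℤ} {q q' : ℝ × ℝ} {A : E4 ≃ₗᵢ[ℝ] E4}
    {ε₁ ε₂ : ℝ}
    (hq : q.1 ∈ Icc (node C Cs k) (node C Cs (k + 1)))
    (hq' : q'.1 ∈ Icc (node C Cs l) (node C Cs (l + 1)))
    (H : FrameContact (profile hC hS hc) (profile hC hS hc') A q q' ε₁ ε₂) :
    F C Cs q'.1 = F C Cs q.1 ∧ (CarriesPiece A C l (c' l) k (c k) ∨
      (F C Cs q.1 = xi01 C ∨ F C Cs q.1 = xi02 C) ∧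
        CarriesPiece A C l (c' l) (k + 1) (-2 * zeta0 C (F C Cs q.1) - c k)) := by
  have hF := F_mem hC hS q.1
  have hFF : F C Cs q'.1 = F C Cs q.1 :=
    rhoX_injOn hC (pos_of_mem hC (F_mem hC hS _)) (pos_of_mem hC hF)
      (congrArg (· ^ 2) (show rhoX C (F C Cs q'.1) = rhoX C (F C Cs q.1) from H.ρ))
  refine ⟨hFF, ?_⟩
  have hα : alphaF C Cs q.1 = ε₁ * alphaF C Cs q'.1 := H.α
  rw [alphaF_eq hC hS hq, alphaF_eq hC hS hq', hFF] at hα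
  have hk2 := neg_one_zpow_sq k
  have hl2 := neg_one_zpow_sq l
  set a := (-1 : ℝ) ^ k with ha
  set b := (-1 : ℝ) ^ l with hb
  have hprod : (ε₁ * b - a) * (ε₁ * b + a) = 0 := by
    linear_combination b * b * H.sq₁ + hl2 - hk2
  have hε₂ : ε₂ = 1 ∨ ε₂ = -1 := sq_eq_one_iff.1 H.sq₂
  have hcos : ∀ x, Real.cos (Real.sqrt C * (ε₂ * x)) = Real.cos (Real.sqrt C * x) := by
    intro x
    rcases hε₂ with h | h <;> simp [h]
  have hsin : ∀ x, Real.sin (Real.sqrt C * (ε₂ * x)) = ε₂ * Real.sin (Real.sqrt C * x) := by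
    intro x
    rcases hε₂ with h | h <;> simp [h]
  have hmap : ∀ ξ θ, A (pieceMap C l (c' l) (ξ, θ)) =
      (Real.sqrt (1 - 1 / (C * ξ ^ 2)) * Real.cos (zeta0 C ξ - zeta0 C (F C Cs q.1))) •
        (profile hC hS hc).u q.1 +
      (Real.sqrt (1 - 1 / (C * ξ ^ 2)) * (ε₁ * b * Real.sin (zeta0 C ξ - zeta0 C (F C Cs q.1)))) •
        (profile hC hS hc).ju q.1 +
      (1 / (Real.sqrt C * ξ) * Real.cos (Real.sqrt C * (ε₂ * (θ - q'.2)))) •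
        (profile hC hS hc).w q.2 +
      (1 / (Real.sqrt C * ξ) * Real.sin (Real.sqrt C * (ε₂ * (θ - q'.2)))) •
        (profile hC hS hc).τ q.2 := by
    intro ξ θ
    rw [pieceMap_eq_frame hC hS hc' hq']
    simp only [map_add, map_smul, H.u, H.ju, H.w, H.τ, hFF, hcos, hsin, smul_smul]
    congr 2
    · congr 2
      ring
    · ring
  have hkI : ε₁ * b = a → CarriesPiece A C l (c' l) k (c k) := by
    intro h
    refine ⟨ε₂, q.2 - ε₂ * q'.2, H.sq₂, fun ξ θ => ?_⟩
    rw [hmap, pieceMap_eq_frame hC hS hc hq, h]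
    rw [show ε₂ * θ + (q.2 - ε₂ * q'.2) - q.2 = ε₂ * (θ - q'.2) by ring]
  by_cases h0 : alphaX C (F C Cs q.1) = 0
  · rcases mul_eq_zero.1 hprod with h | h
    · exact Or.inl (hkI (sub_eq_zero.1 h))
    · refine Or.inr ⟨(alphaX_eq_zero_iff hC hF).1 h0, ε₂, q.2 - ε₂ * q'.2, H.sq₂, fun ξ θ => ?_⟩
      -- the reflected frame is the frame at the common boundary point of the next piece
      obtain ⟨h1, h2⟩ := cosF_sinF_eq hC hS hc hq
      set z := zeta0 C (F C Cs q.1) with hz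
      have hzz : zeta0 C ξ + (-2 * z - c k) = (zeta0 C ξ - z) - (z + c k) := by ring
      have htt : Real.sqrt C * (ε₂ * θ + (q.2 - ε₂ * q'.2)) =
        Real.sqrt C * (ε₂ * (θ - q'.2)) + Real.sqrt C * q.2 := by ring
      rw [hmap, eq_neg_of_add_eq_zero_left h]
      ext i
      fin_cases i
      · simp only [pieceMap, hzz, Real.cos_sub _ (z + c k), ProfileFlow.u, ProfileFlow.ju,
          ProfileFlow.w, ProfileFlow.τ, profile, h1, h2]
        simp
        linear_combination (√(1 - (ξ ^ 2)⁻¹ * C⁻¹) * Real.sin (zeta0 C ξ - z) *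
          Real.sin (z + c k)) * hk2
      · simp only [pieceMap, hzz, Real.sin_sub _ (z + c k), ProfileFlow.u, ProfileFlow.ju,
          ProfileFlow.w, ProfileFlow.τ, profile, h1, h2, neg_one_zpow_succ]
        simp
        ring
      · simp only [pieceMap, htt, Real.cos_add, ProfileFlow.u, ProfileFlow.ju, ProfileFlow.w,
          ProfileFlow.τ, profile]
        simp
        ring
      · simp only [pieceMap, htt, Real.sin_add, ProfileFlow.u, ProfileFlow.ju, ProfileFlow.w,
          ProfileFlow.τ, profile]
        simp
        ring
  · refine Or.inl (hkI ?_)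
    have : (ε₁ * b - a) * alphaX C (F C Cs q.1) = 0 := by linear_combination hα
    exact sub_eq_zero.1 ((mul_eq_zero.1 this).resolve_right h0)


/-! ### Rigidity of gluing -/

lemma SideLift.mono {P : ProfileFlow} {X : ℝ × ℝ → E4} {N N' R : Set (ℝ × ℝ)} {ω : ℝ × ℝ → ℝ × ℝ}
    (S : SideLift P X N R ω) (h : N' ⊆ N) (hN' : IsOpen N') : SideLift P X N' R ω :=
  ⟨hN', S.isOpen_side, fun p hp => S.contDiffAt_map p (h hp),
    fun p hp => S.contDiffAt_lift p (h hp), fun p hp => S.eq p (h hp)⟩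

/-- A surface patch in the closure of a piece lifts to the parameter plane, since the closed pieces
are embedded. -/
lemma exists_sideLift {C Cs : ℝ} (hC : critC < C) (hS : RegularStar C Cs) {c : ℤ → ℝ}
    (hc : PhaseRec C c) {k : ℤ} {X : ℝ × ℝ → E4} {U R : Set (ℝ × ℝ)} (hU : IsOpen U)
    (hX : ContDiffOn ℝ 3 X U) (hR : IsOpen R) {p₀ : ℝ × ℝ} (hp₀ : p₀ ∈ U) (hp₀R : p₀ ∈ closure R)
    (hcl : ∀ p ∈ U, p ∈ closure R → X p ∈ closure (piece C k (c k))) :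
    ∃ N ω, N ⊆ U ∧ p₀ ∈ N ∧ SideLift (profile hC hS hc) X N R ω ∧
      ∀ p ∈ N, p ∈ closure R → (ω p).1 ∈ Icc (node C Cs k) (node C Cs (k + 1)) := by
  have hXp₀ := hcl p₀ hp₀ hp₀R
  rw [closure_piece_eq_Phi hC hS hc] at hXp₀
  obtain ⟨q₀, ⟨hq₀, -⟩, hq₀X⟩ := hXp₀
  have hY := profile_Y hC hS hc
  obtain ⟨π, hπ, hπY⟩ := exists_local_left_inverse
    ((profile hC hS hc).contDiff_Y.contDiffAt (x := q₀)) ((profile hC hS hc).injective_fderiv_Y q₀)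
  have hparam := eventually_exists_param hC hS hc hq₀ hπY
  have hXc : ContinuousAt X p₀ := (hX.contDiffAt (hU.mem_nhds hp₀)).continuousAt
  rw [ContinuousAt, ← hq₀X] at hXc
  rw [hY, hq₀X] at hπ
  rw [hY] at hπY
  have hπev : ∀ᶠ x in 𝓝 (Phi C Cs c q₀), ContDiffAt ℝ 3 π x := by
    rw [hq₀X]; exact hπ.eventually (by decide)
  have hev : ∀ᶠ p in 𝓝 p₀, p ∈ U ∧ ContDiffAt ℝ 3 π (X p) ∧ (X p ∈ closure (piece C k (c k)) →
      ∃ q, π (Phi C Cs c q) = q ∧ q.1 ∈ Icc (node C Cs k) (node C Cs (k + 1)) ∧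
        Phi C Cs c q = X p) := by
    filter_upwards [hU.mem_nhds hp₀, hXc hπev, hXc hparam] with p h1 h2 h3
    refine ⟨h1, h2, fun h => ?_⟩
    obtain ⟨q, hq⟩ := h3 h
    rw [hY] at hq
    exact ⟨q, hq⟩
  obtain ⟨N, hN, hNo, hpN⟩ := eventually_nhds_iff.1 hev
  have hlift : ∀ p ∈ N, p ∈ closure R → Phi C Cs c (π (X p)) = X p ∧
      (π (X p)).1 ∈ Icc (node C Cs k) (node C Cs (k + 1)) := by
    intro p hp hpR
    obtain ⟨h1, h2, h3⟩ := hN p hp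
    obtain ⟨q, h4, h5, h6⟩ := h3 (hcl p h1 hpR)
    rw [← h6, h4]
    exact ⟨rfl, h5⟩
  refine ⟨N, fun p => π (X p), fun p hp => (hN p hp).1, hpN, ⟨hNo, hR, fun p hp => ?_,
    fun p hp => ?_, fun p hp hpR => ?_⟩, fun p hp hpR => (hlift p hp hpR).2⟩
  · exact hX.contDiffAt (hU.mem_nhds (hN p hp).1)
  · exact (hN p hp).2.1.comp p (hX.contDiffAt (hU.mem_nhds (hN p hp).1))
  · rw [hY]
    exact (hlift p hp (subset_closure hpR)).1

lemma F_eq_xi_iff {C Cs : ℝ} (hC : critC < C) (hS : RegularStar C Cs) {k : ℤ} {h : ℝ}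
    (hh : h ∈ Icc (node C Cs k) (node C Cs (k + 1))) (hF : F C Cs h = xi01 C ∨ F C Cs h = xi02 C) :
    h = node C Cs k ∨ h = node C Cs (k + 1) := by
  by_contra hne
  push Not at hne
  have := F_mem_Ioo hC hS ⟨lt_of_le_of_ne hh.1 (Ne.symm hne.1), lt_of_le_of_ne hh.2 hne.2⟩
  rcases hF with h | h
  · exact this.1.ne' h
  · exact this.2.ne h

/-- An open surface patch cannot lie in the closure of a piece and meet its boundary: the height of
its lift would have a critical point there. -/
lemma mem_Ioo_of_patch {C : ℝ} (hC : critC < C) {k : ℤ} {c : ℝ} {X : ℝ × ℝ → E4} {U : Set (ℝ × ℝ)}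
    (hU : IsOpen U) (hX : ContDiffOn ℝ 3 X U) {p₀ : ℝ × ℝ} (hp₀ : p₀ ∈ U)
    (hinj : Function.Injective (fderiv ℝ X p₀)) (hcl : ∀ p ∈ U, X p ∈ closure (piece C k c))
    {ξ θ : ℝ} (hξ : ξ ∈ Icc (xi01 C) (xi02 C)) (hXp₀ : X p₀ = pieceMap C k c (ξ, θ)) :
    ξ ∈ Ioo (xi01 C) (xi02 C) := by
  have hS := regularStar_zero hC
  obtain ⟨f, hf, rfl⟩ := exists_phaseRec C k c
  obtain ⟨N, ω, hNU, hpN, S, hω⟩ := exists_sideLift hC hS hf hU hX isOpen_univ hp₀ (by simp)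
    (fun p hp _ => hcl p hp)
  have hω' : ∀ p ∈ N, (ω p).1 ∈ Icc (node C 0 k) (node C 0 (k + 1)) := fun p hp => hω p hp (by simp)
  obtain ⟨h1, h2⟩ := S.first hpN (by simp)
  rw [profile_Y hC hS hf, hXp₀, show ω p₀ = ((ω p₀).1, (ω p₀).2) from rfl,
    Phi_eq_pieceMap hC hS hf (hω' p₀ hpN)] at h1
  have hF : F C 0 (ω p₀).1 = ξ := (pieceMap_eq hC (pos_of_mem hC (F_mem hC hS _))
    (pos_of_mem hC hξ) h1).1
  by_contra hne
  have hξ' : ξ = xi01 C ∨ ξ = xi02 C := by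
    by_contra hne'
    push Not at hne'
    exact hne ⟨lt_of_le_of_ne hξ.1 (Ne.symm hne'.1), lt_of_le_of_ne hξ.2 hne'.2⟩
  rw [← hF] at hξ'
  have hextr : IsLocalExtr (fun p => (ω p).1) p₀ := by
    rcases F_eq_xi_iff hC hS (hω' p₀ hpN) hξ' with h | h
    · refine Or.inl ?_
      filter_upwards [S.isOpen.mem_nhds hpN] with p hp
      rw [h]; exact (hω' p hp).1
    · refine Or.inr ?_
      filter_upwards [S.isOpen.mem_nhds hpN] with p hp
      rw [h]; exact (hω' p hp).2
  have hd := hextr.fderiv_eq_zero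
  have hωd := (S.contDiffAt_lift p₀ hpN).differentiableAt (by norm_num)
  have hd' : ∀ x, (fderiv ℝ ω p₀ x).1 = 0 := by
    intro x
    have := (hasFDerivAt_fst.comp p₀ hωd.hasFDerivAt).fderiv
    have h3 := DFunLike.congr_fun (this.symm.trans hd) x
    simpa using h3
  have hinjω : Function.Injective (fderiv ℝ ω p₀ : ℝ × ℝ →ₗ[ℝ] ℝ × ℝ) := by
    refine (injective_iff_map_eq_zero _).2 fun x hx => ?_
    have hx' : fderiv ℝ ω p₀ x = 0 := hx
    refine hinj ?_
    rw [h2, map_zero, SideLift.ca, SideLift.cb, hx']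
    simp
  obtain ⟨x, hx⟩ := LinearMap.injective_iff_surjective.1 hinjω (1, 0)
  have := hd' x
  rw [show fderiv ℝ ω p₀ x = (1, 0) from hx] at this
  exact one_ne_zero this

lemma closure_image_isometry (A : E4 ≃ₗᵢ[ℝ] E4) (s : Set E4) : closure (A '' s) = A '' closure s :=
  (A.toHomeomorph.image_closure s).symm

/-- The local form of the rigidity of gluing, at one point of the curve of contact. -/
lemma contact_at {C C' : ℝ} {k l : ℤ} {c c' : ℝ} {A : E4 ≃ₗᵢ[ℝ] E4} {X : ℝ × ℝ → E4}
    {U : Set (ℝ × ℝ)} {s : ℝ} (hC : critC < C) (hC' : critC < C') (hU : IsOpen U)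
    (hs : ((0 : ℝ), s) ∈ U) (hX : ContDiffOn ℝ 3 X U)
    (hinj : ∀ p ∈ U, Function.Injective (fderiv ℝ X p))
    (h1 : ∀ p ∈ U, p.1 ≤ 0 → X p ∈ closure (piece C k c))
    (h2 : ∀ p ∈ U, 0 ≤ p.1 → X p ∈ closure (A '' piece C' l c')) :
    C' = C ∧ ∃ ξ θ, X (0, s) = pieceMap C k c (ξ, θ) ∧
      ((ξ ∈ Ioo (xi01 C) (xi02 C) ∧ CarriesPiece A C l c' k c) ∨
        ((ξ = xi01 C ∨ ξ = xi02 C) ∧ X (0, s) ∈ A '' bdryCircle C l c' ξ ∧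
          CarriesPiece A C l c' (k + 1) (-2 * zeta0 C ξ - c))) := by
  have hS := regularStar_zero hC
  have hS' := regularStar_zero hC'
  obtain ⟨f, hf, rfl⟩ := exists_phaseRec C k c
  obtain ⟨f', hf', rfl⟩ := exists_phaseRec C' l c'
  have hcl1 : closure {p : ℝ × ℝ | p.1 < 0} ⊆ {p | p.1 ≤ 0} :=
    closure_minimal (fun p (hp : p.1 < 0) => hp.le) (isClosed_le continuous_fst continuous_const)
  have hcl2 : closure {p : ℝ × ℝ | 0 < p.1} ⊆ {p | 0 ≤ p.1} :=
    closure_minimal (fun p (hp : 0 < p.1) => hp.le) (isClosed_le continuous_const continuous_fst)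
  obtain ⟨N, ω, hNU, hpN, S, hω⟩ := exists_sideLift hC hS hf hU hX
    (isOpen_lt continuous_fst continuous_const) hs (mem_closure_neg s)
    (fun p hp hp' => h1 p hp (hcl1 hp'))
  have hX' : ContDiffOn ℝ 3 (fun p => A.symm (X p)) U :=
    A.symm.toContinuousLinearEquiv.contDiff.comp_contDiffOn hX
  obtain ⟨N', ω', hNU', hpN', S', hω'⟩ := exists_sideLift hC' hS' hf' hU hX'
    (isOpen_lt continuous_const continuous_fst) hs (mem_closure_pos s) (k := l)
    (fun p hp hp' => by
      have := h2 p hp (hcl2 hp')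
      rw [closure_image_isometry] at this
      obtain ⟨y, hy, hyX⟩ := this
      rwa [← hyX, A.symm_apply_apply])
  have hNN := S.isOpen.inter S'.isOpen
  obtain ⟨ε₁, ε₂, H⟩ := exists_frameContact (S.mono inter_subset_left hNN)
    (S'.mono inter_subset_right hNN) (fun p hp => hinj p (hNU hp.1)) ⟨hpN, hpN'⟩
  obtain rfl : C' = C := H.const
  refine ⟨rfl, F C' 0 (ω (0, s)).1, (ω (0, s)).2, ?_⟩
  have hq := hω _ hpN (mem_closure_neg s)
  have hq' := hω' _ hpN' (mem_closure_pos s)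
  have hXp : X (0, s) = pieceMap C' k (f k) (F C' 0 (ω (0, s)).1, (ω (0, s)).2) := by
    rw [← (S.first hpN (mem_closure_neg s)).1, profile_Y hC hS hf, ← Phi_eq_pieceMap hC hS hf hq]
  refine ⟨hXp, ?_⟩
  obtain ⟨hFF, hcar⟩ := H.carriesPiece hC hS hf hf' hq hq'
  rcases hcar with hcar | ⟨he, hcar⟩
  · refine Or.inl ⟨mem_Ioo_of_patch hC hU hX hs (hinj _ hs) (fun p hp => ?_) (F_mem hC hS _) hXp,
      hcar⟩
    rcases le_total p.1 0 with h | h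
    · exact h1 p hp h
    · rw [← hcar.image_piece]; exact h2 p hp h
  · refine Or.inr ⟨he, ⟨A.symm (X (0, s)), ⟨(ω' (0, s)).2, ?_⟩, by simp⟩, hcar⟩
    have h3 := (S'.first hpN' (mem_closure_pos s)).1
    rw [profile_Y hC hS hf'] at h3
    rw [← h3, ← hFF]
    exact (Phi_eq_pieceMap hC hS hf' hq' _).symm

/-- The parity of the index and the phase mod `2π` are determined by the piece. -/
lemma CarriesPiece.phase_eq {C : ℝ} (hC : critC < C) {k l : ℤ} {c c' : ℝ}
    (h : CarriesPiece (LinearIsometryEquiv.refl ℝ E4) C l c' k c) :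
    Even (k + l) ∧ c' ≡ c [PMOD (2 * Real.pi)] := by
  obtain ⟨ε, δ, hε, h⟩ := h
  have hcs : ∀ ξ ∈ Icc (xi01 C) (xi02 C), Real.cos (zeta0 C ξ + c') = Real.cos (zeta0 C ξ + c) ∧
      (-1) ^ l * Real.sin (zeta0 C ξ + c') = (-1) ^ k * Real.sin (zeta0 C ξ + c) := by
    intro ξ hξ
    have h0 := congrFun (congrArg WithLp.ofLp (h ξ 0)) 0
    have h1 := congrFun (congrArg WithLp.ofLp (h ξ 0)) 1
    simp only [LinearIsometryEquiv.coe_refl, id, pieceMap, Matrix.cons_val] at h0 h1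
    have hr : 0 < Real.sqrt (1 - 1 / (C * ξ ^ 2)) := by
      have := one_lt_mul_sq hC hξ
      refine Real.sqrt_pos.2 (sub_pos.2 ?_)
      rw [div_lt_one (by linarith)]
      exact this
    refine ⟨mul_left_cancel₀ hr.ne' h0, mul_left_cancel₀ hr.ne' ?_⟩
    linarith
  have hm : xi00 C ∈ Ioo (xi01 C) (xi02 C) := ⟨xi01_lt_xi00 hC, xi00_lt_xi02 hC⟩
  rcases Int.even_or_odd (k + l) with hpar | hpar
  · refine ⟨hpar, ?_⟩
    have h1 : (-1 : ℝ) ^ l = (-1) ^ k := by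
      have h3 : (-1 : ℝ) ^ (k + l) = 1 := hpar.neg_one_zpow
      rw [zpow_add₀ (by norm_num)] at h3
      exact mul_left_cancel₀ (zpow_ne_zero k (by norm_num)) (h3.trans (neg_one_zpow_sq k).symm)
    obtain ⟨h2, h3⟩ := hcs _ (Ioo_subset_Icc_self hm)
    rw [h1] at h3
    have h4 := Real.Angle.cos_sin_inj h2 (mul_left_cancel₀ (zpow_ne_zero k (by norm_num)) h3)
    obtain ⟨n, hn⟩ := Real.Angle.angle_eq_iff_two_pi_dvd_sub.1 h4
    refine (AddCommGroup.modEq_iff_zsmul.2 ⟨n, ?_⟩).symm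
    rw [zsmul_eq_mul]
    linarith
  · exfalso
    have h1 : (-1 : ℝ) ^ l = -(-1) ^ k := by
      have h3 : (-1 : ℝ) ^ (k + l) = -1 := hpar.neg_one_zpow
      rw [zpow_add₀ (by norm_num)] at h3
      refine mul_left_cancel₀ (zpow_ne_zero k (by norm_num)) (h3.trans ?_)
      rw [mul_neg, neg_one_zpow_sq]
    -- otherwise `2 ζ₀ + c + c'` is a multiple of `2π` all along the interval
    have hmul : ∀ ξ ∈ Icc (xi01 C) (xi02 C), ∃ n : ℤ, 2 * zeta0 C ξ + c + c' = 2 * Real.pi * n := by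
      intro ξ hξ
      obtain ⟨h2, h3⟩ := hcs ξ hξ
      rw [h1] at h3
      have h3' : Real.sin (zeta0 C ξ + c') = Real.sin (-(zeta0 C ξ + c)) := by
        rw [Real.sin_neg]
        refine mul_left_cancel₀ (zpow_ne_zero k (by norm_num : (-1 : ℝ) ≠ 0)) ?_
        linarith
      rw [← Real.cos_neg (zeta0 C ξ + c)] at h2
      obtain ⟨n, hn⟩ := Real.Angle.angle_eq_iff_two_pi_dvd_sub.1 (Real.Angle.cos_sin_inj h2 h3')
      exact ⟨n, by linarith⟩
    have hcont := (hasDerivAt_zeta0 hC hm).continuousAt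
    have hev : ∀ᶠ ξ in 𝓝[>] (xi00 C), zeta0 C ξ < zeta0 C (xi00 C) + Real.pi ∧ ξ < xi02 C ∧
        xi00 C < ξ := by
      filter_upwards [nhdsWithin_le_nhds (hcont.eventually (gt_mem_nhds
        (lt_add_of_pos_right (zeta0 C (xi00 C)) Real.pi_pos))),
        nhdsWithin_le_nhds (gt_mem_nhds hm.2), self_mem_nhdsWithin] with x h1 h2 h3
      exact ⟨h1, h2, h3⟩
    obtain ⟨ξ, e1, e2, e3⟩ := hev.exists
    have hξ : ξ ∈ Icc (xi01 C) (xi02 C) := ⟨(hm.1.trans e3).le, e2.le⟩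
    have hlt := strictMonoOn_zeta0 hC (Ioo_subset_Icc_self hm) hξ e3
    obtain ⟨n, hn⟩ := hmul _ hξ
    obtain ⟨m, hm'⟩ := hmul _ (Ioo_subset_Icc_self hm)
    have hpi := Real.pi_pos
    have h5 : (m : ℝ) < n := by
      have : 2 * Real.pi * m < 2 * Real.pi * n := by linarith
      exact lt_of_mul_lt_mul_left this (by positivity)
    have h6 : (n : ℝ) < m + 1 := by
      have : 2 * Real.pi * n < 2 * Real.pi * (m + 1) := by linarith
      exact lt_of_mul_lt_mul_left this (by positivity)
    have h7 : m < n := by exact_mod_cast h5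
    have h8 : n < m + 1 := by exact_mod_cast h6
    lia

/-- The same isometry cannot carry a piece both to `S` and to a continuation of `S`. -/
lemma CarriesPiece.not_both {C : ℝ} (hC : critC < C) {A : E4 ≃ₗᵢ[ℝ] E4} {k l : ℤ} {c c' d : ℝ}
    (h : CarriesPiece A C l c' k c) (h' : CarriesPiece A C l c' (k + 1) d) : False := by
  have := h.symm.trans h'
  rw [LinearIsometryEquiv.symm_trans_self] at this
  obtain ⟨m, hm⟩ := (this.phase_eq hC).1
  lia

/-- Rigidity of gluing when the second piece is moved by an isometry of the sphere. -/
lemma GluedAlong.carriesPiece {C C' : ℝ} {k l : ℤ} {c c' : ℝ} {A : E4 ≃ₗᵢ[ℝ] E4} {γ : ℝ → E4}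
    {a b : ℝ} (hC : critC < C) (hC' : critC < C') (hab : a < b)
    (h : GluedAlong (piece C k c) (A '' piece C' l c') γ a b) :
    C = C' ∧ ((CarriesPiece A C l c' k c ∧ γ '' Ioo a b ⊆ piece C k c) ∨
      ∃ e, (e = xi01 C ∨ e = xi02 C) ∧
        γ '' Ioo a b ⊆ bdryCircle C k c e ∩ A '' bdryCircle C' l c' e ∧
        CarriesPiece A C l c' (k + 1) (-2 * zeta0 C e - c)) := by
  obtain ⟨U, X, hU, hUab, hX, hinj, hγ, hneg, hpos⟩ := h
  have hmem : ∀ s ∈ Ioo a b, ((0 : ℝ), s) ∈ U := fun s hs => hUab ⟨rfl, hs⟩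
  have key := fun s hs => contact_at hC hC' hU (hmem s hs) hX hinj hneg hpos
  obtain ⟨m, hm⟩ := exists_between hab
  obtain rfl : C' = C := (key m hm).1
  refine ⟨rfl, ?_⟩
  obtain ⟨-, ξ, θ, hXm, hcase⟩ := key m hm
  rcases hcase with ⟨hξ, hcar⟩ | ⟨hξ, hXA, hcar⟩
  · refine Or.inl ⟨hcar, ?_⟩
    rintro _ ⟨s, hs, rfl⟩
    obtain ⟨-, ξ', θ', hXs, hcase'⟩ := key s hs
    rw [← hγ s hs, hXs]
    rcases hcase' with ⟨hξ', -⟩ | ⟨-, -, hcar'⟩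
    · exact ⟨_, ⟨hξ', mem_univ _⟩, rfl⟩
    · exact (hcar.not_both hC hcar').elim
  · refine Or.inr ⟨ξ, hξ, ?_, hcar⟩
    have hII : ∀ s ∈ Ioo a b, ∃ ξ' θ', X (0, s) = pieceMap C' k c (ξ', θ') ∧
        (ξ' = xi01 C' ∨ ξ' = xi02 C') ∧ X (0, s) ∈ A '' bdryCircle C' l c' ξ' := by
      intro s hs
      obtain ⟨-, ξ', θ', hXs, ⟨-, hcar'⟩ | ⟨h1, h2, -⟩⟩ := key s hs
      · exact (hcar'.not_both hC hcar).elim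
      · exact ⟨ξ', θ', hXs, h1, h2⟩
    -- the radius of the parallel circle is continuous along the curve and takes two values
    have hcont : ContinuousOn (fun s : ℝ => X (0, s) 2 ^ 2 + X (0, s) 3 ^ 2) (Ioo a b) := by
      have h1 : ContinuousOn (fun s : ℝ => X (0, s)) (Ioo a b) :=
        hX.continuousOn.comp (by fun_prop) hmem
      have h2 : Continuous fun x : E4 => x 2 ^ 2 + x 3 ^ 2 := by fun_prop
      exact h2.comp_continuousOn h1
    have hmaps : MapsTo (fun s : ℝ => X (0, s) 2 ^ 2 + X (0, s) 3 ^ 2) (Ioo a b)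
        {rhoX C' (xi01 C') ^ 2, rhoX C' (xi02 C') ^ 2} := by
      intro s hs
      obtain ⟨ξ', θ', hXs, h1 | h1, -⟩ := hII s hs
      · left; dsimp only; rw [hXs, norm_sq_tail, h1]
      · right; dsimp only; rw [hXs, norm_sq_tail, h1]; rfl
    have hpos' : ∀ x, (x = xi01 C' ∨ x = xi02 C') → 0 < x := by
      have := (xi01_lt_xi02 hC).le
      rintro x (rfl | rfl)
      · exact pos_of_mem hC (left_mem_Icc.2 this)
      · exact pos_of_mem hC (right_mem_Icc.2 this)
    rintro _ ⟨s, hs, rfl⟩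
    obtain ⟨ξ', θ', hXs, h1, h2⟩ := hII s hs
    have hconst := isPreconnected_Ioo.constant_of_mapsTo (toFinite _).isDiscrete hcont hmaps hs hm
    dsimp only at hconst
    rw [hXs, hXm, norm_sq_tail, norm_sq_tail] at hconst
    obtain rfl := rhoX_injOn hC (hpos' _ h1) (hpos' _ hξ) hconst
    rw [← hγ s hs]
    exact ⟨⟨θ', hXs.symm⟩, h2⟩


/-! ### Lifts through immersions -/

/-- A continuous lift of an immersion through an immersion is a local diffeomorphism of class
`C³`. -/
lemma lift_of_immersions {Y Ψ : ℝ × ℝ → E4} {Ω : ℝ × ℝ → ℝ × ℝ} {p : ℝ × ℝ}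
    (hY : ContDiffAt ℝ 3 Y (Ω p)) (hYi : Function.Injective (fderiv ℝ Y (Ω p)))
    (hΨ : ContDiffAt ℝ 3 Ψ p) (hΨi : Function.Injective (fderiv ℝ Ψ p)) (hΩ : ContinuousAt Ω p)
    (h : ∀ᶠ x in 𝓝 p, Y (Ω x) = Ψ x) : ContDiffAt ℝ 3 Ω p ∧ map Ω (𝓝 p) = 𝓝 (Ω p) := by
  obtain ⟨π, hπ, hπY⟩ := exists_local_left_inverse hY hYi
  have hsm : ContDiffAt ℝ 3 Ω p := by
    rw [h.self_of_nhds] at hπ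
    refine (hπ.comp p hΨ).congr_of_eventuallyEq ?_
    filter_upwards [h, hΩ hπY] with x hx hx'
    rw [Function.comp_apply, ← hx]
    exact (hx' : π (Y (Ω x)) = Ω x).symm
  refine ⟨hsm, ?_⟩
  have hs := hsm.hasStrictFDerivAt (by norm_num)
  refine hs.map_nhds_eq_of_surj (LinearMap.range_eq_top.2 ?_)
  refine LinearMap.injective_iff_surjective.1 ((injective_iff_map_eq_zero _).2 fun x hx => hΨi ?_)
  have h1 := (hY.differentiableAt (by norm_num)).hasFDerivAt.comp p hs.hasFDerivAt
  have h2 : fderiv ℝ Ψ p = _ := (h1.congr_of_eventuallyEq (EventuallyEq.symm h)).fderiv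
  have hx' : fderiv ℝ Ω p x = 0 := hx
  rw [h2, ContinuousLinearMap.comp_apply, hx']
  simp

lemma tendsto_of_leftInverse {Ω g : ℝ × ℝ → ℝ × ℝ} {p : ℝ × ℝ} (h : map Ω (𝓝 p) = 𝓝 (Ω p))
    (hg : ∀ᶠ x in 𝓝 p, g (Ω x) = x) : Tendsto g (𝓝 (Ω p)) (𝓝 p) := by
  rw [← h, tendsto_map'_iff]
  exact tendsto_id.congr' (EventuallyEq.symm hg)

lemma isDiscrete_range_intCast : IsDiscrete (range ((↑) : ℤ → ℝ)) :=
  Int.isClosedEmbedding_coe_real.isEmbedding.isDiscrete_range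

/-- A map into the union of pieces with constant `C` lifts to the parameter plane: the angle of
rotation is a continuous logarithm of the last two coordinates. -/
lemma exists_param_lift {C : ℝ} (hC : critC < C) {f : ℝ × ℝ → E4} (hf : Continuous f)
    (h : ∀ p, ∃ (k : ℤ) (c ξ θ : ℝ), ξ ∈ Icc (xi01 C) (xi02 C) ∧ f p = pieceMap C k c (ξ, θ)) :
    ∃ G : ℝ × ℝ → ℝ × ℝ, Continuous G ∧ ∀ p (k : ℤ) (c ξ θ : ℝ), ξ ∈ Icc (xi01 C) (xi02 C) →
      f p = pieceMap C k c (ξ, θ) → (G p).1 = ξ ∧ f p = pieceMap C k c (G p) := by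
  have hs := Real.sqrt_pos.2 (C_pos hC)
  have hU : IsSimplyConnected (univ : Set (ℝ × ℝ)) := by
    have : ContractibleSpace (univ : Set (ℝ × ℝ)) := convex_univ.contractibleSpace univ_nonempty
    exact SimplyConnectedSpace.ofContractible _
  set g : ℝ × ℝ → ℂ := fun p => ⟨f p 2, f p 3⟩ with hg
  have hgc : Continuous g := by
    have : g = fun p => ((f p 2 : ℝ) : ℂ) + (f p 3 : ℝ) * Complex.I := by
      ext p
      exact Complex.mk_eq_add_mul_I _ _
    rw [this]
    have h2 : Continuous fun p => f p 2 := (PiLp.continuous_apply 2 _ 2).comp hf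
    have h3 : Continuous fun p => f p 3 := (PiLp.continuous_apply 2 _ 3).comp hf
    fun_prop
  have hg0 : ∀ p, g p ≠ 0 := by
    intro p hp
    obtain ⟨k, c, ξ, θ, hξ, hfp⟩ := h p
    have h1 := norm_sq_tail (C := C) k c (ξ, θ)
    rw [← hfp] at h1
    have h2 : f p 2 = 0 := congrArg Complex.re hp
    have h3 : f p 3 = 0 := congrArg Complex.im hp
    rw [h2, h3] at h1
    have := pow_pos (rhoX_pos hC (pos_of_mem hC hξ)) 2
    simp only at h1
    linarith
  obtain ⟨L, hL, hLg⟩ := Complex.exists_continuousOn_eqOn_exp_comp hU isOpen_univ hgc.continuousOn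
    (by rintro ⟨p, -, hp⟩; exact hg0 p hp)
  have hLc : Continuous L := continuousOn_univ.1 hL
  have hexp : ∀ p, Complex.exp (L p) = g p := fun p => hLg (mem_univ p)
  have hre : ∀ p, Real.exp (L p).re * Real.cos (L p).im = f p 2 := fun p => by
    rw [← Complex.exp_re, hexp]
  have him : ∀ p, Real.exp (L p).re * Real.sin (L p).im = f p 3 := fun p => by
    rw [← Complex.exp_im, hexp]
  refine ⟨fun p => (1 / (Real.sqrt C * Real.exp (L p).re), (L p).im / Real.sqrt C), ?_, ?_⟩
  · have : Continuous fun p => 1 / (Real.sqrt C * Real.exp (L p).re) := by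
      refine continuous_const.div (by fun_prop) fun p => by positivity
    fun_prop
  · intro p k c ξ θ hξ hfp
    have hp := pos_of_mem hC hξ
    have h1 := norm_sq_tail (C := C) k c (ξ, θ)
    rw [← hfp, ← hre, ← him] at h1
    have h2 : Real.exp (L p).re ^ 2 = rhoX C ξ ^ 2 := by
      rw [← h1]
      linear_combination (-Real.exp (L p).re ^ 2) * Real.sin_sq_add_cos_sq (L p).im
    have h3 := (sq_eq_sq₀ (Real.exp_pos _).le (rhoX_pos hC hp).le).1 h2
    have h4 : 1 / (Real.sqrt C * Real.exp (L p).re) = ξ := by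
      rw [h3]; unfold rhoX; field_simp
    refine ⟨h4, ?_⟩
    have hr := hre p
    have hi := him p
    rw [h3] at hr hi
    rw [hfp] at hr hi ⊢
    ext i
    fin_cases i
    · simp [pieceMap, h4]
    · simp [pieceMap, h4]
    · change _ = Real.cos (Real.sqrt C * ((L p).im / Real.sqrt C)) /
        (Real.sqrt C * (1 / (Real.sqrt C * Real.exp (L p).re)))
      rw [h4, mul_div_cancel₀ _ hs.ne', div_eq_mul_one_div, mul_comm]
      exact hr.symm
    · change _ = Real.sin (Real.sqrt C * ((L p).im / Real.sqrt C)) /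
        (Real.sqrt C * (1 / (Real.sqrt C * Real.exp (L p).re)))
      rw [h4, mul_div_cancel₀ _ hs.ne', div_eq_mul_one_div, mul_comm]
      exact hi.symm

/-- Two continuous lifts over a connected set differ by a multiple of the period. -/
lemma bijOn_of_lift {C : ℝ} (hC : critC < C) {V : Set (ℝ × ℝ)} (hV : IsPreconnected V)
    {ω G : ℝ × ℝ → ℝ × ℝ} (hω : ContinuousOn ω V) (hbij : BijOn ω V (D C)) (hG : ContinuousOn G V)
    {k : ℤ} {c : ℝ} (hpos : ∀ p ∈ V, 0 < (G p).1)
    (h : ∀ p ∈ V, pieceMap C k c (ω p) = pieceMap C k c (G p)) : BijOn G V (D C) := by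
  have hs := Real.sqrt_pos.2 (C_pos hC)
  set T := 2 * Real.pi / Real.sqrt C with hT
  have hT0 : 0 < T := by positivity
  have hn : ∀ p ∈ V, (G p).1 = (ω p).1 ∧ ∃ n : ℤ, (n : ℝ) = ((G p).2 - (ω p).2) / T := by
    intro p hp
    obtain ⟨h1, n, h2⟩ := pieceMap_eq hC (pos_of_mem hC (Ioo_subset_Icc_self (hbij.mapsTo hp).1))
      (hpos p hp) (h p hp)
    refine ⟨h1.symm, -n, ?_⟩
    rw [h2, ← hT, sub_add_cancel_left, neg_div, mul_div_cancel_right₀ _ hT0.ne']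
    push_cast
    rfl
  have hc : ContinuousOn (fun p => ((G p).2 - (ω p).2) / T) V := by fun_prop
  have hmaps : MapsTo (fun p => ((G p).2 - (ω p).2) / T) V (range ((↑) : ℤ → ℝ)) :=
    fun p hp => (hn p hp).2
  have hshift : ∃ d : ℝ, EqOn (fun p => ((ω p).1, (ω p).2 + d)) G V := by
    rcases V.eq_empty_or_nonempty with rfl | ⟨p₀, hp₀⟩
    · exact ⟨0, fun p hp => hp.elim⟩
    refine ⟨(G p₀).2 - (ω p₀).2, fun p hp => ?_⟩
    have := hV.constant_of_mapsTo isDiscrete_range_intCast hc hmaps hp hp₀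
    rw [div_left_inj' hT0.ne'] at this
    ext
    · exact (hn p hp).1.symm
    · dsimp only; linarith
  obtain ⟨d, hd⟩ := hshift
  refine BijOn.congr ?_ hd
  refine BijOn.comp (t := D C) (g := fun q : ℝ × ℝ => (q.1, q.2 + d)) ⟨?_, ?_, ?_⟩ hbij
  · rintro q ⟨hq, -⟩
    exact ⟨hq, mem_univ _⟩
  · rintro q - q' - hqq
    simp only [Prod.mk.injEq, add_left_inj] at hqq
    exact Prod.ext hqq.1 hqq.2
  · rintro q ⟨hq, -⟩
    exact ⟨(q.1, q.2 - d), ⟨hq, mem_univ _⟩, by simp⟩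

/-! ### Curves in the induced metric -/

lemma surfDist_le {Ψ : ℝ × ℝ → E4} {σ : ℝ → ℝ × ℝ} (hσ : ContDiff ℝ 1 σ) {M : ℝ}
    (hM : ∀ u, ‖fderiv ℝ Ψ (σ u) (deriv σ u)‖ ≤ M) : surfDist Ψ (σ 0) (σ 1) ≤ M := by
  have h1 : curveLength Ψ σ ≤ M := by
    have := intervalIntegral.norm_integral_le_of_norm_le_const (a := 0) (b := 1) (C := M)
      (f := fun u => ‖fderiv ℝ Ψ (σ u) (deriv σ u)‖) fun u _ => by rw [norm_norm]; exact hM u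
    simp only [sub_zero, abs_one, mul_one] at this
    exact (le_abs_self _).trans this
  refine le_trans (csInf_le (a := curveLength Ψ σ) ⟨0, ?_⟩ ⟨σ, hσ, rfl, rfl, rfl⟩) h1
  rintro _ ⟨σ', -, -, -, rfl⟩
  exact intervalIntegral.integral_nonneg zero_le_one fun u _ => norm_nonneg _


/-! ### The strips of a glued surface -/

/-- A continuous parametrization `G` of the closed strip `[a, b] × ℝ` of the surface `Ψ` by the
piece with isometry `A`, which is a bijection of the open strip onto the open domain of the
piece. -/
structure StripParam (Ψ : ℝ × ℝ → E4) (A : E4 ≃ₗᵢ[ℝ] E4) (C : ℝ) (k : ℤ) (c a b : ℝ)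
    (G : ℝ × ℝ → ℝ × ℝ) : Prop where
  continuousOn : ContinuousOn G (Icc a b ×ˢ univ)
  bijOn : BijOn G (Ioo a b ×ˢ univ) (D C)
  eq : ∀ p ∈ Icc a b ×ˢ (univ : Set ℝ), Ψ p = A (pieceMap C k c (G p))

lemma closure_strip {a b : ℝ} (hab : a < b) :
    closure (Ioo a b ×ˢ (univ : Set ℝ)) = Icc a b ×ˢ univ := by
  rw [closure_prod_eq, closure_Ioo hab.ne, closure_univ]

/-- A reparametrization of a piece on an open strip extends to the closed strip, up to a change of
the angle by a period. -/
lemma exists_stripParam {Ψ : ℝ × ℝ → E4} {A : E4 ≃ₗᵢ[ℝ] E4} {C : ℝ} {k : ℤ} {c a b : ℝ}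
    (hC : critC < C) (hab : a < b) (hΨ : Continuous Ψ) {ω : ℝ × ℝ → ℝ × ℝ}
    (hω : ContinuousOn ω (Ioo a b ×ˢ univ)) (hbij : BijOn ω (Ioo a b ×ˢ univ) (D C))
    (h : ∀ p ∈ Ioo a b ×ˢ (univ : Set ℝ), Ψ p = A (pieceMap C k c (ω p))) :
    ∃ G, StripParam Ψ A C k c a b G := by
  set f : ℝ × ℝ → E4 := fun p => A.symm (Ψ p) with hf
  have hfc : Continuous f := A.symm.continuous.comp hΨ
  have hfcl : ∀ p ∈ Icc a b ×ˢ (univ : Set ℝ), f p ∈ closure (piece C k c) := by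
    rw [← closure_strip hab]
    refine MapsTo.closure (fun p hp => ?_) hfc
    exact ⟨ω p, hbij.mapsTo hp, by simp [hf, h p hp]⟩
  have hfm : ∀ p ∈ Icc a b ×ˢ (univ : Set ℝ), ∃ ξ θ, ξ ∈ Icc (xi01 C) (xi02 C) ∧
      f p = pieceMap C k c (ξ, θ) := by
    intro p hp
    have := hfcl p hp
    rw [closure_piece hC] at this
    obtain ⟨⟨ξ, θ⟩, ⟨h1, -⟩, h2⟩ := this
    exact ⟨ξ, θ, h1, h2.symm⟩
  -- retract the plane to the closed strip
  set ret : ℝ × ℝ → ℝ × ℝ := fun p => (max a (min b p.1), p.2) with hret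
  have hretc : Continuous ret := by fun_prop
  have hretm : ∀ p, ret p ∈ Icc a b ×ˢ (univ : Set ℝ) := fun p =>
    ⟨⟨le_max_left _ _, max_le hab.le (min_le_left _ _)⟩, mem_univ _⟩
  have hrete : ∀ p ∈ Icc a b ×ˢ (univ : Set ℝ), ret p = p := by
    rintro ⟨x, y⟩ ⟨hx, -⟩
    simp only [hret]
    rw [min_eq_right hx.2, max_eq_right hx.1]
  obtain ⟨G, hG, hGe⟩ := exists_param_lift hC (hfc.comp hretc) (fun p => by
    obtain ⟨ξ, θ, h1, h2⟩ := hfm _ (hretm p)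
    exact ⟨k, c, ξ, θ, h1, h2⟩)
  have key : ∀ p ∈ Icc a b ×ˢ (univ : Set ℝ), (G p).1 ∈ Icc (xi01 C) (xi02 C) ∧
      f p = pieceMap C k c (G p) := by
    intro p hp
    obtain ⟨ξ, θ, h1, h2⟩ := hfm p hp
    obtain ⟨h3, h4⟩ := hGe p k c ξ θ h1 (by simpa [hrete p hp] using h2)
    rw [Function.comp_apply, hrete p hp] at h4
    exact ⟨h3 ▸ h1, h4⟩
  have hsub : Ioo a b ×ˢ (univ : Set ℝ) ⊆ Icc a b ×ˢ univ := prod_mono Ioo_subset_Icc_self le_rfl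
  refine ⟨G, hG.continuousOn, bijOn_of_lift hC ?_ hω hbij hG.continuousOn (k := k) (c := c)
    (fun p hp => pos_of_mem hC (key p (hsub hp)).1) (fun p hp => ?_), fun p hp => ?_⟩
  · exact (isPreconnected_Ioo).prod isPreconnected_univ
  · rw [← (key p (hsub hp)).2]
    simp [hf, h p hp]
  · rw [← (key p hp).2]
    simp [hf]

namespace StripParam
variable {Ψ : ℝ × ℝ → E4} {A : E4 ≃ₗᵢ[ℝ] E4} {C : ℝ} {k : ℤ} {f : ℤ → ℝ} {c a b : ℝ}
  {G : ℝ × ℝ → ℝ × ℝ}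

lemma mem (hC : critC < C) (hab : a < b) (S : StripParam Ψ A C k c a b G) {p : ℝ × ℝ}
    (hp : p ∈ Icc a b ×ˢ (univ : Set ℝ)) : (G p).1 ∈ Icc (xi01 C) (xi02 C) := by
  have h1 := S.bijOn.mapsTo.closure_of_continuousOn (by rw [closure_strip hab]; exact S.continuousOn)
  rw [closure_strip hab] at h1
  have h2 := h1 hp
  unfold D at h2
  rw [closure_strip (xi01_lt_xi02 hC)] at h2
  exact h2.1

/-- The parametrization of a strip in terms of the arc length of the meridians. -/
noncomputable def height (C : ℝ) (k : ℤ) (G : ℝ × ℝ → ℝ × ℝ) (p : ℝ × ℝ) : ℝ × ℝ :=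
  (hk C 0 k (G p).1, (G p).2)

section
variable (hC : critC < C) (hf : PhaseRec C f) (hab : a < b) (S : StripParam Ψ A C k (f k) a b G)
include hC hab S

lemma continuousOn_height : ContinuousOn (height C k G) (Icc a b ×ˢ univ) := by
  have h1 := (continuousOn_hk hC (regularStar_zero hC) k).comp
    (continuous_fst.comp_continuousOn S.continuousOn) fun p hp => S.mem hC hab hp
  exact h1.prodMk (continuous_snd.comp_continuousOn S.continuousOn)

omit hab in
lemma bijOn_height : BijOn (height C k G) (Ioo a b ×ˢ univ)
    (Ioo (node C 0 k) (node C 0 (k + 1)) ×ˢ univ) := by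
  have hS := regularStar_zero hC
  refine BijOn.comp (t := D C) (g := fun q : ℝ × ℝ => (hk C 0 k q.1, q.2)) ⟨?_, ?_, ?_⟩ S.bijOn
  · rintro q ⟨hq, -⟩
    exact ⟨hk_mem_Ioo hC hS k hq, mem_univ _⟩
  · rintro q ⟨hq, -⟩ q' ⟨hq', -⟩ hqq
    simp only [Prod.mk.injEq] at hqq
    exact Prod.ext (injOn_hk hC hS k (Ioo_subset_Icc_self hq) (Ioo_subset_Icc_self hq') hqq.1)
      hqq.2
  · rintro q ⟨hq, -⟩
    exact ⟨(F C 0 q.1, q.2), ⟨F_mem_Ioo hC hS hq, mem_univ _⟩,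
      by simp [hk_F hC hS (Ioo_subset_Icc_self hq)]⟩

include hf in
lemma Phi_height {p : ℝ × ℝ} (hp : p ∈ Icc a b ×ˢ (univ : Set ℝ)) :
    A (Phi C 0 f (height C k G p)) = Ψ p := by
  have hS := regularStar_zero hC
  have h1 := S.mem hC hab hp
  rw [S.eq p hp, height, Phi_eq_pieceMap hC hS hf (hk_mem_Icc hC hS k h1), F_hk hC hS k h1]

end

lemma isOpen_strip (a b : ℝ) : IsOpen (Ioo a b ×ˢ (univ : Set ℝ)) := isOpen_Ioo.prod isOpen_univ

lemma strip_mem_nhds {a b : ℝ} {p : ℝ × ℝ} (hp : p ∈ Ioo a b ×ˢ (univ : Set ℝ)) :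
    Icc a b ×ˢ (univ : Set ℝ) ∈ 𝓝 p :=
  mem_of_superset ((isOpen_strip a b).mem_nhds hp) (prod_mono Ioo_subset_Icc_self le_rfl)

/-- The moved surface `A ∘ Φ` is an immersion of class `C³`. -/
lemma _root_.BiconsSphere.isometry_comp_Phi {Cs : ℝ} (hC : critC < C) (hS : RegularStar C Cs)
    (hf : PhaseRec C f) (A : E4 ≃ₗᵢ[ℝ] E4) :
    ContDiff ℝ 3 (fun q => A (Phi C Cs f q)) ∧
    (∀ q x, fderiv ℝ (fun q => A (Phi C Cs f q)) q x = A (fderiv ℝ (profile hC hS hf).Y q x)) ∧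
    ∀ q, Function.Injective (fderiv ℝ (fun q => A (Phi C Cs f q)) q) := by
  have hY := profile_Y hC hS hf
  have hd : ∀ q x, fderiv ℝ (fun q => A (Phi C Cs f q)) q x =
      A (fderiv ℝ (profile hC hS hf).Y q x) := by
    intro q x
    have h1 := ((profile hC hS hf).hasFDerivAt_Y q).differentiableAt.hasFDerivAt
    have h2 : HasFDerivAt (fun q => A (Phi C Cs f q)) ((A.toContinuousLinearEquiv : E4 →L[ℝ] E4) ∘L
        fderiv ℝ (profile hC hS hf).Y q) q := by
      rw [← hY]
      exact (A.toContinuousLinearEquiv : E4 →L[ℝ] E4).hasFDerivAt.comp q h1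
    rw [h2.fderiv]; rfl
  refine ⟨?_, hd, fun q x y hxy => ?_⟩
  · rw [← hY]
    exact A.toContinuousLinearEquiv.contDiff.comp (profile hC hS hf).contDiff_Y
  · rw [hd, hd] at hxy
    exact (profile hC hS hf).injective_fderiv_Y q (A.injective hxy)

section
variable (hC : critC < C) (hf : PhaseRec C f) (hab : a < b) (S : StripParam Ψ A C k (f k) a b G)
  (hΨ : ContDiff ℝ 3 Ψ) (hi : ∀ p, Function.Injective (fderiv ℝ Ψ p))
include hC hf hab S hΨ hi

lemma map_nhds_height {p : ℝ × ℝ} (hp : p ∈ Ioo a b ×ˢ (univ : Set ℝ)) :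
    map (height C k G) (𝓝 p) = 𝓝 (height C k G p) := by
  obtain ⟨h1, -, h3⟩ := isometry_comp_Phi hC (regularStar_zero hC) hf A
  refine (lift_of_immersions h1.contDiffAt (h3 _) hΨ.contDiffAt (hi p)
    ((S.continuousOn_height hC hab).continuousAt (strip_mem_nhds hp)) ?_).2
  filter_upwards [strip_mem_nhds hp] with x hx
  exact S.Phi_height hC hf hab hx

/-- Points of the boundary of a strip are mapped to the boundary of the piece. -/
lemma mem_strip_of_mem_D {p : ℝ × ℝ} (hp : p ∈ Icc a b ×ˢ (univ : Set ℝ)) (hpD : G p ∈ D C) :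
    p ∈ Ioo a b ×ˢ (univ : Set ℝ) := by
  obtain ⟨p', hp', hpp⟩ := S.bijOn.surjOn hpD
  by_contra hnot
  have hne : p' ≠ p := fun h => hnot (h ▸ hp')
  obtain ⟨V, W, hV, hW, hpV, hpW, hVW⟩ := t2_separation hne
  have hH : height C k G p' = height C k G p := by unfold height; rw [hpp]
  have himg : height C k G '' (V ∩ Ioo a b ×ˢ univ) ∈ 𝓝 (height C k G p) := by
    rw [← hH, ← S.map_nhds_height hC hf hab hΨ hi hp']
    exact image_mem_map (inter_mem (hV.mem_nhds hpV) ((isOpen_strip a b).mem_nhds hp'))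
  have hev := (S.continuousOn_height hC hab p hp).eventually himg
  have hcl : p ∈ closure (Ioo a b ×ˢ (univ : Set ℝ)) := by rw [closure_strip hab]; exact hp
  have hneb : (𝓝[Ioo a b ×ˢ univ] p).NeBot := mem_closure_iff_nhdsWithin_neBot.1 hcl
  have hev' := hev.filter_mono (nhdsWithin_mono p (prod_mono Ioo_subset_Icc_self le_rfl :
    Ioo a b ×ˢ (univ : Set ℝ) ⊆ _))
  obtain ⟨x, ⟨⟨y, ⟨hyV, hy⟩, hyx⟩, hxW⟩, hx⟩ := ((hev'.and (nhdsWithin_le_nhds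
    (hW.mem_nhds hpW))).and self_mem_nhdsWithin).exists
  have := (S.bijOn_height hC).injOn hy hx hyx
  exact hVW.le_bot ⟨hyV, this ▸ hxW⟩

lemma eq_xi_of_not_mem {p : ℝ × ℝ} (hp : p ∈ Icc a b ×ˢ (univ : Set ℝ))
    (hp' : p ∉ Ioo a b ×ˢ (univ : Set ℝ)) : (G p).1 = xi01 C ∨ (G p).1 = xi02 C := by
  by_contra hne
  push Not at hne
  have h1 := S.mem hC hab hp
  exact hp' (S.mem_strip_of_mem_D hC hf hab hΨ hi hp
    ⟨⟨lt_of_le_of_ne h1.1 (Ne.symm hne.1), lt_of_le_of_ne h1.2 hne.2⟩, mem_univ _⟩)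

/-- The inverse of the parametrization of an open strip, in terms of arc length. -/
lemma exists_inverse : ∃ g : ℝ × ℝ → ℝ × ℝ, ∀ q ∈ Ioo (node C 0 k) (node C 0 (k + 1)) ×ˢ (univ : Set ℝ),
    g q ∈ Ioo a b ×ˢ (univ : Set ℝ) ∧ height C k G (g q) = q ∧ ContDiffAt ℝ 3 g q := by
  have hbij := S.bijOn_height hC
  set g := Function.invFunOn (height C k G) (Ioo a b ×ˢ univ) with hg
  obtain ⟨h1, -, h3⟩ := isometry_comp_Phi hC (regularStar_zero hC) hf A
  have hmem : ∀ q ∈ Ioo (node C 0 k) (node C 0 (k + 1)) ×ˢ (univ : Set ℝ),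
      g q ∈ Ioo a b ×ˢ (univ : Set ℝ) ∧ height C k G (g q) = q := fun q hq =>
    ⟨Function.invFunOn_mem (hbij.surjOn hq), Function.invFunOn_eq (hbij.surjOn hq)⟩
  refine ⟨g, fun q hq => ⟨(hmem q hq).1, (hmem q hq).2, ?_⟩⟩
  refine (lift_of_immersions (Y := Ψ) hΨ.contDiffAt (hi _) (h1.contDiffAt (x := q)) (h3 _) ?_ ?_).1
  · have h4 := S.map_nhds_height hC hf hab hΨ hi (hmem q hq).1
    have h5 := tendsto_of_leftInverse h4 (g := g) (by
      filter_upwards [(isOpen_strip a b).mem_nhds (hmem q hq).1] with x hx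
      have hx' := hmem _ (hbij.mapsTo hx)
      exact hbij.injOn hx'.1 hx hx'.2)
    rwa [(hmem q hq).2] at h5
  · filter_upwards [(isOpen_strip _ _).mem_nhds hq] with x hx
    rw [← S.Phi_height hC hf hab ⟨Ioo_subset_Icc_self (hmem x hx).1.1, mem_univ _⟩, (hmem x hx).2]

omit hi in
/-- A meridian of the piece has at most twice its arc length as length in the induced metric. -/
lemma surfDist_le_meridian {g : ℝ × ℝ → ℝ × ℝ}
    (hg : ∀ q ∈ Ioo (node C 0 k) (node C 0 (k + 1)) ×ˢ (univ : Set ℝ),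
      g q ∈ Ioo a b ×ˢ (univ : Set ℝ) ∧ height C k G (g q) = q ∧ ContDiffAt ℝ 3 g q)
    {s s' θ : ℝ} (hs : s ∈ Ioo (node C 0 k) (node C 0 (k + 1)))
    (hs' : s' ∈ Ioo (node C 0 k) (node C 0 (k + 1))) :
    surfDist Ψ (g (s, θ)) (g (s', θ)) ≤ 2 * |s' - s| := by
  have hS := regularStar_zero hC
  -- the meridian, run through so that the parameter stays between `s` and `s'` on all of `ℝ`
  set l : ℝ → ℝ := fun u => s + (s' - s) * ((1 - Real.cos (Real.pi * u)) / 2) with hl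
  have hlm : ∀ u, l u ∈ Ioo (node C 0 k) (node C 0 (k + 1)) := by
    intro u
    have h1 := Real.neg_one_le_cos (Real.pi * u)
    have h2 := Real.cos_le_one (Real.pi * u)
    have := (convex_Ioo (node C 0 k) (node C 0 (k + 1))) hs hs'
      (a := 1 - (1 - Real.cos (Real.pi * u)) / 2) (b := (1 - Real.cos (Real.pi * u)) / 2)
      (by linarith) (by linarith) (by ring)
    convert this using 1
    simp only [hl, smul_eq_mul]; ring
  have hlsm : ContDiff ℝ 1 l := by
    have : ContDiff ℝ 1 fun u : ℝ => Real.cos (Real.pi * u) := by fun_prop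
    fun_prop
  have hld : ∀ u, HasDerivAt l ((s' - s) * (Real.pi * Real.sin (Real.pi * u) / 2)) u := by
    intro u
    have h1 := ((hasDerivAt_id u).const_mul Real.pi).cos
    refine ((((h1.const_sub 1).div_const 2).const_mul (s' - s)).const_add s).congr_deriv ?_
    simp only [id]; ring
  set σ : ℝ → ℝ × ℝ := fun u => g (l u, θ) with hσ
  have hσsm : ContDiff ℝ 1 σ := by
    refine contDiff_iff_contDiffAt.2 fun u => ?_
    have h1 := (hg (l u, θ) ⟨hlm u, mem_univ _⟩).2.2.of_le (m := 1) (by norm_num)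
    exact h1.comp u (hlsm.contDiffAt.prodMk contDiffAt_const)
  have hΨσ : (fun u => Ψ (σ u)) = fun u => A (Phi C 0 f (l u, θ)) := by
    ext1 u
    obtain ⟨h1, h2, -⟩ := hg (l u, θ) ⟨hlm u, mem_univ _⟩
    rw [← S.Phi_height hC hf hab ⟨Ioo_subset_Icc_self h1.1, mem_univ _⟩, h2]
  have h0 : σ 0 = g (s, θ) := by simp [hσ, hl]
  have h1 : σ 1 = g (s', θ) := by
    simp only [hσ, hl, mul_one, Real.cos_pi]
    norm_num
  rw [← h0, ← h1]
  refine surfDist_le hσsm fun u => ?_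
  obtain ⟨hsm, hd, -⟩ := isometry_comp_Phi hC hS hf A
  have d1 := (hΨ.differentiable (by norm_num) (σ u)).hasFDerivAt.comp_hasDerivAt u
    ((hσsm.differentiable (by norm_num)) u).hasDerivAt
  have d2 := (hsm.differentiable (by norm_num) (l u, θ)).hasFDerivAt.comp_hasDerivAt u
    ((hld u).prodMk (hasDerivAt_const u θ))
  have d3 : fderiv ℝ Ψ (σ u) (deriv σ u) = _ := d1.unique (by
    rw [show Ψ ∘ σ = _ from hΨσ]; exact d2)
  rw [d3, hd, A.norm_map]
  have hv : (profile hC hS hf).v (l u) = 1 := by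
    unfold ProfileFlow.v
    simp [profile]
  have h4 := (profile hC hS hf).norm_fderiv_Y_sq (l u, θ)
    ((s' - s) * (Real.pi * Real.sin (Real.pi * u) / 2), 0)
  simp only [hv, mul_one, zero_mul] at h4
  rw [zero_pow two_ne_zero, add_zero] at h4
  rw [← abs_norm, (sq_eq_sq_iff_abs_eq_abs _ _).1 h4, abs_mul, mul_comm]
  refine mul_le_mul_of_nonneg_right ?_ (abs_nonneg _)
  rw [abs_div, abs_mul, abs_of_pos Real.pi_pos, abs_two]
  have h5 := Real.abs_sin_le_one (Real.pi * u)
  have h6 := Real.pi_le_four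
  have h7 := Real.pi_pos
  nlinarith [abs_nonneg (Real.sin (Real.pi * u))]

end

/-- By completeness the meridians of a strip reach the boundary: every point of the boundary of the
piece is the image of a boundary point of the strip. -/
lemma exists_boundary (hC : critC < C) (hf : PhaseRec C f) (hab : a < b)
    (S : StripParam Ψ A C k (f k) a b G) (hΨ : IsCompleteImmersion Ψ) {e θ : ℝ}
    (he : e = xi01 C ∨ e = xi02 C) :
    ∃ p ∈ Icc a b ×ˢ (univ : Set ℝ), p ∉ Ioo a b ×ˢ (univ : Set ℝ) ∧ G p = (e, θ) := by
  have hS := regularStar_zero hC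
  have hle := (xi01_lt_xi02 hC).le
  have hsub : Ioo a b ×ˢ (univ : Set ℝ) ⊆ Icc a b ×ˢ univ := prod_mono Ioo_subset_Icc_self le_rfl
  have heI : e ∈ Icc (xi01 C) (xi02 C) := by
    rcases he with rfl | rfl
    · exact left_mem_Icc.2 hle
    · exact right_mem_Icc.2 hle
  obtain ⟨g, hg⟩ := S.exists_inverse hC hf hab hΨ.contDiff hΨ.immersion
  have hn := node_strictMono hC hS (show k < k + 1 by lia)
  set h := hk C 0 k e with hh
  set m := (node C 0 k + node C 0 (k + 1)) / 2 with hm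
  set s : ℕ → ℝ := fun n => h + (m - h) * (1 / ((n : ℝ) + 1)) with hs
  have hhm := hk_mem_Icc hC hS k heI
  have hsm : ∀ n, s n ∈ Ioo (node C 0 k) (node C 0 (k + 1)) := by
    intro n
    have h0 : (0 : ℝ) < 1 / ((n : ℝ) + 1) := by positivity
    have h1 : 1 / ((n : ℝ) + 1) ≤ 1 := by
      rw [div_le_one (by positivity)]
      have : (0 : ℝ) ≤ n := by positivity
      linarith
    have hhm1 : node C 0 k ≤ h := hhm.1
    have hhm2 : h ≤ node C 0 (k + 1) := hhm.2
    have e1 : s n = (1 - 1 / ((n : ℝ) + 1)) * h + (1 / ((n : ℝ) + 1)) * m := by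
      simp only [hs]; ring
    rw [e1]
    set x := 1 / ((n : ℝ) + 1)
    constructor
    · have : 0 < x * (m - node C 0 k) := mul_pos h0 (by linarith)
      nlinarith [mul_nonneg (sub_nonneg.2 h1) (sub_nonneg.2 hhm1)]
    · have : 0 < x * (node C 0 (k + 1) - m) := mul_pos h0 (by linarith)
      nlinarith [mul_nonneg (sub_nonneg.2 h1) (sub_nonneg.2 hhm2)]
  have hst : Tendsto s atTop (𝓝 h) := by
    have := (tendsto_one_div_add_atTop_nhds_zero_nat (𝕜 := ℝ)).const_mul (m - h)
    simpa [hs] using this.const_add h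
  obtain ⟨p, hp⟩ := hΨ.complete (fun n => g (s n, θ)) fun ε hε => by
    obtain ⟨N, hN⟩ := Metric.cauchySeq_iff.1 hst.cauchySeq (ε / 2) (by positivity)
    refine ⟨N, fun i hi j hj => ?_⟩
    have h1 := S.surfDist_le_meridian hC hf hab hΨ.contDiff hg (hsm i) (hsm j)
      (θ := θ)
    have h2 := hN j hj i hi
    rw [Real.dist_eq] at h2
    linarith
  have hmem : ∀ n, g (s n, θ) ∈ Ioo a b ×ˢ (univ : Set ℝ) := fun n =>
    (hg _ ⟨hsm n, mem_univ _⟩).1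
  have hpK : p ∈ Icc a b ×ˢ (univ : Set ℝ) := by
    rw [← closure_strip hab]
    exact mem_closure_of_tendsto hp (Eventually.of_forall hmem)
  have hlim : Tendsto (fun n => height C k G (g (s n, θ))) atTop (𝓝 (height C k G p)) :=
    (S.continuousOn_height hC hab p hpK).tendsto.comp (tendsto_nhdsWithin_iff.2
      ⟨hp, Eventually.of_forall fun n => hsub (hmem n)⟩)
  have hlim' : Tendsto (fun n => height C k G (g (s n, θ))) atTop (𝓝 (h, θ)) := by
    have : (fun n => height C k G (g (s n, θ))) = fun n => (s n, θ) := by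
      ext1 n
      exact (hg _ ⟨hsm n, mem_univ _⟩).2.1
    rw [this]
    exact hst.prodMk_nhds tendsto_const_nhds
  have heq := tendsto_nhds_unique hlim hlim'
  unfold height at heq
  obtain ⟨h1, h2⟩ := Prod.ext_iff.1 heq
  have hGp : G p = (e, θ) := Prod.ext (injOn_hk hC hS k (S.mem hC hab hpK) heI h1) h2
  refine ⟨p, hpK, fun hpo => ?_, hGp⟩
  have := (S.bijOn.mapsTo hpo).1
  rw [hGp] at this
  rcases he with rfl | rfl
  · exact lt_irrefl _ this.1
  · exact lt_irrefl _ this.2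

end StripParam


/-! ### Chains of pieces -/

namespace StripParam
variable {Ψ : ℝ × ℝ → E4} {A : E4 ≃ₗᵢ[ℝ] E4} {C : ℝ} {k : ℤ} {c a b : ℝ} {G : ℝ × ℝ → ℝ × ℝ}

/-- The two boundary lines of a strip are mapped onto the two boundary circles of the piece. -/
lemma exists_ends (hC : critC < C) (hab : a < b) (S : StripParam Ψ A C k c a b G)
    (hΨ : IsCompleteImmersion Ψ) :
    ∃ e e', (e = xi01 C ∧ e' = xi02 C ∨ e = xi02 C ∧ e' = xi01 C) ∧ (∀ s, (G (a, s)).1 = e) ∧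
      (∀ s, (G (b, s)).1 = e') ∧ ∀ θ, ∃ s, G (a, s) = (e, θ) := by
  obtain ⟨f, hf, rfl⟩ := exists_phaseRec C k c
  have hne := (xi01_lt_xi02 hC).ne
  have hline : ∀ x ∈ Icc a b, x ∉ Ioo a b → ∀ s, (G (x, s)).1 = (G (x, 0)).1 := by
    intro x hx hx' s
    have hcont : ContinuousOn (fun s : ℝ => (G (x, s)).1) univ :=
      continuous_fst.comp_continuousOn (S.continuousOn.comp (by fun_prop)
        fun s _ => ⟨hx, mem_univ _⟩)
    refine isPreconnected_univ.constant_of_mapsTo (T := {xi01 C, xi02 C}) (toFinite _).isDiscrete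
      hcont (fun s _ => ?_) (mem_univ s) (mem_univ 0)
    exact S.eq_xi_of_not_mem hC hf hab hΨ.contDiff hΨ.immersion ⟨hx, mem_univ _⟩
      fun h => hx' h.1
  have ha := hline a (left_mem_Icc.2 hab.le) (fun h => lt_irrefl _ h.1)
  have hb := hline b (right_mem_Icc.2 hab.le) (fun h => lt_irrefl _ h.2)
  have hbd : ∀ e θ, (e = xi01 C ∨ e = xi02 C) →
      (∃ s, G (a, s) = (e, θ)) ∨ ∃ s, G (b, s) = (e, θ) := by
    intro e θ he
    obtain ⟨⟨x, s⟩, ⟨hx, -⟩, hp', hG⟩ := S.exists_boundary hC hf hab hΨ he (θ := θ)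
    rcases eq_or_lt_of_le hx.1 with h | h
    · exact Or.inl ⟨s, h ▸ hG⟩
    rcases eq_or_lt_of_le hx.2 with h' | h'
    · exact Or.inr ⟨s, h' ▸ hG⟩
    exact (hp' ⟨⟨h, h'⟩, mem_univ _⟩).elim
  have hval : ∀ e, (e = xi01 C ∨ e = xi02 C) → (G (a, 0)).1 = e ∨ (G (b, 0)).1 = e := by
    intro e he
    rcases hbd e 0 he with ⟨s, h⟩ | ⟨s, h⟩
    · exact Or.inl (by rw [← ha s, h])
    · exact Or.inr (by rw [← hb s, h])
  have hdis : (G (a, 0)).1 = xi01 C ∧ (G (b, 0)).1 = xi02 C ∨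
      (G (a, 0)).1 = xi02 C ∧ (G (b, 0)).1 = xi01 C := by
    rcases hval _ (Or.inl rfl) with h1 | h1 <;> rcases hval _ (Or.inr rfl) with h2 | h2
    · exact absurd (h1.symm.trans h2) hne
    · exact Or.inl ⟨h1, h2⟩
    · exact Or.inr ⟨h2, h1⟩
    · exact absurd (h1.symm.trans h2) hne
  refine ⟨_, _, hdis, ha, hb, fun θ => ?_⟩
  have hea : (G (a, 0)).1 = xi01 C ∨ (G (a, 0)).1 = xi02 C := hdis.imp And.left And.left
  refine (hbd _ θ hea).resolve_right ?_
  rintro ⟨s, h⟩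
  have h3 : (G (b, 0)).1 = (G (a, 0)).1 := by rw [← hb s, h]
  rcases hdis with ⟨h1, h2⟩ | ⟨h1, h2⟩
  · exact hne (by rw [← h1, ← h2, h3])
  · exact hne (by rw [← h1, ← h2, h3])

lemma mem_image_closure (hC : critC < C) (hab : a < b) (S : StripParam Ψ A C k c a b G)
    {p : ℝ × ℝ} (hp : p ∈ Icc a b ×ˢ (univ : Set ℝ)) : Ψ p ∈ A '' closure (piece C k c) := by
  rw [S.eq p hp, closure_piece hC]
  exact ⟨_, ⟨_, ⟨S.mem hC hab hp, mem_univ _⟩, rfl⟩, rfl⟩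

end StripParam

/-- Rigidity of gluing across the line `{x} × ℝ`, where the side of the first piece is the left
one if `ε = 1` and the right one if `ε = -1`. -/
lemma contact_across {Ψ : ℝ × ℝ → E4} (hΨ : ContDiff ℝ 3 Ψ)
    (hi : ∀ p, Function.Injective (fderiv ℝ Ψ p)) {A B : E4 ≃ₗᵢ[ℝ] E4} {C C' : ℝ}
    (hC : critC < C) (hC' : critC < C') {k l : ℤ} {c c' a b x e ε s θ : ℝ} (hε : ε = 1 ∨ ε = -1)
    (hx : x ∈ Ioo a b)
    (h1 : ∀ p : ℝ × ℝ, p.1 ∈ Ioo a b → ε * (p.1 - x) ≤ 0 → Ψ p ∈ B '' closure (piece C k c))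
    (h2 : ∀ p : ℝ × ℝ, p.1 ∈ Ioo a b → 0 ≤ ε * (p.1 - x) → Ψ p ∈ A '' closure (piece C' l c'))
    (he : e = xi01 C ∨ e = xi02 C) (hΨe : Ψ (x, s) = B (pieceMap C k c (e, θ))) :
    C' = C ∧ Ψ (x, s) ∈ A '' bdryCircle C l c' e ∧
      CarriesPiece (A.trans B.symm) C l c' (k + 1) (-2 * zeta0 C e - c) := by
  have hε2 : ε * ε = 1 := by rcases hε with h | h <;> rw [h] <;> norm_num
  have hε0 : ε ≠ 0 := by rintro rfl; norm_num at hε2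
  have hle := (xi01_lt_xi02 hC).le
  set φ : ℝ × ℝ → ℝ × ℝ := fun p => (x + ε * p.1, p.2) with hφ
  have hφd : ∀ p, HasFDerivAt φ ((ε • ContinuousLinearMap.fst ℝ ℝ ℝ).prod
      (ContinuousLinearMap.snd ℝ ℝ ℝ)) p := fun p =>
    (((hasFDerivAt_fst).const_mul ε).const_add x).prodMk hasFDerivAt_snd
  have hφc : ContDiff ℝ 3 φ := by fun_prop
  have hU : IsOpen (φ ⁻¹' (Ioo a b ×ˢ univ)) :=
    (isOpen_Ioo.prod isOpen_univ).preimage hφc.continuous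
  have hXd : ∀ p y, fderiv ℝ (fun p => B.symm (Ψ (φ p))) p y =
      B.symm (fderiv ℝ Ψ (φ p) (ε * y.1, y.2)) := by
    intro p y
    have d1 := (hΨ.differentiable (by norm_num) (φ p)).hasFDerivAt.comp p (hφd p)
    have d2 : HasFDerivAt (fun p => B.symm (Ψ (φ p))) _ p :=
      (B.symm.toContinuousLinearEquiv : E4 →L[ℝ] E4).hasFDerivAt.comp p d1
    rw [d2.fderiv]
    rfl
  have hx0 : φ (0, s) = (x, s) := by simp [hφ]
  have hsub : ∀ p : ℝ × ℝ, ε * ((φ p).1 - x) = p.1 := fun p => by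
    simp only [hφ, add_sub_cancel_left, ← mul_assoc, hε2, one_mul]
  obtain ⟨rfl, ξ, θ', hX, hcase⟩ := contact_at (X := fun p => B.symm (Ψ (φ p)))
    (A := A.trans B.symm) (s := s) hC hC' hU (by
      change φ (0, s) ∈ Ioo a b ×ˢ univ
      rw [hx0]
      exact ⟨hx, mem_univ _⟩)
    (B.symm.toContinuousLinearEquiv.contDiff.comp (hΨ.comp hφc)).contDiffOn
    (fun p _ y z hyz => by
      rw [hXd, hXd] at hyz
      have h3 := hi _ (B.symm.injective hyz)
      simp only [Prod.mk.injEq] at h3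
      exact Prod.ext (mul_left_cancel₀ hε0 h3.1) h3.2)
    (fun p hp hp' => by
      obtain ⟨y, hy, hyp⟩ := h1 (φ p) hp.1 (by rw [hsub]; exact hp')
      simp only [← hyp, B.symm_apply_apply]
      exact hy)
    (fun p hp hp' => by
      obtain ⟨y, hy, hyp⟩ := h2 (φ p) hp.1 (by rw [hsub]; exact hp')
      rw [closure_image_isometry]
      exact ⟨y, hy, by simp [← hyp]⟩)
  have heI : e ∈ Icc (xi01 C') (xi02 C') := by
    rcases he with rfl | rfl
    · exact left_mem_Icc.2 hle
    · exact right_mem_Icc.2 hle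
  have hξe : 0 < ξ → ξ = e := by
    intro hξ
    have h3 : pieceMap C' k c (ξ, θ') = pieceMap C' k c (e, θ) := by
      rw [← hX, hx0, hΨe, B.symm_apply_apply]
    exact (pieceMap_eq hC hξ (pos_of_mem hC heI) h3).1
  refine ⟨rfl, ?_⟩
  rcases hcase with ⟨hξ, -⟩ | ⟨hξ, hXA, hcar⟩
  · have h4 := hξe (pos_of_mem hC (Ioo_subset_Icc_self hξ))
    rw [h4] at hξ
    rcases he with rfl | rfl
    · exact absurd hξ.1 (lt_irrefl _)
    · exact absurd hξ.2 (lt_irrefl _)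
  · obtain rfl : ξ = e := hξe (by
      rcases hξ with rfl | rfl
      · exact pos_of_mem hC (left_mem_Icc.2 hle)
      · exact pos_of_mem hC (right_mem_Icc.2 hle))
    obtain ⟨y, hy, hyX⟩ := hXA
    refine ⟨⟨y, hy, ?_⟩, hcar⟩
    rw [hx0] at hyX
    exact B.symm.injective hyX

lemma eNode_cases (C : ℝ) (k : ℤ) : eNode C k = xi01 C ∧ eNode C (k + 1) = xi02 C ∨
    eNode C k = xi02 C ∧ eNode C (k + 1) = xi01 C := by
  rcases Int.even_or_odd k with h | h
  · exact Or.inl ⟨eNode_even h, eNode_odd h.add_one⟩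
  · exact Or.inr ⟨eNode_odd h, eNode_even h.add_one⟩

/-- A sequence that alternates between the two end points is `eNode`, up to a shift. -/
lemma eq_eNode_of_alternating {C : ℝ} (hne : xi01 C ≠ xi02 C) {e : ℤ → ℝ}
    (h : ∀ k, e k = xi01 C ∧ e (k + 1) = xi02 C ∨ e k = xi02 C ∧ e (k + 1) = xi01 C) :
    (∀ k, e k = eNode C k) ∨ ∀ k, e k = eNode C (k + 1) := by
  have key : ∀ j, e 0 = eNode C j → ∀ k, e k = eNode C (k + j) := by
    intro j h0 k
    induction k using Int.induction_on with
    | zero => simpa using h0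
    | succ i ih =>
      have h1 := h i
      have h2 := eNode_cases C (i + j)
      rw [show (i : ℤ) + 1 + j = i + j + 1 by ring]
      grind
    | pred i ih =>
      have h1 := h (-i - 1)
      have h2 := eNode_cases C (-i - 1 + j)
      rw [show -(i : ℤ) - 1 + j + 1 = -i + j by ring] at h2
      rw [sub_add_cancel] at h1
      grind
  have h0 := h 0
  have h1 := eNode_cases C 0
  rcases h0 with ⟨h0, -⟩ | ⟨h0, -⟩
  · exact Or.inl fun k => by simpa using key 0 (by rw [h0, eNode_even Even.zero]) k
  · exact Or.inr fun k => key 1 (by rw [h0, eNode_odd odd_one]) k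

section
variable {Ψ : ℝ × ℝ → E4} {t : ℤ → ℝ} {c : ℤ → ℝ} {A : ℤ → E4 ≃ₗᵢ[ℝ] E4}

/-- Consecutive pieces of a complete chain have the same constant, and the boundary values of `ξ`
alternate. -/
lemma exists_chain_ends {Cc : ℤ → ℝ} (hΨ : IsCompleteImmersion Ψ) (ht : StrictMono t)
    (hCc : ∀ k, critC < Cc k) {G : ℤ → ℝ × ℝ → ℝ × ℝ}
    (S : ∀ k, StripParam Ψ (A k) (Cc k) k (c k) (t k) (t (k + 1)) (G k)) :
    (∀ k, Cc k = Cc 0) ∧ ∃ e : ℤ → ℝ,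
      (∀ k s, (G k (t k, s)).1 = e k ∧ (G k (t (k + 1), s)).1 = e (k + 1)) ∧
      ((∀ k, e k = eNode (Cc 0) k) ∨ ∀ k, e k = eNode (Cc 0) (k + 1)) := by
  have hlt : ∀ k, t k < t (k + 1) := fun k => ht (by lia)
  choose e e' hee hG1 hG2 hsurj using fun k => (S k).exists_ends (hCc k) (hlt k) hΨ
  have hstep : ∀ k, Cc (k + 1) = Cc k ∧ e (k + 1) = e' k := by
    intro k
    have hx : t (k + 1) ∈ Ioo (t k) (t (k + 1 + 1)) := ⟨hlt k, hlt (k + 1)⟩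
    have hp : (t (k + 1), (0 : ℝ)) ∈ Icc (t k) (t (k + 1)) ×ˢ (univ : Set ℝ) :=
      ⟨right_mem_Icc.2 (hlt k).le, mem_univ _⟩
    have hp' : (t (k + 1), (0 : ℝ)) ∈ Icc (t (k + 1)) (t (k + 1 + 1)) ×ˢ (univ : Set ℝ) :=
      ⟨left_mem_Icc.2 (hlt (k + 1)).le, mem_univ _⟩
    have he' : e' k = xi01 (Cc k) ∨ e' k = xi02 (Cc k) := by
      rcases hee k with ⟨-, h⟩ | ⟨-, h⟩
      · exact Or.inr h
      · exact Or.inl h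
    have hval : Ψ (t (k + 1), 0) =
        A k (pieceMap (Cc k) k (c k) (e' k, (G k (t (k + 1), 0)).2)) := by
      rw [(S k).eq _ hp, ← hG2 k 0]
    obtain ⟨h1, h2, -⟩ := contact_across hΨ.contDiff hΨ.immersion (hCc k) (hCc (k + 1))
      (B := A k) (A := A (k + 1)) (k := k) (l := k + 1) (c := c k) (c' := c (k + 1))
      (Or.inl rfl) hx
      (fun p hp hp' => (S k).mem_image_closure (hCc k) (hlt k) ⟨⟨hp.1.le, by linarith⟩, mem_univ _⟩)
      (fun p hp hp' => (S (k + 1)).mem_image_closure (hCc (k + 1)) (hlt (k + 1))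
        ⟨⟨by linarith, hp.2.le⟩, mem_univ _⟩) he' hval
    refine ⟨h1, ?_⟩
    obtain ⟨_, ⟨θ, rfl⟩, h3⟩ := h2
    rw [(S (k + 1)).eq _ hp'] at h3
    have h4 := (A (k + 1)).injective h3
    rw [h1] at h4
    have hle := (xi01_lt_xi02 (hCc k)).le
    have hpos : 0 < e' k := by
      rcases he' with h | h <;> rw [h]
      · exact pos_of_mem (hCc k) (left_mem_Icc.2 hle)
      · exact pos_of_mem (hCc k) (right_mem_Icc.2 hle)
    have h5 := (S (k + 1)).mem (hCc (k + 1)) (hlt (k + 1)) hp'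
    rw [← hG1 (k + 1) 0]
    exact (pieceMap_eq (hCc k) hpos (pos_of_mem (hCc (k + 1)) h5) h4).1.symm
  have hconst : ∀ k, Cc k = Cc 0 := by
    intro k
    induction k using Int.induction_on with
    | zero => rfl
    | succ i ih => rw [(hstep i).1, ih]
    | pred i ih =>
      have := (hstep (-i - 1)).1
      rw [sub_add_cancel] at this
      rw [← this, ih]
  refine ⟨hconst, e, fun k s => ⟨hG1 k s, by rw [hG2, (hstep k).2]⟩, ?_⟩
  refine eq_eNode_of_alternating (xi01_lt_xi02 (hCc 0)).ne fun k => ?_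
  rw [(hstep k).2, ← hconst k]
  exact hee k

/-- Along a chain with the phases `c'` of the recursion the moved pieces are pieces in standard
position, moved by the isometry of the piece of index `0`. -/
lemma carriesPiece_chain {C : ℝ} (hC : critC < C) (hΨ : ContDiff ℝ 3 Ψ)
    (hi : ∀ p, Function.Injective (fderiv ℝ Ψ p)) (ht : StrictMono t)
    {G : ℤ → ℝ × ℝ → ℝ × ℝ} (S : ∀ k, StripParam Ψ (A k) C k (c k) (t k) (t (k + 1)) (G k))
    {e : ℤ → ℝ} (he : ∀ k, e k = xi01 C ∨ e k = xi02 C)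
    (hG : ∀ k s, (G k (t k, s)).1 = e k ∧ (G k (t (k + 1), s)).1 = e (k + 1)) {c' : ℤ → ℝ}
    (h0 : c' 0 = c 0) (hrec : ∀ k, c' k ≡ -2 * zeta0 C (e k) - c' (k - 1) [PMOD (2 * Real.pi)])
    (k : ℤ) : CarriesPiece ((A k).trans (A 0).symm) C k (c k) k (c' k) := by
  have hlt : ∀ k, t k < t (k + 1) := fun k => ht (by lia)
  have hcl : ∀ k, CarriesPiece ((A k).trans (A 0).symm) C k (c k) k (c' k) →
      (∀ p ∈ Icc (t k) (t (k + 1)) ×ˢ (univ : Set ℝ), Ψ p ∈ A 0 '' closure (piece C k (c' k)) ∧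
        ∃ θ, Ψ p = A 0 (pieceMap C k (c' k) ((G k p).1, θ))) := by
    intro k hk p hp
    obtain ⟨ε, δ, -, h⟩ := hk
    have h1 : Ψ p = A 0 (pieceMap C k (c' k) ((G k p).1, ε * (G k p).2 + δ)) := by
      rw [← h, (S k).eq p hp]
      simp
    refine ⟨?_, _, h1⟩
    rw [h1, closure_piece hC]
    exact ⟨_, ⟨((G k p).1, ε * (G k p).2 + δ), ⟨(S k).mem hC (hlt k) hp, mem_univ _⟩, rfl⟩, rfl⟩
  induction k using Int.induction_on with
  | zero =>
    rw [h0, LinearIsometryEquiv.self_trans_symm]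
    exact CarriesPiece.refl C 0 (c 0)
  | succ i ih =>
    have hp : (t (i + 1), (0 : ℝ)) ∈ Icc (t i) (t (i + 1)) ×ˢ (univ : Set ℝ) :=
      ⟨right_mem_Icc.2 (hlt i).le, mem_univ _⟩
    obtain ⟨-, θ, hθ⟩ := hcl i ih _ hp
    rw [(hG i 0).2] at hθ
    obtain ⟨-, -, h1⟩ := contact_across hΨ hi hC hC (B := A 0) (A := A (i + 1)) (k := i)
      (l := i + 1) (c := c' i) (c' := c (i + 1)) (Or.inl rfl)
      (show t (i + 1) ∈ Ioo (t i) (t (i + 1 + 1)) from ⟨hlt i, hlt (i + 1)⟩)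
      (fun p hp hp' => (hcl i ih p ⟨⟨hp.1.le, by linarith⟩, mem_univ _⟩).1)
      (fun p hp hp' => (S (i + 1)).mem_image_closure hC (hlt (i + 1))
        ⟨⟨by linarith, hp.2.le⟩, mem_univ _⟩) (he _) hθ
    have h2 := hrec (i + 1)
    rw [add_sub_cancel_right] at h2
    have h3 := h1.trans (CarriesPiece.of_modEq (C := C) (k := i + 1) ⟨i + 1, rfl⟩ h2.symm)
    rwa [LinearIsometryEquiv.trans_refl] at h3
  | pred i ih =>
    have hlt' := hlt (-i - 1)
    have S' := S (-i - 1)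
    rw [sub_add_cancel] at hlt' S'
    have hp : (t (-i), (0 : ℝ)) ∈ Icc (t (-i)) (t (-i + 1)) ×ˢ (univ : Set ℝ) :=
      ⟨left_mem_Icc.2 (hlt (-i)).le, mem_univ _⟩
    obtain ⟨-, θ, hθ⟩ := hcl (-i) ih _ hp
    rw [(hG (-i) 0).1] at hθ
    obtain ⟨-, -, h1⟩ := contact_across hΨ hi hC hC (B := A 0) (A := A (-i - 1)) (k := -i)
      (l := -i - 1) (c := c' (-i)) (c' := c (-i - 1)) (Or.inr rfl)
      (show t (-i) ∈ Ioo (t (-i - 1)) (t (-i + 1)) from ⟨hlt', hlt (-i)⟩)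
      (fun p hp hp' => (hcl (-i) ih p ⟨⟨by linarith, hp.2.le⟩, mem_univ _⟩).1)
      (fun p hp hp' => S'.mem_image_closure hC hlt' ⟨⟨hp.1.le, by linarith⟩, mem_univ _⟩)
      (he _) hθ
    have h2 := ((hrec (-i)).add_right (c' (-i - 1))).sub_right (c' (-i))
    rw [sub_add_cancel, add_sub_cancel_left] at h2
    have h3 := h1.trans (CarriesPiece.of_modEq (C := C) (k := -i - 1) ⟨-i, by ring⟩ h2.symm)
    rwa [LinearIsometryEquiv.trans_refl] at h3

/-- The angles of rotation on all strips fit together to one parametrization of the plane. -/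
lemma exists_global_param {C : ℝ} (hC : critC < C) (hΨ : IsCompleteImmersion Ψ)
    (ht : StrictMono t) (hcov : ∀ x : ℝ, ∃ k, t k ≤ x ∧ x < t (k + 1))
    {G : ℤ → ℝ × ℝ → ℝ × ℝ} (S : ∀ k, StripParam Ψ (A k) C k (c k) (t k) (t (k + 1)) (G k))
    {e : ℤ → ℝ} (hG : ∀ k s, (G k (t k, s)).1 = e k ∧ (G k (t (k + 1), s)).1 = e (k + 1))
    {c' : ℤ → ℝ} (hcar : ∀ k, CarriesPiece ((A k).trans (A 0).symm) C k (c k) k (c' k)) :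
    ∃ H : ℝ × ℝ → ℝ × ℝ, Continuous H ∧
      (∀ k, StripParam Ψ (A 0) C k (c' k) (t k) (t (k + 1)) H) ∧
      (∀ k s, (H (t k, s)).1 = e k) ∧ ∀ k θ, ∃ s, H (t k, s) = (e k, θ) := by
  have hlt : ∀ k, t k < t (k + 1) := fun k => ht (by lia)
  choose ε δ hε hεδ using hcar
  set G' : ℤ → ℝ × ℝ → ℝ × ℝ := fun k p => ((G k p).1, ε k * (G k p).2 + δ k) with hG'
  have hval : ∀ k, ∀ p ∈ Icc (t k) (t (k + 1)) ×ˢ (univ : Set ℝ),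
      (A 0).symm (Ψ p) = pieceMap C k (c' k) (G' k p) := by
    intro k p hp
    rw [hG', ← hεδ, (S k).eq p hp]
    rfl
  have hmem : ∀ k, ∀ p ∈ Icc (t k) (t (k + 1)) ×ˢ (univ : Set ℝ),
      (G' k p).1 ∈ Icc (xi01 C) (xi02 C) := fun k p hp => (S k).mem hC (hlt k) hp
  obtain ⟨H, hH, hHe⟩ := exists_param_lift hC
    ((A 0).symm.continuous.comp hΨ.contDiff.continuous) (fun p => by
      obtain ⟨k, h1, h2⟩ := hcov p.1
      have hp : p ∈ Icc (t k) (t (k + 1)) ×ˢ (univ : Set ℝ) := ⟨⟨h1, h2.le⟩, mem_univ _⟩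
      exact ⟨k, c' k, (G' k p).1, (G' k p).2, hmem k p hp, hval k p hp⟩)
  have hHe' : ∀ k, ∀ p ∈ Icc (t k) (t (k + 1)) ×ˢ (univ : Set ℝ), (H p).1 = (G k p).1 ∧
      (A 0).symm (Ψ p) = pieceMap C k (c' k) (H p) := fun k p hp =>
    hHe p k (c' k) (G' k p).1 (G' k p).2 (hmem k p hp) (hval k p hp)
  have hsub : ∀ k, Ioo (t k) (t (k + 1)) ×ˢ (univ : Set ℝ) ⊆ Icc (t k) (t (k + 1)) ×ˢ univ :=
    fun k => prod_mono Ioo_subset_Icc_self le_rfl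
  have hSH : ∀ k, StripParam Ψ (A 0) C k (c' k) (t k) (t (k + 1)) H := by
    intro k
    have hcG : ContinuousOn (G' k) (Ioo (t k) (t (k + 1)) ×ˢ univ) := by
      have := (S k).continuousOn.mono (hsub k)
      fun_prop
    have hbG : BijOn (G' k) (Ioo (t k) (t (k + 1)) ×ˢ univ) (D C) := by
      refine BijOn.comp (t := D C) (g := fun q : ℝ × ℝ => (q.1, ε k * q.2 + δ k)) ⟨?_, ?_, ?_⟩
        (S k).bijOn
      · rintro q ⟨hq, -⟩
        exact ⟨hq, mem_univ _⟩
      · rintro q - q' - hqq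
        simp only [Prod.mk.injEq, add_left_inj] at hqq
        have hε0 : ε k ≠ 0 := by
          intro h
          have := hε k
          rw [h] at this
          norm_num at this
        exact Prod.ext hqq.1 (mul_left_cancel₀ hε0 hqq.2)
      · rintro q ⟨hq, -⟩
        refine ⟨(q.1, ε k * (q.2 - δ k)), ⟨hq, mem_univ _⟩, Prod.ext rfl ?_⟩
        dsimp only
        linear_combination (q.2 - δ k) * hε k
    refine ⟨hH.continuousOn, bijOn_of_lift hC (isPreconnected_Ioo.prod isPreconnected_univ) hcG hbG
      hH.continuousOn (k := k) (c := c' k) (fun p hp => ?_) (fun p hp => ?_), fun p hp => ?_⟩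
    · rw [(hHe' k p (hsub k hp)).1]
      exact pos_of_mem hC (hmem k p (hsub k hp))
    · rw [← (hHe' k p (hsub k hp)).2, hval k p (hsub k hp)]
    · rw [← (hHe' k p hp).2, LinearIsometryEquiv.apply_symm_apply]
  have hHt : ∀ k s, (H (t k, s)).1 = e k := fun k s => by
    rw [(hHe' k (t k, s) ⟨left_mem_Icc.2 (hlt k).le, mem_univ _⟩).1, (hG k s).1]
  refine ⟨H, hH, hSH, hHt, fun k θ => ?_⟩
  obtain ⟨e₁, -, -, h1, -, h2⟩ := (hSH k).exists_ends hC (hlt k) hΨ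
  obtain ⟨s, hs⟩ := h2 θ
  exact ⟨s, by rw [hs, ← h1 0, hHt]⟩

end


/-! ### Uniqueness of complete glued surfaces -/

lemma PhaseRec.congr {C : ℝ} {c d : ℤ → ℝ} (hd : PhaseRec C d)
    (h : ∀ k, c k ≡ d k [PMOD (2 * Real.pi)]) : PhaseRec C c := by
  rw [phaseRec_iff] at hd ⊢
  exact fun k => (h k).trans ((hd k).trans ((h (k - 1)).symm.sub_left _))

/-- A surface that is parametrized strip by strip by the pieces of `Φ_{C, C*}`, with the nodes in
their order, is a reparametrization of `Φ_{C, C*}`. -/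
lemma exists_reparam {Ψ : ℝ × ℝ → E4} {t : ℤ → ℝ} {B : E4 ≃ₗᵢ[ℝ] E4} {C Cs : ℝ} {c : ℤ → ℝ}
    {H : ℝ × ℝ → ℝ × ℝ} (hC : critC < C) (hS : RegularStar C Cs) (hc : PhaseRec C c)
    (hΨ : ContDiff ℝ 3 Ψ) (hi : ∀ p, Function.Injective (fderiv ℝ Ψ p)) (ht : StrictMono t)
    (hcov : ∀ x : ℝ, ∃ k, t k ≤ x ∧ x < t (k + 1))
    (S : ∀ k, StripParam Ψ B C k (c k) (t k) (t (k + 1)) H)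
    (hHt : ∀ k s, (H (t k, s)).1 = eNode C k) (hsurj : ∀ k θ, ∃ s, H (t k, s) = (eNode C k, θ)) :
    ∃ ω : (ℝ × ℝ) ≃ₜ (ℝ × ℝ), ContDiff ℝ 3 ω ∧ ContDiff ℝ 3 ω.symm ∧
      ∀ p, Ψ p = B (Phi C Cs c (ω p)) := by
  have hlt : ∀ k, t k < t (k + 1) := fun k => ht (by lia)
  have hnode := node_strictMono hC hS
  choose idx hidx1 hidx2 using hcov
  set Ω : ℝ × ℝ → ℝ × ℝ := fun p => (hk C Cs (idx p.1) (H p).1, (H p).2) with hΩ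
  have hmem : ∀ k, ∀ p : ℝ × ℝ, p.1 ∈ Icc (t k) (t (k + 1)) → (H p).1 ∈ Icc (xi01 C) (xi02 C) :=
    fun k p hp => (S k).mem hC (hlt k) ⟨hp, mem_univ _⟩
  have hΩk : ∀ k, ∀ p : ℝ × ℝ, p.1 ∈ Icc (t k) (t (k + 1)) →
      Ω p = (hk C Cs k (H p).1, (H p).2) := by
    intro k p hp
    have h1 : idx p.1 < k + 1 + 1 := ht.lt_iff_lt.1
      (((hidx1 p.1).trans hp.2).trans_lt (hlt (k + 1)))
    have h2 : k < idx p.1 + 1 := ht.lt_iff_lt.1 (hp.1.trans_lt (hidx2 p.1))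
    rcases (show idx p.1 = k ∨ idx p.1 = k + 1 by lia) with h | h
    · simp only [hΩ, h]
    · have h3 : p.1 = t (k + 1) := le_antisymm hp.2 (h ▸ hidx1 p.1)
      have h4 : (H p).1 = eNode C (k + 1) := by
        rw [← hHt (k + 1) p.2, ← h3]
      simp only [hΩ, h, h4, hk_eNode, hk_eNode_succ]
  have hcont : Continuous Ω := by
    refine continuous_of_strips ht (fun x => ⟨idx x, hidx1 x, hidx2 x⟩) continuous_fst fun k => ?_
    have hset : Prod.fst ⁻¹' Icc (t k) (t (k + 1)) = Icc (t k) (t (k + 1)) ×ˢ (univ : Set ℝ) := by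
      ext; simp
    rw [hset]
    have h1 : ContinuousOn (fun p => hk C Cs k (H p).1) (Icc (t k) (t (k + 1)) ×ˢ univ) :=
      (continuousOn_hk hC hS k).comp (continuous_fst.comp_continuousOn (S k).continuousOn)
        fun p hp => hmem k p hp.1
    refine (h1.prodMk (continuous_snd.comp_continuousOn (S k).continuousOn)).congr
      fun p hp => hΩk k p hp.1
  have hstrip : ∀ p : ℝ × ℝ, p.1 ∈ Icc (t (idx p.1)) (t (idx p.1 + 1)) := fun p =>
    ⟨hidx1 _, (hidx2 _).le⟩
  have hval : ∀ p, B (Phi C Cs c (Ω p)) = Ψ p := by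
    intro p
    have h1 := hmem _ p (hstrip p)
    rw [hΩk _ p (hstrip p), (S _).eq p ⟨hstrip p, mem_univ _⟩,
      Phi_eq_pieceMap hC hS hc (hk_mem_Icc hC hS _ h1), F_hk hC hS _ h1]
  obtain ⟨hsm, -, hinj⟩ := isometry_comp_Phi hC hS hc B
  have hlocal : ∀ p, ContDiffAt ℝ 3 Ω p ∧ map Ω (𝓝 p) = 𝓝 (Ω p) := fun p =>
    lift_of_immersions hsm.contDiffAt (hinj _) hΨ.contDiffAt (hi p) hcont.continuousAt
      (Eventually.of_forall hval)
  -- the strips correspond to the strips between the nodes, and the lines to the nodes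
  have hline : ∀ k s, Ω (t k, s) = (node C Cs k, (H (t k, s)).2) := fun k s => by
    rw [hΩk k _ (left_mem_Icc.2 (hlt k).le), hHt, hk_eNode]
  have hopen : ∀ k, BijOn Ω (Ioo (t k) (t (k + 1)) ×ˢ univ)
      (Ioo (node C Cs k) (node C Cs (k + 1)) ×ˢ univ) := by
    intro k
    have h1 : BijOn (fun p => (hk C Cs k (H p).1, (H p).2)) (Ioo (t k) (t (k + 1)) ×ˢ univ)
        (Ioo (node C Cs k) (node C Cs (k + 1)) ×ˢ univ) := by
      refine BijOn.comp (t := D C) (g := fun q : ℝ × ℝ => (hk C Cs k q.1, q.2)) ⟨?_, ?_, ?_⟩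
        (S k).bijOn
      · rintro q ⟨hq, -⟩
        exact ⟨hk_mem_Ioo hC hS k hq, mem_univ _⟩
      · rintro q ⟨hq, -⟩ q' ⟨hq', -⟩ hqq
        simp only [Prod.mk.injEq] at hqq
        exact Prod.ext (injOn_hk hC hS k (Ioo_subset_Icc_self hq) (Ioo_subset_Icc_self hq') hqq.1)
          hqq.2
      · rintro q ⟨hq, -⟩
        exact ⟨(F C Cs q.1, q.2), ⟨F_mem_Ioo hC hS hq, mem_univ _⟩,
          by simp [hk_F hC hS (Ioo_subset_Icc_self hq)]⟩
    exact h1.congr fun p hp => (hΩk k p (Ioo_subset_Icc_self hp.1)).symm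
  have hcases : ∀ p : ℝ × ℝ, (∃ k, p ∈ Ioo (t k) (t (k + 1)) ×ˢ (univ : Set ℝ)) ∨
      ∃ k, p.1 = t k := by
    intro p
    rcases eq_or_lt_of_le (hidx1 p.1) with h | h
    · exact Or.inr ⟨_, h.symm⟩
    · exact Or.inl ⟨_, ⟨h, hidx2 p.1⟩, mem_univ _⟩
  have hback : ∀ k, ∀ p : ℝ × ℝ, (Ω p).1 ∈ Ioo (node C Cs k) (node C Cs (k + 1)) →
      p ∈ Ioo (t k) (t (k + 1)) ×ˢ (univ : Set ℝ) := by
    intro k p hp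
    rcases hcases p with ⟨j, hj⟩ | ⟨j, hj⟩
    · have h1 := ((hopen j).mapsTo hj).1
      have h2 := hnode.lt_iff_lt.1 (h1.1.trans hp.2)
      have h3 := hnode.lt_iff_lt.1 (hp.1.trans h1.2)
      obtain rfl : j = k := by lia
      exact hj
    · have h1 : (Ω p).1 = node C Cs j := by
        rw [show p = (t j, p.2) from Prod.ext hj rfl, hline]
      rw [h1] at hp
      have h2 := hnode.lt_iff_lt.1 hp.1
      have h3 := hnode.lt_iff_lt.1 hp.2
      lia
  have hΩinj : Function.Injective Ω := by
    intro p p' hpp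
    rcases hcases p with ⟨k, hk'⟩ | ⟨k, hk'⟩
    · have h1 := ((hopen k).mapsTo hk').1
      exact (hopen k).injOn hk' (hback k p' (hpp ▸ h1)) hpp
    · -- two preimages on a line would produce two preimages of nearby points off the line
      by_contra hne
      obtain ⟨V, W, hV, hW, hpV, hpW, hVW⟩ := t2_separation hne
      have i1 : Ω '' V ∈ 𝓝 (Ω p) := by
        rw [← (hlocal p).2]; exact image_mem_map (hV.mem_nhds hpV)
      have i2 : Ω '' W ∈ 𝓝 (Ω p) := by
        rw [hpp, ← (hlocal p').2]; exact image_mem_map (hW.mem_nhds hpW)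
      have hcl : Ω p ∈ closure (Ioo (node C Cs k) (node C Cs (k + 1)) ×ˢ (univ : Set ℝ)) := by
        rw [closure_strip (hnode (by lia)), show p = (t k, p.2) from Prod.ext hk' rfl, hline]
        exact ⟨left_mem_Icc.2 (hnode (by lia)).le, mem_univ _⟩
      obtain ⟨q, ⟨⟨x, hxV, hx⟩, ⟨y, hyW, hy⟩⟩, hq⟩ := mem_closure_iff_nhds.1 hcl _ (inter_mem i1 i2)
      have hx' := hback k x (by rw [hx]; exact hq.1)
      have hy' := hback k y (by rw [hy]; exact hq.1)
      have hxy := (hopen k).injOn hx' hy' (hx.trans hy.symm)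
      exact hVW.le_bot ⟨hxV, hxy ▸ hyW⟩
  have hΩsurj : Function.Surjective Ω := by
    intro q
    obtain ⟨k, h1, h2⟩ := node_cover hC hS q.1
    rcases eq_or_lt_of_le h1 with h | h
    · obtain ⟨s, hs⟩ := hsurj k q.2
      exact ⟨(t k, s), by rw [hline, hs]; exact Prod.ext h rfl⟩
    · obtain ⟨p, -, hp⟩ := (hopen k).surjOn (show q ∈ _ from ⟨⟨h, h2⟩, mem_univ _⟩)
      exact ⟨p, hp⟩
  set E := Equiv.ofBijective Ω ⟨hΩinj, hΩsurj⟩ with hE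
  have hEsymm : ∀ p, E.symm (Ω p) = p := fun p => E.symm_apply_apply p
  have hEcont : Continuous E.symm := by
    refine continuous_iff_continuousAt.2 fun q => ?_
    obtain ⟨p, rfl⟩ := hΩsurj q
    rw [ContinuousAt, hEsymm]
    exact tendsto_of_leftInverse (hlocal p).2 (Eventually.of_forall hEsymm)
  refine ⟨⟨E, hcont, hEcont⟩, contDiff_iff_contDiffAt.2 fun p => (hlocal p).1,
    contDiff_iff_contDiffAt.2 fun q => ?_, fun p => (hval p).symm⟩
  refine (lift_of_immersions (Y := Ψ) (Ω := E.symm) hΨ.contDiffAt (hi _)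
    (hsm.contDiffAt (x := q)) (hinj _) hEcont.continuousAt (Eventually.of_forall fun x => ?_)).1
  rw [← hval, show Ω (E.symm x) = x from E.apply_symm_apply x]

/-- The reflection of the first coordinate. -/
def reflectFst : (ℝ × ℝ) ≃ₜ (ℝ × ℝ) := (Homeomorph.neg ℝ).prodCongr (Homeomorph.refl ℝ)

lemma reflectFst_apply (p : ℝ × ℝ) : reflectFst p = (-p.1, p.2) := rfl

lemma contDiff_reflectFst : ContDiff ℝ 3 reflectFst := by
  change ContDiff ℝ 3 fun p : ℝ × ℝ => (-p.1, p.2)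
  fun_prop

lemma contDiff_reflectFst_symm : ContDiff ℝ 3 reflectFst.symm := by
  change ContDiff ℝ 3 fun p : ℝ × ℝ => (-p.1, p.2)
  fun_prop

lemma StripParam.reflect {Ψ : ℝ × ℝ → E4} {A : E4 ≃ₗᵢ[ℝ] E4} {C : ℝ} {k : ℤ} {c a b : ℝ}
    {G : ℝ × ℝ → ℝ × ℝ} (S : StripParam Ψ A C k c a b G) :
    StripParam (Ψ ∘ reflectFst) A C (-k) c (-b) (-a) (G ∘ reflectFst) := by
  have h1 : MapsTo reflectFst (Icc (-b) (-a) ×ˢ univ) (Icc a b ×ˢ univ) := by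
    rintro p ⟨hp, -⟩
    exact ⟨⟨by simp only [reflectFst_apply]; linarith [hp.2],
      by simp only [reflectFst_apply]; linarith [hp.1]⟩, mem_univ _⟩
  refine ⟨S.continuousOn.comp reflectFst.continuous.continuousOn h1, ?_, fun p hp => ?_⟩
  · refine S.bijOn.comp ⟨?_, reflectFst.injective.injOn, ?_⟩
    · rintro p ⟨hp, -⟩
      exact ⟨⟨by simp only [reflectFst_apply]; linarith [hp.2],
        by simp only [reflectFst_apply]; linarith [hp.1]⟩, mem_univ _⟩
    · rintro p ⟨hp, -⟩
      exact ⟨(-p.1, p.2), ⟨⟨by linarith [hp.2], by linarith [hp.1]⟩, mem_univ _⟩,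
        by simp [reflectFst_apply]⟩
  · have h2 : (-1 : ℝ) ^ (-k) = (-1) ^ k := by
      rw [zpow_neg, inv_eq_of_mul_eq_one_left (neg_one_zpow_sq k)]
    rw [Function.comp_apply, S.eq _ (h1 hp)]
    unfold pieceMap
    rw [h2]
    rfl

lemma eNode_neg_add (C : ℝ) (k : ℤ) {j : ℤ} (hj : Even (j - k)) : eNode C j = eNode C k := by
  rcases Int.even_or_odd k with h | h
  · rw [eNode_even h, eNode_even (by have := hj.add h; rwa [sub_add_cancel] at this)]
  · rw [eNode_odd h, eNode_odd (by have := hj.add_odd h; rwa [sub_add_cancel] at this)]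

/-- Uniqueness of the complete surfaces obtained by gluing pieces. -/
theorem IsPieceChain.uniqueness {Ψ : ℝ × ℝ → E4} {t Cc c : ℤ → ℝ} {A : ℤ → E4 ≃ₗᵢ[ℝ] E4}
    (hΨ : IsCompleteImmersion Ψ) (h : IsPieceChain Ψ t Cc c A) :
    (∀ k, Cc k = Cc 0) ∧
      ((∀ k, A k = LinearIsometryEquiv.refl ℝ E4) →
        PhaseRec (Cc 0) c ∨ PhaseRec (Cc 0) (fun k => c (-k))) ∧
      ∀ Cs : ℝ, AdmissibleStar (Cc 0) Cs →
        ∃ c' : ℤ → ℝ, c' 0 = c 0 ∧ PhaseRec (Cc 0) c' ∧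
          ∃ ω : (ℝ × ℝ) ≃ₜ (ℝ × ℝ), ContDiff ℝ 3 ω ∧ ContDiff ℝ 3 ω.symm ∧
            ∀ p, Ψ p = A 0 (Phi (Cc 0) Cs c' (ω p)) := by
  obtain ⟨ht, hcov, hpieces⟩ := h
  have hlt : ∀ k, t k < t (k + 1) := fun k => ht (by lia)
  have hex : ∀ k, ∃ G, StripParam Ψ (A k) (Cc k) k (c k) (t k) (t (k + 1)) G := by
    intro k
    obtain ⟨hCk, ω, hω, hbij, hval⟩ := hpieces k
    exact exists_stripParam hCk (hlt k) hΨ.contDiff.continuous hω hbij hval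
  choose G S using hex
  obtain ⟨hconst, e, hG, he⟩ := exists_chain_ends hΨ ht (fun k => (hpieces k).1) S
  refine ⟨hconst, ?_⟩
  obtain ⟨C, rfl⟩ : ∃ C, Cc = fun _ => C := ⟨Cc 0, funext hconst⟩
  have hC : critC < C := (hpieces 0).1
  have heN : ∀ k, e k = xi01 C ∨ e k = xi02 C := by
    intro k
    rcases he with he | he <;> rw [he]
    · exact (eNode_cases C k).imp And.left And.left
    · exact (eNode_cases C (k + 1)).imp And.left And.left
  have hmod : (∀ k, A k = LinearIsometryEquiv.refl ℝ E4) → ∀ c' : ℤ → ℝ,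
      (∀ k, CarriesPiece ((A k).trans (A 0).symm) C k (c k) k (c' k)) →
      ∀ k, c k ≡ c' k [PMOD (2 * Real.pi)] := by
    intro hA c' hcar k
    have := hcar k
    rw [hA, hA, LinearIsometryEquiv.self_trans_symm] at this
    exact (this.phase_eq hC).2
  obtain ⟨d, hd, hd0⟩ := exists_phaseRec C 0 (c 0)
  have hdrec := phaseRec_iff.1 hd
  rcases he with he | he
  · have hcar := carriesPiece_chain hC hΨ.contDiff hΨ.immersion ht S heN hG hd0
      (fun k => by rw [he]; exact hdrec k)
    refine ⟨fun hA => Or.inl (hd.congr (hmod hA d hcar)), fun Cs hCs => ⟨d, hd0, hd, ?_⟩⟩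
    obtain ⟨H, -, hSH, hHt, hsurj⟩ := exists_global_param hC hΨ ht hcov S hG hcar
    exact exists_reparam hC (hCs.regularStar hC) hd hΨ.contDiff hΨ.immersion ht hcov hSH
      (fun k s => by rw [hHt, he]) (fun k θ => by rw [← he]; exact hsurj k θ)
  · -- the strips follow each other in the reversed order
    have hrec : ∀ k, d (-k) ≡ -2 * zeta0 C (e k) - d (-(k - 1)) [PMOD (2 * Real.pi)] := by
      intro k
      have h1 := ((hdrec (1 - k)).add_right (d (-k))).sub_right (d (1 - k))
      rw [show 1 - k - 1 = -k by ring, sub_add_cancel, add_sub_cancel_left,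
        eNode_neg_add C (k + 1) ⟨-k, by ring⟩, ← he] at h1
      rwa [show -(k - 1) = 1 - k by ring]
    have hcar := carriesPiece_chain (c' := fun k => d (-k)) hC hΨ.contDiff hΨ.immersion ht S heN hG
      (by simpa using hd0) hrec
    refine ⟨fun hA => Or.inr (hd.congr fun k => ?_), fun Cs hCs => ⟨d, hd0, hd, ?_⟩⟩
    · have := hmod hA _ hcar (-k)
      rwa [neg_neg] at this
    obtain ⟨H, -, hSH, hHt, hsurj⟩ := exists_global_param hC hΨ ht hcov S hG hcar
    have hi : ∀ p, Function.Injective (fderiv ℝ (Ψ ∘ reflectFst) p) := by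
      intro p
      have h1 : HasFDerivAt reflectFst ((-ContinuousLinearMap.fst ℝ ℝ ℝ).prod
          (ContinuousLinearMap.snd ℝ ℝ ℝ)) p := hasFDerivAt_fst.neg.prodMk hasFDerivAt_snd
      rw [((hΨ.contDiff.differentiable (by norm_num) _).hasFDerivAt.comp p h1).fderiv]
      refine (hΨ.immersion _).comp fun x y hxy => ?_
      simpa [Prod.ext_iff] using hxy
    obtain ⟨ω, hω, hω', hωe⟩ := exists_reparam (t := fun j => -t (1 - j)) (B := A 0)
      (H := H ∘ reflectFst) hC (hCs.regularStar hC) hd (hΨ.contDiff.comp contDiff_reflectFst) hi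
      (fun i j hij => neg_lt_neg (ht (by lia)))
      (fun x => by
        obtain ⟨k, h1, h2⟩ := hcov (-x)
        rcases eq_or_lt_of_le h1 with h3 | h3
        · refine ⟨1 - k, ?_, ?_⟩
          · rw [show 1 - (1 - k) = k by ring]; linarith
          · rw [show 1 - (1 - k + 1) = k - 1 by ring]
            have := ht (show k - 1 < k by lia)
            linarith
        · refine ⟨-k, ?_, ?_⟩
          · rw [show 1 - -k = k + 1 by ring]; linarith
          · rw [show 1 - (-k + 1) = k by ring]; linarith)
      (fun j => by
        have := (hSH (-j)).reflect
        rwa [neg_neg, show -j + 1 = 1 - j by ring, show -j = 1 - (j + 1) by ring] at this)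
      (fun j s => by
        rw [Function.comp_apply, reflectFst_apply]
        dsimp only
        rw [neg_neg, hHt, he, eNode_neg_add C j ⟨1 - j, by ring⟩])
      (fun j θ => by
        obtain ⟨s, hs⟩ := hsurj (1 - j) θ
        refine ⟨s, ?_⟩
        rw [Function.comp_apply, reflectFst_apply]
        dsimp only
        rw [neg_neg, hs, he, eNode_neg_add C j ⟨1 - j, by ring⟩])
    refine ⟨reflectFst.trans ω, hω.comp contDiff_reflectFst, contDiff_reflectFst_symm.comp hω',
      fun p => ?_⟩
    have h3 := hωe (reflectFst p)
    rw [Function.comp_apply] at h3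
    rw [Homeomorph.trans_apply, ← h3]
    congr 1
    simp [reflectFst_apply]

end BiconsSphere

theorem mainTheorem10 :
    -- the boundary of a piece consists of its two boundary circles
    (∀ (C : ℝ) (k : ℤ) (c : ℝ), critC < C →
      closure (piece C k c) \ piece C k c =
        bdryCircle C k c (xi01 C) ∪ bdryCircle C k c (xi02 C)) ∧
    -- two pieces glued along a curve have equal `C`, and either they coincide or they are glued
    -- along a common boundary circle, with opposite signs and with phases as in the recursion
    (∀ (C C' : ℝ) (k l : ℤ) (c c' : ℝ) (γ : ℝ → E4) (a b : ℝ),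
      critC < C → critC < C' → a < b →
      GluedAlong (piece C k c) (piece C' l c') γ a b →
      C = C' ∧
        ((piece C k c = piece C' l c' ∧ γ '' Ioo a b ⊆ piece C k c) ∨
          ∃ e : ℝ, (e = xi01 C ∨ e = xi02 C) ∧
            γ '' Ioo a b ⊆ bdryCircle C k c e ∩ bdryCircle C' l c' e ∧
            Odd (k + l) ∧ c' ≡ -2 * zeta0 C e - c [PMOD (2 * Real.pi)])) ∧
    -- conversely, under these conditions the pieces are glued along the whole boundary circle
    (∀ (C : ℝ) (k l : ℤ) (c c' e : ℝ),
      critC < C → (e = xi01 C ∨ e = xi02 C) → Odd (k + l) →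
      c' ≡ -2 * zeta0 C e - c [PMOD (2 * Real.pi)] →
      ∀ a b : ℝ, a < b →
        GluedAlong (piece C k c) (piece C l c') (fun θ => pieceMap C k c (e, θ)) a b) ∧
    -- the same rigidity when the second piece is moved by an arbitrary isometry of the sphere
    (∀ (C C' : ℝ) (k l : ℤ) (c c' : ℝ) (A : E4 ≃ₗᵢ[ℝ] E4) (γ : ℝ → E4) (a b : ℝ),
      critC < C → critC < C' → a < b →
      GluedAlong (piece C k c) (A '' piece C' l c') γ a b →
      C = C' ∧
        ((piece C k c = A '' piece C' l c' ∧ γ '' Ioo a b ⊆ piece C k c) ∨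
          ∃ e : ℝ, (e = xi01 C ∨ e = xi02 C) ∧
            γ '' Ioo a b ⊆ bdryCircle C k c e ∩ A '' bdryCircle C' l c' e ∧
            A '' piece C' l c' = piece C (k + 1) (-2 * zeta0 C e - c))) ∧
    -- the maps `Φ_{C, C*}` are complete biconservative surfaces obtained by gluing pieces
    (∀ (C Cs : ℝ) (c : ℤ → ℝ), critC < C → AdmissibleStar C Cs → PhaseRec C c →
      IsCompleteImmersion (Phi C Cs c) ∧ IsBiconservative (Phi C Cs c) ∧
      IsPieceChain (Phi C Cs c) (node C Cs) (fun _ => C) c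
        (fun _ => LinearIsometryEquiv.refl ℝ E4)) ∧
    -- uniqueness: every complete surface obtained by gluing pieces has one and the same `C` on all
    -- pieces, the phases of pieces in standard position satisfy the recursion, and the surface
    -- is, up to an isometry of the sphere, a reparametrization of `Φ_{C, C*}`, for each `C*`
    (∀ (Ψ : ℝ × ℝ → E4) (t : ℤ → ℝ) (Cc c : ℤ → ℝ) (A : ℤ → E4 ≃ₗᵢ[ℝ] E4),
      IsCompleteImmersion Ψ → IsPieceChain Ψ t Cc c A →
      (∀ k, Cc k = Cc 0) ∧
      ((∀ k, A k = LinearIsometryEquiv.refl ℝ E4) →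
        PhaseRec (Cc 0) c ∨ PhaseRec (Cc 0) (fun k => c (-k))) ∧
      ∀ Cs : ℝ, AdmissibleStar (Cc 0) Cs →
        ∃ c' : ℤ → ℝ, c' 0 = c 0 ∧ PhaseRec (Cc 0) c' ∧
          ∃ ω : (ℝ × ℝ) ≃ₜ (ℝ × ℝ), ContDiff ℝ 3 ω ∧ ContDiff ℝ 3 ω.symm ∧
            ∀ p, Ψ p = A 0 (Phi (Cc 0) Cs c' (ω p))) := by
  refine ⟨fun C k c hC => boundary_piece hC k c, ?_, ?_, ?_, ?_, ?_⟩
  · intro C C' k l c c' γ a b hC hC' hab h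
    have h' : GluedAlong (piece C k c) (LinearIsometryEquiv.refl ℝ E4 '' piece C' l c') γ a b := by
      simpa using h
    obtain ⟨rfl, h1⟩ := h'.carriesPiece hC hC' hab
    refine ⟨rfl, h1.imp (fun h2 => ⟨?_, h2.2⟩) ?_⟩
    · simpa using h2.1.image_piece.symm
    · rintro ⟨e, he, hsub, hcar⟩
      obtain ⟨hpar, hphase⟩ := hcar.phase_eq hC
      exact ⟨e, he, by simpa using hsub, by rw [← Int.not_even_iff_odd]; intro h3; grind, hphase⟩
  · intro C k l c c' e hC he hkl hcc a b _
    exact gluedAlong_of_phase hC he hkl hcc a b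
  · intro C C' k l c c' A γ a b hC hC' hab h
    obtain ⟨rfl, h1⟩ := h.carriesPiece hC hC' hab
    refine ⟨rfl, h1.imp (fun h2 => ⟨h2.1.image_piece.symm, h2.2⟩) ?_⟩
    rintro ⟨e, he, hsub, hcar⟩
    exact ⟨e, he, hsub, hcar.image_piece⟩
  · intro C Cs c hC hCs hc
    have hS := hCs.regularStar hC
    have h1 := (profile hC hS hc).isCompleteImmersion_Y
    have h2 := (profile hC hS hc).isBiconservative_Y
    rw [profile_Y] at h1 h2
    exact ⟨h1, h2, isPieceChain_Phi hC hS hc⟩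
  · exact fun Ψ t Cc c A hΨ h => h.uniqueness hΨ
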